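/- A Minsky machine is a nondeterministic device with a finite state space, a designated initial state, a designated final state, and two counters with values in $\mathbb N$ that can be incremented, decremented (only when positive) and tested for zero. An accepting run is a finite nonempty sequence of configurations, consecutive ones being related by a transition, which begins in the initial state with both counters equal to zero and ends in the final state. A vector $(c_1,\ldots,c_{2\ell})$ of natural numbers describes a run with $\ell$ configurations if $c_{2i-1},c_{2i}$ are the values of the two counters in the $i$-th configuration, for $i=1,\ldots,\ell$. MSO+U is monadic second-order logic over infinite words (with the order on positions, and a predicate for every letter) extended by the quantifier $\mathsf U X.\,\varphi(X)$, which says that $\varphi(X)$ holds for finite sets $X$ of arbitrarily large size. For a word $w\in\{1,2,3,4\}^\omega$ with infinitely many 1's, $\mathrm{tree}(w)$ is the following sequence of trees of depth $4$. The leaves (the nodes of depth 4) are the positions with label $4$, and two leaves $x\neq y$ have a common ancestor at depth $i\in\{1,2,3\}$ if and only if no position between $x$ and $y$ has a label in $\{1,\ldots,i\}$. Every node has a leaf below it, the roots have depth 1, siblings are ordered by position, and the degree of a node is the number of its children. **Lemma.** For every Minsky machine $M$ one can compute a sentence $\varphi_M$ of MSO+U which defines the set of words $w\in\{1,2,3,4\}^\omega$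 that have infinitely many 1's, for which $\mathrm{tree}(w)$ is an infinite sequence of trees, and for which there are $d\in\mathbb N$ and $n_1,\ldots,n_d\ge 1$ such that: (a) the degree of depth 3 nodes tends to infinity, i.e. for every $k$ all but finitely many depth 3 nodes have degree at least $k$; (b) all but finitely many depth 1 nodes have degree $d$; (c) for every $i\in\{1,\ldots,d\}$, all but finitely many depth 2 nodes which are an $i$-th child have degree $n_i$; (d) the vector $(n_1-1,\ldots,n_d-1)$ describes some accepting run of $M$. In particular, $\varphi_M$ is satisfied by some word $w\in\{1,2,3,4\}^\omega$ if and only if $M$ has an accepting run. -/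

import Mathlib

/-! ## The logic MSO+U on infinite words over the alphabet `{1,2,3,4}`

The letter `k ∈ {1,…,n}` is represented by the element of `Fin n` with value `k - 1`. -/

/-- The number in `{1,…,n}` carried by position `x` of the word `w`. -/
def labelAt {n : ℕ} (w : ℕ → Fin n) (x : ℕ) : ℕ := (w x).val + 1

/-- Syntax of MSO+U over the alphabet `{1,2,3,4}`. Element variables and set variables are
numbered separately by natural numbers; `unb X φ` is the formula `U X. φ`. The remaining
connectives and quantifiers are the usual abbreviations. -/
inductive MSOU : Type
  | le (x y : ℕ) : MSOU
  | mem (x X : ℕ) : MSOU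
  | label (a : Fin 4) (x : ℕ) : MSOU
  | neg (φ : MSOU) : MSOU
  | conj (φ ψ : MSOU) : MSOU
  | exElem (x : ℕ) (φ : MSOU) : MSOU
  | exSet (X : ℕ) (φ : MSOU) : MSOU
  | unb (X : ℕ) (φ : MSOU) : MSOU

namespace MSOU

/-- Satisfaction in the word `w`, for a valuation `ν` of the element variables by positions and
a valuation `μ` of the set variables by (possibly infinite) sets of positions. -/
def Sat (w : ℕ → Fin 4) : MSOU → (ℕ → ℕ) → (ℕ → Set ℕ) → Prop
  | le x y, ν, _ => ν x ≤ ν y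
  | mem x X, ν, μ => ν x ∈ μ X
  | label a x, ν, _ => w (ν x) = a
  | neg φ, ν, μ => ¬ Sat w φ ν μ
  | conj φ ψ, ν, μ => Sat w φ ν μ ∧ Sat w ψ ν μ
  | exElem x φ, ν, μ => ∃ p : ℕ, Sat w φ (Function.update ν x p) μ
  | exSet X φ, ν, μ => ∃ S : Set ℕ, Sat w φ ν (Function.update μ X S)
  | unb X φ, ν, μ =>
      ∀ k : ℕ, ∃ S : Finset ℕ, k ≤ S.card ∧ Sat w φ ν (Function.update μ X (S : Set ℕ))

/-- Free element variables. -/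
def freeElem : MSOU → Finset ℕ
  | le x y => {x, y}
  | mem x _ => {x}
  | label _ x => {x}
  | neg φ => freeElem φ
  | conj φ ψ => freeElem φ ∪ freeElem ψ
  | exElem x φ => (freeElem φ).erase x
  | exSet _ φ => freeElem φ
  | unb _ φ => freeElem φ

/-- Free set variables. -/
def freeSet : MSOU → Finset ℕ
  | le _ _ => ∅
  | mem _ X => {X}
  | label _ _ => ∅
  | neg φ => freeSet φ
  | conj φ ψ => freeSet φ ∪ freeSet ψ
  | exElem _ φ => freeSet φ
  | exSet X φ => (freeSet φ).erase X
  | unb X φ => (freeSet φ).erase X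

/-- A sentence is a formula without free variables. -/
def IsSentence (φ : MSOU) : Prop := φ.freeElem = ∅ ∧ φ.freeSet = ∅

/-- `w ⊨ φ`. It is used for sentences only, whose truth value does not depend on the valuation. -/
def Models (w : ℕ → Fin 4) (φ : MSOU) : Prop := Sat w φ (fun _ => 0) (fun _ => ∅)

/-- Gödel numbering of formulas. -/
def code : MSOU → ℕ
  | le x y => 11 * Nat.pair x y
  | mem x X => 11 * Nat.pair x X + 1
  | label a x => 11 * x + (2 + a.val)
  | neg φ => 11 * code φ + 6
  | conj φ ψ => 11 * Nat.pair (code φ) (code ψ) + 7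
  | exElem x φ => 11 * Nat.pair x (code φ) + 8
  | exSet X φ => 11 * Nat.pair X (code φ) + 9
  | unb X φ => 11 * Nat.pair X (code φ) + 10

/-- The formula with a given Gödel number. -/
def ofCode (m : ℕ) : MSOU :=
  if m % 11 = 0 then le (Nat.unpair (m / 11)).1 (Nat.unpair (m / 11)).2
  else if m % 11 = 1 then mem (Nat.unpair (m / 11)).1 (Nat.unpair (m / 11)).2
  else if m % 11 < 6 then label (Fin.ofNat 4 (m % 11 - 2)) (m / 11)
  else if m % 11 = 6 then neg (ofCode (m / 11))
  else if m % 11 = 7 then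
    conj (ofCode (Nat.unpair (m / 11)).1) (ofCode (Nat.unpair (m / 11)).2)
  else if m % 11 = 8 then exElem (Nat.unpair (m / 11)).1 (ofCode (Nat.unpair (m / 11)).2)
  else if m % 11 = 9 then exSet (Nat.unpair (m / 11)).1 (ofCode (Nat.unpair (m / 11)).2)
  else unb (Nat.unpair (m / 11)).1 (ofCode (Nat.unpair (m / 11)).2)
  termination_by m
  decreasing_by
    all_goals
      have h1 := Nat.unpair_left_le (m / 11)
      have h2 := Nat.unpair_right_le (m / 11)
      omega

theorem ofCode_code (φ : MSOU) : ofCode φ.code = φ := by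
  induction φ with
  | label a x =>
    have ha := a.isLt
    have h1 : (11 * x + (2 + a.val)) % 11 = 2 + a.val := by omega
    have h2 : (11 * x + (2 + a.val)) / 11 = x := by omega
    rw [code, ofCode, h1, h2]
    rw [if_neg (by omega), if_neg (by omega), if_pos (by omega)]
    congr 1
    apply Fin.ext
    simp [Fin.ofNat]
  | _ => rw [code, ofCode]; simp [Nat.mul_add_div, *]

theorem code_ofCode (m : ℕ) : (ofCode m).code = m := by
  induction m using Nat.strong_induction_on with
  | _ m ih =>
    have h1 := Nat.unpair_left_le (m / 11)
    have h2 := Nat.unpair_right_le (m / 11)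
    rw [ofCode]
    split_ifs
    · simp only [code, Nat.pair_unpair]; omega
    · simp only [code, Nat.pair_unpair]; omega
    · simp only [code, Fin.ofNat]; omega
    · rw [code, ih _ (by omega)]; omega
    · rw [code, ih _ (by omega), ih _ (by omega), Nat.pair_unpair]; omega
    · rw [code, ih _ (by omega), Nat.pair_unpair]; omega
    · rw [code, ih _ (by omega), Nat.pair_unpair]; omega
    · rw [code, ih _ (by omega), Nat.pair_unpair]; omega

/-- The Gödel numbering is a bijection. -/
def equivNat : MSOU ≃ ℕ := ⟨code, ofCode, ofCode_code, code_ofCode⟩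

instance : Primcodable MSOU := Primcodable.ofEquiv ℕ equivNat

end MSOU

/-! ## Minsky machines -/

/-- The operations performed on a counter: increment, decrement, and the two outcomes of a test
for zero. -/
inductive CounterOp : Type
  | inc : CounterOp
  | dec : CounterOp
  | isZero : CounterOp
  | isPos : CounterOp

/-- Numbering of the operations, as needed to speak of computable functions. -/
def CounterOp.equivFin : CounterOp ≃ Fin 4 where
  toFun o := match o with
    | .inc => 0
    | .dec => 1
    | .isZero => 2
    | .isPos => 3
  invFun i := match i with
    | 0 => .inc
    | 1 => .dec
    | 2 => .isZero
    | 3 => .isPos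
  left_inv o := by cases o <;> rfl
  right_inv i := by fin_cases i <;> rfl

instance : Primcodable CounterOp := Primcodable.ofEquiv (Fin 4) CounterOp.equivFin

/-- A nondeterministic two-counter Minsky machine. States are named by natural numbers; the state
space is the finite set of states that occur in `init`, `final` or `trans`. A transition
`(q, c, o, q')` goes from state `q` to state `q'` and performs the operation `o` on counter `c`. -/
structure MinskyMachine : Type where
  init : ℕ
  final : ℕ
  trans : List (ℕ × Fin 2 × CounterOp × ℕ)

/-- A machine is given to an algorithm as the tuple of its components. -/
def MinskyMachine.equivProd :
    MinskyMachine ≃ ℕ × ℕ × List (ℕ × Fin 2 × CounterOp × ℕ) where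
  toFun M := (M.init, M.final, M.trans)
  invFun t := ⟨t.1, t.2.1, t.2.2⟩
  left_inv _ := rfl
  right_inv _ := rfl

instance : Primcodable MinskyMachine := Primcodable.ofEquiv _ MinskyMachine.equivProd

/-- A configuration: a state and the values of the two counters. -/
structure MinskyConfig : Type where
  state : ℕ
  val : Fin 2 → ℕ

/-- The effect of an operation on counter `c`, from counter values `u` to counter values `v`. -/
def CounterOp.Exec (c : Fin 2) (u v : Fin 2 → ℕ) : CounterOp → Prop
  | .inc => v = Function.update u c (u c + 1)
  | .dec => 0 < u c ∧ v = Function.update u c (u c - 1)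
  | .isZero => u c = 0 ∧ v = u
  | .isPos => 0 < u c ∧ v = u

namespace MinskyMachine

/-- One step of the machine. -/
def Step (M : MinskyMachine) (s t : MinskyConfig) : Prop :=
  ∃ (c : Fin 2) (o : CounterOp), (s.state, c, o, t.state) ∈ M.trans ∧ o.Exec c s.val t.val

/-- `ρ`, a list of configurations, is an accepting run: it begins in the initial state with zero
on both counters, consecutive configurations are related by a step, and it ends in the final
state. -/
def IsAcceptingRun (M : MinskyMachine) (ρ : List MinskyConfig) : Prop :=
  ρ.head? = some ⟨M.init, fun _ => 0⟩ ∧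
  ρ.IsChain M.Step ∧
  ∃ s ∈ ρ.getLast?, s.state = M.final

end MinskyMachine

/-- The vector `v` describes the run `ρ`: it lists the values of the first and of the second
counter in the first configuration, then in the second configuration, and so on. -/
def Describes {d : ℕ} (v : Fin d → ℕ) (ρ : List MinskyConfig) : Prop :=
  List.ofFn v = ρ.flatMap (fun s => [s.val 0, s.val 1])

/-! ## The sequence of trees of a word in `{1,…,n}^ω`

The leaves are the positions with label `n`. A node is represented, together with its depth
`i ∈ {1,…,n}`, by the set of leaves below it. -/

section Tree

variable {n : ℕ}

/-- The letter `1` occurs infinitely often. -/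
def HasInfinitelyManyOnes (w : ℕ → Fin n) : Prop := {x | labelAt w x = 1}.Infinite

/-- `x` is a leaf of the sequence of trees. -/
def IsLeaf (w : ℕ → Fin n) (x : ℕ) : Prop := labelAt w x = n

/-- The leaves `x` and `y` have a common ancestor at depth `i` (a node being an ancestor of
itself): either they are the same leaf, or `i < n` and no position between them has a label in
`{1,…,i}`. -/
def SameAncestor (w : ℕ → Fin n) (i x y : ℕ) : Prop :=
  x = y ∨ (i < n ∧ ∀ z, min x y < z → z < max x y → i < labelAt w z)

/-- `v` is (the set of leaves of) a node of depth `i`. -/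
def IsNode (w : ℕ → Fin n) (i : ℕ) (v : Set ℕ) : Prop :=
  ∃ x, IsLeaf w x ∧ v = {y | IsLeaf w y ∧ SameAncestor w i x y}

/-- The children of the node `v` of depth `i`. -/
def children (w : ℕ → Fin n) (i : ℕ) (v : Set ℕ) : Set (Set ℕ) :=
  {u | IsNode w (i + 1) u ∧ u ⊆ v}

/-- The degree of the node `v` of depth `i`. When `1` occurs infinitely often, every node has
finitely many children. -/
noncomputable def degree (w : ℕ → Fin n) (i : ℕ) (v : Set ℕ) : ℕ := (children w i v).ncard

/-- `u` is to the left of `v`. -/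
def LeftOf (u v : Set ℕ) : Prop := ∀ x ∈ u, ∀ y ∈ v, x < y

/-- `u` is a `k`-th child (`k = 1, 2, …`) of some node of depth `i`: exactly `k - 1` of its
siblings are to the left of it. -/
def IsKthChild (w : ℕ → Fin n) (i k : ℕ) (u : Set ℕ) : Prop :=
  ∃ v, IsNode w i v ∧ u ∈ children w i v ∧
    {u' | u' ∈ children w i v ∧ LeftOf u' u}.ncard + 1 = k

/-- `tree(w)` is an infinite sequence of trees, that is, it has infinitely many roots. -/
def HasInfinitelyManyTrees (w : ℕ → Fin n) : Prop := {v | IsNode w 1 v}.Infinite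

/-- The degree of depth `i` nodes tends to infinity. -/
def DegreeTendsToInfinity (w : ℕ → Fin n) (i : ℕ) : Prop :=
  ∀ m : ℕ, {v | IsNode w i v ∧ degree w i v < m}.Finite

/-- All but finitely many depth 1 nodes have degree `d`. -/
def RootDegreeEventually (w : ℕ → Fin n) (d : ℕ) : Prop :=
  {v | IsNode w 1 v ∧ degree w 1 v ≠ d}.Finite

/-- All but finitely many depth 2 nodes which are a `k`-th child have degree `m`. -/
def KthChildDegreeEventually (w : ℕ → Fin n) (k m : ℕ) : Prop :=
  {u | IsKthChild w 1 k u ∧ degree w 2 u ≠ m}.Finite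

end Tree

/-- The language of words that encode an accepting run of `M`. The index `i : Fin d` stands for
the number `i + 1 ∈ {1,…,d}`. -/
def EncodesAcceptingRun (M : MinskyMachine) (w : ℕ → Fin 4) : Prop :=
  HasInfinitelyManyOnes w ∧ HasInfinitelyManyTrees w ∧
  DegreeTendsToInfinity w 3 ∧
  ∃ (d : ℕ) (m : Fin d → ℕ),
    RootDegreeEventually w d ∧
    (∀ i : Fin d, KthChildDegreeEventually w (i.val + 1) (m i)) ∧
    (∀ i : Fin d, 1 ≤ m i) ∧
    ∃ ρ : List MinskyConfig, M.IsAcceptingRun ρ ∧ Describes (fun i => m i - 1) ρ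

/-! The difficulty is to compare numbers: MSO cannot say that two finite sets in a tree have equal
size, and `U` only distinguishes bounded from unbounded. The device is that of asymptotic mixes. Let
`A s` and `B s` be finite blocks of columns, each column being a finite set, with column sizes
tending to infinity. Intersecting with a set `P` prunes the columns, and selecting at most one
column per block yields a sequence of numbers, of which `U` sees only the index sets on which it is
bounded. `MixLE A B` says that for every pruning of `A` some pruning of `B` matches every selection
from `A`, asymptotically, by a selection from `B`.

If the blocks of `A` have bounded size, this holds exactly when `A s` has at most as many columns as
`B s` for almost all `s` (`mixLE_iff`). If the counts allow it, the pruning is copied along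
injections from `A s` to `B s`. Otherwise `A s` has a fixed size `b`, larger than that of `B s`, for
infinitely many `s`; prune so that all vectors of length `b` occur. A vector with sufficiently
separated coordinates must be matched by `b` pairwise different nonzero numbers
(`exists_injective_of_asymptotic`), hence by `b` different columns of `B s`, which do not exist.

In a tree the columns are depth 2 or depth 3 nodes with the leaves below them. Comparing a family of
blocks with its shift to the next root says that a bounded sequence is eventually nondecreasing,
that is, eventually constant. Applied to root degrees, to places of marked children and to their
degrees, this pins down `d` and the `n_i` (`exists_eventualDegrees_iff`). Comparing the children of
siblings within one tree, with or without the first child, expresses that two counter values are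
equal or differ by one, hence the effect of every operation (`Regular.performsOp_iff`).

Almost all trees then carry the same vector, and only the states of a run remain to be found. This
is reachability, in least fixed point form: every family of node sets, one per state, that contains
the initial configurations and is closed under correctly performed transitions contains the final
ones (`ReachesFinal`).

The sentence is assembled from finitely many fixed formulas by recursion on the list of transitions,
so it is computable. For the equivalence between satisfiability and acceptance, a word with
prescribed degrees is constructed explicitly. -/

/-! ### Definable properties of words and valuations -/

namespace MSOU

/-- A property of words and valuations is definable if it is expressed by a formula whose free
element variables are below `n` and whose free set variables are below `m`. -/
def Def (n m : ℕ) (P : (ℕ → Fin 4) → (ℕ → ℕ) → (ℕ → Set ℕ) → Prop) : Prop :=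
  ∃ φ : MSOU, φ.freeElem ⊆ Finset.range n ∧ φ.freeSet ⊆ Finset.range m ∧
    ∀ w ν μ, Sat w φ ν μ ↔ P w ν μ

namespace Def

variable {n m : ℕ} {P Q : (ℕ → Fin 4) → (ℕ → ℕ) → (ℕ → Set ℕ) → Prop}

theorem congr (h : Def n m P) (hPQ : ∀ w ν μ, P w ν μ ↔ Q w ν μ) : Def n m Q := by
  obtain ⟨φ, h1, h2, h3⟩ := h
  exact ⟨φ, h1, h2, fun w ν μ => (h3 w ν μ).trans (hPQ w ν μ)⟩

theorem not (h : Def n m P) : Def n m (fun w ν μ => ¬ P w ν μ) := by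
  obtain ⟨φ, h1, h2, h3⟩ := h
  exact ⟨.neg φ, h1, h2, fun w ν μ => not_congr (h3 w ν μ)⟩

theorem and (h : Def n m P) (h' : Def n m Q) : Def n m (fun w ν μ => P w ν μ ∧ Q w ν μ) := by
  obtain ⟨φ, h1, h2, h3⟩ := h
  obtain ⟨ψ, k1, k2, k3⟩ := h'
  exact ⟨.conj φ ψ, Finset.union_subset h1 k1, Finset.union_subset h2 k2,
    fun w ν μ => and_congr (h3 w ν μ) (k3 w ν μ)⟩

theorem or (h : Def n m P) (h' : Def n m Q) : Def n m (fun w ν μ => P w ν μ ∨ Q w ν μ) :=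
  (h.not.and h'.not).not.congr fun w ν μ => by tauto

theorem imp (h : Def n m P) (h' : Def n m Q) : Def n m (fun w ν μ => P w ν μ → Q w ν μ) :=
  (h.and h'.not).not.congr fun w ν μ => by tauto

theorem iff (h : Def n m P) (h' : Def n m Q) : Def n m (fun w ν μ => P w ν μ ↔ Q w ν μ) :=
  ((h.imp h').and (h'.imp h)).congr fun w ν μ => by tauto

/-- The bound variable is always the first one out of scope, `n`. The condition `hP` says that `P`
sees it only through its last argument, so overwriting its value loses nothing. -/
theorem ex {P : (ℕ → Fin 4) → (ℕ → ℕ) → (ℕ → Set ℕ) → ℕ → Prop}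
    (h : Def (n + 1) m (fun w ν μ => P w ν μ (ν n)))
    (hP : ∀ w ν μ p, P w (Function.update ν n p) μ p = P w ν μ p := by
      intros; simp (disch := omega) only [Function.update_of_ne]) :
    Def n m (fun w ν μ => ∃ p, P w ν μ p) := by
  obtain ⟨φ, h1, h2, h3⟩ := h
  refine ⟨.exElem n φ, ?_, h2, fun w ν μ => ?_⟩
  · intro x hx
    have := h1 (Finset.mem_of_mem_erase hx)
    have := Finset.ne_of_mem_erase hx
    simp only [Finset.mem_range] at *
    omega
  · simp only [Sat, h3, Function.update_self, hP]

theorem all {P : (ℕ → Fin 4) → (ℕ → ℕ) → (ℕ → Set ℕ) → ℕ → Prop}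
    (h : Def (n + 1) m (fun w ν μ => P w ν μ (ν n)))
    (hP : ∀ w ν μ p, P w (Function.update ν n p) μ p = P w ν μ p := by
      intros; simp (disch := omega) only [Function.update_of_ne]) :
    Def n m (fun w ν μ => ∀ p, P w ν μ p) :=
  (ex (P := fun w ν μ p => ¬ P w ν μ p) h.not (by intros; rw [hP])).not.congr
    fun w ν μ => by push Not; rfl

theorem exSet {P : (ℕ → Fin 4) → (ℕ → ℕ) → (ℕ → Set ℕ) → Set ℕ → Prop}
    (h : Def n (m + 1) (fun w ν μ => P w ν μ (μ m)))
    (hP : ∀ w ν μ S, P w ν (Function.update μ m S) S = P w ν μ S := by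
      intros; simp (disch := omega) only [Function.update_of_ne]) :
    Def n m (fun w ν μ => ∃ S, P w ν μ S) := by
  obtain ⟨φ, h1, h2, h3⟩ := h
  refine ⟨.exSet m φ, h1, ?_, fun w ν μ => ?_⟩
  · intro x hx
    have := h2 (Finset.mem_of_mem_erase hx)
    have := Finset.ne_of_mem_erase hx
    simp only [Finset.mem_range] at *
    omega
  · simp only [Sat, h3, Function.update_self, hP]

theorem allSet {P : (ℕ → Fin 4) → (ℕ → ℕ) → (ℕ → Set ℕ) → Set ℕ → Prop}
    (h : Def n (m + 1) (fun w ν μ => P w ν μ (μ m)))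
    (hP : ∀ w ν μ S, P w ν (Function.update μ m S) S = P w ν μ S := by
      intros; simp (disch := omega) only [Function.update_of_ne]) :
    Def n m (fun w ν μ => ∀ S, P w ν μ S) :=
  (exSet (P := fun w ν μ p => ¬ P w ν μ p) h.not (by intros; rw [hP])).not.congr
    fun w ν μ => by push Not; rfl

theorem unb (P : (ℕ → Fin 4) → (ℕ → ℕ) → (ℕ → Set ℕ) → Set ℕ → Prop)
    (h : Def n (m + 1) (fun w ν μ => P w ν μ (μ m)))
    (hP : ∀ w ν μ S, P w ν (Function.update μ m S) S = P w ν μ S := by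
      intros; simp (disch := omega) only [Function.update_of_ne]) :
    Def n m (fun w ν μ => ∀ k, ∃ S : Finset ℕ, k ≤ S.card ∧ P w ν μ (S : Set ℕ)) := by
  obtain ⟨φ, h1, h2, h3⟩ := h
  refine ⟨.unb m φ, h1, ?_, fun w ν μ => ?_⟩
  · intro x hx
    have := h2 (Finset.mem_of_mem_erase hx)
    have := Finset.ne_of_mem_erase hx
    simp only [Finset.mem_range] at *
    omega
  · simp only [Sat, h3, Function.update_self, hP]

theorem mem {x X : ℕ} (hx : x < n) (hX : X < m) : Def n m (fun _ ν μ => ν x ∈ μ X) :=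
  ⟨.mem x X, by simpa [freeElem] using hx, by simpa [freeSet] using hX, fun _ _ _ => Iff.rfl⟩

theorem le {x y : ℕ} (hx : x < n) (hy : y < n) : Def n m (fun _ ν _ => ν x ≤ ν y) :=
  ⟨.le x y, by simp [freeElem, Finset.insert_subset_iff, hx, hy], by simp [freeSet],
    fun _ _ _ => Iff.rfl⟩

theorem lt {x y : ℕ} (hx : x < n) (hy : y < n) : Def n m (fun _ ν _ => ν x < ν y) :=
  (le hy hx).not.congr fun _ _ _ => by simp

theorem eq {x y : ℕ} (hx : x < n) (hy : y < n) : Def n m (fun _ ν _ => ν x = ν y) :=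
  ((le hx hy).and (le hy hx)).congr fun _ _ _ => by omega

theorem const_true : Def n m (fun _ _ _ => True) :=
  ⟨.neg (.exElem 0 (.neg (.le 0 0))), by simp [freeElem], by simp [freeSet], by simp [Sat]⟩

/-- Only the existence of a formula matters, so it may be chosen according to the truth value of
`p`. This absorbs side conditions on parameters such as depths. -/
theorem const (p : Prop) : Def n m (fun _ _ _ => p) := by
  by_cases hp : p
  · exact const_true.congr fun _ _ _ => by simp [hp]
  · exact const_true.not.congr fun _ _ _ => by simp [hp]

theorem letter {x : ℕ} (hx : x < n) (p : Fin 4 → Prop) : Def n m (fun w ν _ => p (w (ν x))) := by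
  have h : ∀ a : Fin 4, Def n m (fun w ν _ => w (ν x) = a ∧ p a) := fun a =>
    and ⟨.label a x, by simpa [freeElem] using hx, by simp [freeSet], fun _ _ _ => Iff.rfl⟩
      (const (p a))
  refine ((h 0).or ((h 1).or ((h 2).or (h 3)))).congr fun w ν _ => ?_
  constructor
  · rintro (⟨h, h'⟩ | ⟨h, h'⟩ | ⟨h, h'⟩ | ⟨h, h'⟩) <;> rwa [h]
  · intro h
    generalize w (ν x) = a at *
    fin_cases a <;> simp_all

theorem isLeaf {x : ℕ} (hx : x < n) : Def n m (fun w ν _ => IsLeaf w (ν x)) :=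
  letter hx fun a => a.val + 1 = 4

theorem sameAncestor (i : ℕ) {x y : ℕ} (hx : x < n) (hy : y < n) :
    Def n m (fun w ν _ => SameAncestor w i (ν x) (ν y)) := by
  refine ((eq hx hy).or ((const (i < 4)).and (all (P := fun w ν _ z =>
    ((ν x < z ∨ ν y < z) → (z < ν x ∨ z < ν y) → i < labelAt w z)) ?_))).congr fun w ν _ => ?_
  · exact imp (or (lt (by omega) (by omega)) (lt (by omega) (by omega)))
      (imp (or (lt (by omega) (by omega)) (lt (by omega) (by omega)))
      (letter (by omega) fun a => i < a.val + 1))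
  · simp only [SameAncestor, min_lt_iff, lt_max_iff]

end Def

end MSOU

/-! ### Nodes represented by their first leaves -/

/-- The first leaves of the nodes of depth `i`. -/
def heads {n : ℕ} (w : ℕ → Fin n) (i : ℕ) : Set ℕ :=
  {x | IsLeaf w x ∧ ∀ y, y < x → IsLeaf w y → ¬ SameAncestor w i y x}

/-- The positions from `x` up to the next element of `H`. -/
def stretch (H : Set ℕ) (x : ℕ) : Set ℕ := {y | x ≤ y ∧ ∀ h, h ∈ H → x < h → y < h}

namespace MSOU.Def
variable {n m : ℕ}

theorem mem_heads (i : ℕ) {x : ℕ} (hx : x < n) :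
    Def n m (fun w ν _ => ν x ∈ heads w i) := by
  refine and (isLeaf hx) (all (imp (lt ?_ ?_) (imp (isLeaf ?_) (not (sameAncestor i ?_ ?_)))))
  all_goals omega

theorem mem_stretch (i : ℕ) {x y : ℕ} (hx : x < n) (hy : y < n) :
    Def n m (fun w ν _ => ν y ∈ stretch (heads w i) (ν x)) := by
  refine and (le ?_ ?_) (all (imp (mem_heads i ?_) (imp (lt ?_ ?_) (lt ?_ ?_))))
  all_goals omega
end MSOU.Def

/-! ### Asymptotic mixes and the comparison of numbers of columns -/

/-- The sets `P ∩ col c`, for `c ∈ σ ∩ A s` and `s ∈ Z`, have finite subsets of unbounded size. -/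
def Unb (A : ℕ → Set ℕ) (col : ℕ → Set ℕ) (P σ Z : Set ℕ) : Prop :=
  ∀ k, ∃ Y : Finset ℕ, k ≤ Y.card ∧ ∃ s, s ∈ Z ∧ ∃ c, c ∈ σ ∧ c ∈ A s ∧
    ∀ y, y ∈ (Y : Set ℕ) → y ∈ P ∧ y ∈ col c

/-- `σ` contains at most one element of every set of the family `A`. -/
def Selects (A : ℕ → Set ℕ) (σ : Set ℕ) : Prop :=
  ∀ s c c', c ∈ A s → c' ∈ A s → c ∈ σ → c' ∈ σ → c = c'

/-- The vectors which are obtained by pruning the columns of the family `A` are asymptotic mixes of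
vectors which are obtained by pruning the columns of the family `B`. -/
def MixLE (A B : ℕ → Set ℕ) (col : ℕ → Set ℕ) : Prop :=
  ∀ P : Set ℕ, ∃ Q : Set ℕ, ∀ σ : Set ℕ, Selects A σ → ∃ τ : Set ℕ, Selects B τ ∧
    ∀ Z : Set ℕ, Unb A col P σ Z ↔ Unb B col Q τ Z

/-- As columns are finite, `P ∩ col c` is itself the largest finite set to be tested. -/
theorem not_unb_iff {A col : ℕ → Set ℕ} {P σ Z : Set ℕ}
    (hfin : ∀ s, ∀ c ∈ A s, (col c).Finite) :
    ¬ Unb A col P σ Z ↔ ∃ k, ∀ s ∈ Z, ∀ c ∈ σ, c ∈ A s → (P ∩ col c).ncard ≤ k := by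
  unfold Unb
  push Not
  constructor
  · rintro ⟨k, hk⟩
    refine ⟨k, fun s hs c hc hcA => ?_⟩
    by_contra! hlt
    have hf : (P ∩ col c).Finite := (hfin s c hcA).inter_of_right _
    obtain ⟨y, hy, hy'⟩ := hk hf.toFinset (by rw [← Set.ncard_eq_toFinset_card _ hf]; omega)
      s hs c hc hcA
    simp only [Set.Finite.coe_toFinset] at hy
    exact hy' hy.1 hy.2
  · rintro ⟨k, hk⟩
    refine ⟨k + 1, fun Y hY s hs c hc hcA => ?_⟩
    by_contra! hsub
    have h1 : (Y : Set ℕ).ncard ≤ (P ∩ col c).ncard :=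
      Set.ncard_le_ncard (fun y hy => hsub y hy) ((hfin s c hcA).inter_of_right _)
    rw [Set.ncard_coe_finset] at h1
    have := hk s hs c hc hcA
    omega

/-- If the coordinates of a sequence of all vectors are asymptotically equivalent to the
coordinates of another sequence, then some vector of the latter has pairwise different nonzero
coordinates. -/
theorem exists_injective_of_asymptotic {b : ℕ} (f h : ℕ → Fin b → ℕ)
    (hf : Function.Surjective f)
    (hfh : ∀ j, ∀ Z : Set ℕ, (∃ k, ∀ n ∈ Z, f n j ≤ k) ↔ (∃ k, ∀ n ∈ Z, h n j ≤ k)) :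
    ∃ n, Function.Injective (h n) ∧ ∀ j, h n j ≠ 0 := by
  -- Testing on sublevel sets: a bound on one coordinate yields a bound on the other, in both
  -- directions.
  have h1 : ∀ j K, ∃ k, ∀ n, f n j ≤ K → h n j ≤ k := fun j K =>
    (hfh j {n | f n j ≤ K}).1 ⟨K, fun n hn => hn⟩
  have h2 : ∀ j K, ∃ k, ∀ n, h n j ≤ K → f n j ≤ k := fun j K =>
    (hfh j {n | h n j ≤ K}).2 ⟨K, fun n hn => hn⟩
  choose α hα using h1
  choose β hβ using h2
  -- Each `x j'` exceeds every bound `β j' (α j (x j))` coming from an earlier coordinate. At the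
  -- vector `x`, an equality `h n j = h n j'` with `j < j'` would bound `x j'` by such a number.
  -- Exceeding `β j 0` excludes the value zero.
  obtain ⟨x, hx0, hx⟩ := exists_seq_of_forall_finset_exists (fun y : ℕ => ∀ j, β j 0 < y)
    (fun y z => ∀ j j', β j' (α j y) < z) (by
      intro s _
      refine ⟨(∑ j, β j 0) + (∑ y ∈ s, ∑ j, ∑ j', β j' (α j y)) + 1, ?_, ?_⟩
      · intro j
        have := Finset.single_le_sum (f := fun j => β j 0) (fun _ _ => Nat.zero_le _)
          (Finset.mem_univ j)
        omega
      · intro y hy j j'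
        have a1 := Finset.single_le_sum (f := fun j' => β j' (α j y)) (fun _ _ => Nat.zero_le _)
          (Finset.mem_univ j')
        have a2 := Finset.single_le_sum (f := fun j => ∑ j', β j' (α j y))
          (fun _ _ => Nat.zero_le _) (Finset.mem_univ j)
        have a3 := Finset.single_le_sum (f := fun y => ∑ j, ∑ j', β j' (α j y))
          (fun _ _ => Nat.zero_le _) hy
        omega)
  obtain ⟨n, hn⟩ := hf fun j => x j
  have key : ∀ j j' : Fin b, j < j' → h n j ≠ h n j' := by
    intro j j' hjj' he
    have c1 := hα j (x j) n (by rw [hn])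
    have c2 := hβ j' (α j (x j)) n (he ▸ c1)
    have c3 := hx j j' hjj' j j'
    rw [hn] at c2
    simp only at c2
    omega
  refine ⟨n, fun j j' he => ?_, fun j h0 => ?_⟩
  · rcases lt_trichotomy j j' with hlt | heq | hgt
    · exact absurd he (key _ _ hlt)
    · exact heq
    · exact absurd he.symm (key _ _ hgt)
  · have c2 := hβ j 0 n h0.le
    have c3 := hx0 j j
    rw [hn] at c2
    simp only at c2
    omega

/-- A family of pairwise disjoint finite columns, whose sizes tend to infinity. -/
structure ColumnSystem (C : Set ℕ) (col : ℕ → Set ℕ) : Prop where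
  finite : ∀ c ∈ C, (col c).Finite
  disjoint : ∀ c ∈ C, ∀ c' ∈ C, ∀ y, y ∈ col c → y ∈ col c' → c = c'
  tendsto : ∀ m, {c | c ∈ C ∧ (col c).ncard < m}.Finite

/-- A family of pairwise disjoint finite sets of columns. -/
structure BlockFamily (C : Set ℕ) (A : ℕ → Set ℕ) : Prop where
  subset : ∀ s, A s ⊆ C
  finite : ∀ s, (A s).Finite
  disjoint : ∀ s s' c, c ∈ A s → c ∈ A s' → s = s'

/-- Outside the finite exceptional set there are injections `A s → B s`. The image of `c` is pruned
to the size of `P ∩ col c`, truncated if the target column is too short. For a given bound only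
finitely many columns are too short, so neither truncation nor the exceptional blocks affect
boundedness. -/
theorem mixLE_of_finite {C : Set ℕ} {A B col : ℕ → Set ℕ} (hC : ColumnSystem C col)
    (hA : BlockFamily C A) (hB : BlockFamily C B)
    (hfin : {s | (B s).ncard < (A s).ncard}.Finite) : MixLE A B col := by
  intro P
  have hj : ∀ s, ∃ j : ℕ → ℕ, ¬ (B s).ncard < (A s).ncard →
      Set.MapsTo j (A s) (B s) ∧ Set.InjOn j (A s) := by
    intro s
    by_cases hs : (B s).ncard < (A s).ncard
    · exact ⟨id, fun h => absurd hs h⟩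
    · have hle : (A s).encard ≤ (B s).encard := by
        rw [← (hA.finite s).cast_ncard_eq, ← (hB.finite s).cast_ncard_eq]
        exact_mod_cast not_lt.1 hs
      obtain ⟨j, hj1, hj2⟩ := (hA.finite s).exists_injOn_of_encard_le hle
      exact ⟨j, fun _ => ⟨fun c hc => hj1 hc, hj2⟩⟩
  choose j hj using hj
  have hq : ∀ s c, ∃ q : Set ℕ, q ⊆ col (j s c) ∧
      q.ncard = min (P ∩ col c).ncard (col (j s c)).ncard := by
    intro s c
    obtain ⟨q, hq1, hq2⟩ := Set.exists_subset_card_eq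
      (min_le_right (P ∩ col c).ncard (col (j s c)).ncard)
    exact ⟨q, hq1, hq2⟩
  choose q hq1 hq2 using hq
  let good : Set ℕ := {s | ¬ (B s).ncard < (A s).ncard}
  let Q : Set ℕ := {y | ∃ s ∈ good, ∃ c ∈ A s, y ∈ q s c}
  have hQ : ∀ s ∈ good, ∀ c ∈ A s, Q ∩ col (j s c) = q s c := by
    intro s hs c hc
    ext y
    constructor
    · rintro ⟨⟨s', hs', c', hc', hy⟩, hy'⟩
      have e1 := hC.disjoint _ (hB.subset _ ((hj s hs).1 hc)) _
        (hB.subset _ ((hj s' hs').1 hc')) y hy' (hq1 _ _ hy)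
      have e2 : s = s' := hB.disjoint _ _ _ ((hj s hs).1 hc) (e1 ▸ (hj s' hs').1 hc')
      subst e2
      have e3 := (hj s hs).2 hc hc' e1
      subst e3
      exact hy
    · exact fun hy => ⟨⟨s, hs, c, hc, hy⟩, hq1 _ _ hy⟩
  refine ⟨Q, fun σ hσ => ⟨{c | ∃ s ∈ good, ∃ c' ∈ A s, c' ∈ σ ∧ c = j s c'}, ?_, fun Z => ?_⟩⟩
  · rintro s _ _ h1 h2 ⟨s1, hs1, c1, hc1, hσ1, rfl⟩ ⟨s2, hs2, c2, hc2, hσ2, rfl⟩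
    obtain rfl := hB.disjoint _ _ _ h1 ((hj s1 hs1).1 hc1)
    obtain rfl := hB.disjoint _ _ _ h2 ((hj s2 hs2).1 hc2)
    rw [hσ _ _ _ hc1 hc2 hσ1 hσ2]
  · rw [← not_iff_not, not_unb_iff (fun s c hc => hC.finite c (hA.subset s hc)),
      not_unb_iff (fun s c hc => hC.finite c (hB.subset s hc))]
    constructor
    · rintro ⟨k, hk⟩
      refine ⟨k, ?_⟩
      rintro s hs _ ⟨s', hs', c, hc, hcσ, rfl⟩ hcB
      obtain rfl := hB.disjoint _ _ _ hcB ((hj s' hs').1 hc)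
      rw [hQ _ hs' _ hc, hq2]
      exact (min_le_left _ _).trans (hk _ hs _ hcσ hc)
    · rintro ⟨k, hk⟩
      have hsmall : {c | ∃ s ∈ good, c ∈ A s ∧ (col (j s c)).ncard < k + 1}.Finite := by
        -- A column determines its block, so the maps `j s` glue to one map `J`. It is injective on
        -- the columns of good blocks, and it sends the columns in question to columns of size below
        -- `k + 1`, of which there are finitely many.
        choose! J hJ using (fun c (hc : ∃ s ∈ good, c ∈ A s) =>
          (by obtain ⟨s, h1, h2⟩ := hc; exact ⟨j s c, s, h1, h2, rfl⟩ :
            ∃ c', ∃ s ∈ good, c ∈ A s ∧ c' = j s c))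
        refine Set.Finite.of_finite_image (f := J) ((hC.tendsto (k + 1)).subset ?_) ?_
        · rintro _ ⟨c, ⟨s, hs, hc, hlt⟩, rfl⟩
          obtain ⟨s', hs', hc', he⟩ := hJ c ⟨s, hs, hc⟩
          obtain rfl := hA.disjoint _ _ _ hc hc'
          rw [he]
          exact ⟨hB.subset s ((hj s hs).1 hc), hlt⟩
        · rintro c ⟨s, hs, hc, -⟩ c' ⟨s', hs', hc', -⟩ he
          obtain ⟨t, ht, hct, e1⟩ := hJ c ⟨s, hs, hc⟩
          obtain ⟨t', ht', hct', e2⟩ := hJ c' ⟨s', hs', hc'⟩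
          rw [e1, e2] at he
          obtain rfl := hB.disjoint _ _ _ ((hj t ht).1 hct) (he ▸ (hj t' ht').1 hct')
          exact (hj t ht).2 hct hct' he
      have hbad : (⋃ s ∈ {s | (B s).ncard < (A s).ncard}, A s).Finite :=
        hfin.biUnion fun s _ => hA.finite s
      obtain ⟨k', hk'⟩ := ((hsmall.union hbad).image fun c => (P ∩ col c).ncard).bddAbove
      refine ⟨max k k', fun s hs c hcσ hc => ?_⟩
      by_cases hg : (B s).ncard < (A s).ncard
      · exact le_max_of_le_right (hk' ⟨c, Or.inr (Set.mem_biUnion hg hc), rfl⟩)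
      · by_cases hlt : (col (j s c)).ncard < k + 1
        · exact le_max_of_le_right (hk' ⟨c, Or.inl ⟨s, hg, hc, hlt⟩, rfl⟩)
        · have := hk s hs _ ⟨s, hg, c, hc, hcσ, rfl⟩ ((hj s hg).1 hc)
          rw [hQ _ hg _ hc, hq2] at this
          refine le_max_of_le_left ?_
          rcases min_le_iff.1 this with h | h
          · exact h
          · omega

/-- Were the set infinite, boundedness would give infinitely many exceptional blocks of one size
`b`. Pruning a subsequence of them to all vectors of length `b` forces some `B s` to contain `b`
different columns. -/
theorem finite_of_mixLE {C : Set ℕ} {A B col : ℕ → Set ℕ} (hC : ColumnSystem C col)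
    (hA : BlockFamily C A) (hB : BlockFamily C B) (N : ℕ) (hN : ∀ s, (A s).ncard ≤ N)
    (hle : MixLE A B col) : {s | (B s).ncard < (A s).ncard}.Finite := by
  by_contra hinf
  obtain ⟨b, hb⟩ : ∃ b, {s | (B s).ncard < (A s).ncard ∧ (A s).ncard = b}.Infinite := by
    by_contra! hall
    refine hinf (((Set.finite_Iic N).biUnion fun b _ =>
      hall b).subset fun s hs => ?_)
    exact Set.mem_biUnion (Set.mem_Iic.2 (hN s)) ⟨hs, rfl⟩
  obtain ⟨v, hv⟩ := exists_surjective_nat (Fin b → ℕ)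
  have hlarge : ∀ K, {s | ∃ c ∈ A s, (col c).ncard < K}.Finite := by
    intro K
    choose! t ht using fun c (hc : ∃ s, c ∈ A s) => hc
    refine ((hC.tendsto K).image t).subset ?_
    rintro s ⟨c, hc, hlt⟩
    exact ⟨c, ⟨hA.subset s hc, hlt⟩, hA.disjoint _ _ _ (ht c ⟨s, hc⟩) hc⟩
  -- The `n`-th chosen block has columns large enough to be pruned to the sizes in `v n`; all but
  -- finitely many blocks qualify because column sizes tend to infinity.
  obtain ⟨φ, hφ, hφ'⟩ := Filter.extraction_forall_of_frequently
    (P := fun n s => ((B s).ncard < (A s).ncard ∧ (A s).ncard = b) ∧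
      ∀ c ∈ A s, ∀ j, v n j ≤ (col c).ncard) (by
    intro n
    refine (Nat.frequently_atTop_iff_infinite.2 hb).and_eventually ?_
    rw [← Nat.cofinite_eq_atTop, Filter.eventually_cofinite]
    refine (hlarge (∑ j, v n j)).subset fun s hs => ?_
    simp only [Set.mem_ofPred_eq] at hs
    push Not at hs
    obtain ⟨c, hc, j, hj⟩ := hs
    exact ⟨c, hc, hj.trans_le
      (Finset.single_le_sum (f := v n) (fun _ _ => Nat.zero_le _) (Finset.mem_univ j))⟩)
  have he : ∀ n, ∃ e : Fin b → ℕ, Function.Injective e ∧ ∀ c, c ∈ A (φ n) ↔ ∃ j, e j = c := by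
    intro n
    have hcard : (hA.finite (φ n)).toFinset.card = b := by
      rw [← Set.ncard_eq_toFinset_card _ (hA.finite (φ n))]
      exact (hφ' n).1.2
    let E := (hA.finite (φ n)).toFinset.equivFinOfCardEq hcard
    refine ⟨fun j => E.symm j, fun j j' h => E.symm.injective (Subtype.ext h), fun c => ?_⟩
    constructor
    · intro hc
      exact ⟨E ⟨c, by simpa using hc⟩, by simp⟩
    · rintro ⟨j, rfl⟩
      exact (hA.finite (φ n)).mem_toFinset.1 (E.symm j).2
  choose e he1 he2 using he
  have heA : ∀ n j, e n j ∈ A (φ n) := fun n j => (he2 n _).2 ⟨j, rfl⟩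
  have hp : ∀ n j, ∃ p : Set ℕ, p ⊆ col (e n j) ∧ p.ncard = v n j := fun n j =>
    Set.exists_subset_card_eq ((hφ' n).2 _ (heA n j) j)
  choose p hp1 hp2 using hp
  obtain ⟨Q, hQ⟩ := hle {y | ∃ n j, y ∈ p n j}
  have hP : ∀ n j, {y | ∃ n j, y ∈ p n j} ∩ col (e n j) = p n j := by
    intro n j
    ext y
    constructor
    · rintro ⟨⟨n', j', hy⟩, hy'⟩
      have e1 := hC.disjoint _ (hA.subset _ (heA n j)) _ (hA.subset _ (heA n' j')) y hy'
        (hp1 _ _ hy)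
      obtain rfl : n = n' := hφ.injective (hA.disjoint _ _ _ (heA n j) (e1 ▸ heA n' j'))
      obtain rfl := he1 n e1
      exact hy
    · exact fun hy => ⟨⟨n, j, hy⟩, hp1 _ _ hy⟩
  -- The `j`-th selection takes the `j`-th column of every chosen block, so its pruned sizes are the
  -- `j`-th coordinates of all vectors.
  have hσ : ∀ j, Selects A {c | ∃ n, c = e n j} := by
    rintro j s _ _ h1 h2 ⟨n, rfl⟩ ⟨n', rfl⟩
    have e1 := hA.disjoint _ _ _ h1 (heA n j)
    have e2 := hA.disjoint _ _ _ h2 (heA n' j)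
    rw [hφ.injective (e1.symm.trans e2)]
  choose τ hτ hτ' using fun j => hQ _ (hσ j)
  -- The matching selection has at most one column in `B (φ n)`. The default `0` for no column makes
  -- a nonzero value evidence of a column.
  have hh : ∀ n j, ∃ h : ℕ, (∀ c ∈ τ j, c ∈ B (φ n) → (Q ∩ col c).ncard = h) ∧
      (h ≠ 0 → ∃ c ∈ τ j, c ∈ B (φ n)) := by
    intro n j
    by_cases hc : ∃ c ∈ τ j, c ∈ B (φ n)
    · obtain ⟨c, h1, h2⟩ := hc
      exact ⟨(Q ∩ col c).ncard, fun c' h1' h2' => by rw [hτ j _ _ _ h2 h2' h1 h1'],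
        fun _ => ⟨c, h1, h2⟩⟩
    · push Not at hc
      exact ⟨0, fun c h1 h2 => absurd h2 (hc c h1), fun h => absurd rfl h⟩
  choose h hh1 hh2 using hh
  obtain ⟨n, hinj, hne⟩ := exists_injective_of_asymptotic v h hv (by
    intro j Z
    have := not_iff_not.2 (hτ' j (φ '' Z))
    rw [not_unb_iff (fun s c hc => hC.finite c (hA.subset s hc)),
      not_unb_iff (fun s c hc => hC.finite c (hB.subset s hc))] at this
    constructor
    · rintro ⟨k, hk⟩
      obtain ⟨k', hk'⟩ := this.1 ⟨k, by
        rintro _ ⟨n, hn, rfl⟩ _ ⟨n', rfl⟩ hc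
        obtain rfl : n = n' := hφ.injective (hA.disjoint _ _ _ hc (heA n' j))
        rw [hP, hp2]
        exact hk n hn⟩
      refine ⟨k', fun n hn => ?_⟩
      by_cases h0 : h n j = 0
      · omega
      · obtain ⟨c, h1, h2⟩ := hh2 n j h0
        rw [← hh1 n j c h1 h2]
        exact hk' _ ⟨n, hn, rfl⟩ c h1 h2
    · rintro ⟨k, hk⟩
      obtain ⟨k', hk'⟩ := this.2 ⟨k, by
        rintro _ ⟨n, hn, rfl⟩ c hc hcB
        rw [hh1 n j c hc hcB]
        exact hk n hn⟩
      refine ⟨k', fun n hn => ?_⟩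
      have := hk' _ ⟨n, hn, rfl⟩ (e n j) ⟨n, rfl⟩ (heA n j)
      rwa [hP, hp2] at this)
  choose c hc1 hc2 using fun j => hh2 n j (hne j)
  have hcinj : Function.Injective c := fun j j' hjj' => hinj (by
    rw [← hh1 n j _ (hc1 j) (hc2 j), ← hh1 n j' _ (hc1 j') (hc2 j'), hjj'])
  have h1 : (Set.range c).ncard ≤ (B (φ n)).ncard :=
    Set.ncard_le_ncard (by rintro _ ⟨j, rfl⟩; exact hc2 j) (hB.finite _)
  rw [← Set.image_univ, Set.ncard_image_of_injective _ hcinj, Set.ncard_univ,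
    Nat.card_eq_fintype_card, Fintype.card_fin] at h1
  have := (hφ' n).1
  omega

/-- Asymptotic mixes compare the numbers of columns. -/
theorem mixLE_iff {C : Set ℕ} {A B col : ℕ → Set ℕ} (hC : ColumnSystem C col)
    (hA : BlockFamily C A) (hB : BlockFamily C B) (N : ℕ) (hN : ∀ s, (A s).ncard ≤ N) :
    MixLE A B col ↔ {s | (B s).ncard < (A s).ncard}.Finite :=
  ⟨finite_of_mixLE hC hA hB N hN, mixLE_of_finite hC hA hB⟩

/-! ### Trees in terms of first leaves -/

section Translation

variable {n : ℕ} {w : ℕ → Fin n} {i x y z : ℕ}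

theorem sameAncestor_iff_of_le (hxy : x ≤ y) : SameAncestor w i x y ↔
    x = y ∨ (i < n ∧ ∀ z, x < z → z < y → i < labelAt w z) := by
  simp only [SameAncestor, min_eq_left hxy, max_eq_right hxy]

theorem SameAncestor.symm (h : SameAncestor w i x y) : SameAncestor w i y x := by
  rwa [SameAncestor, eq_comm, min_comm, max_comm]

/-- The only position not covered by the two hypotheses is `y` itself, whose label `n` exceeds `i`.
-/
theorem SameAncestor.trans_of_le (hy : IsLeaf w y) (hxy : x ≤ y) (hyz : y ≤ z)
    (h1 : SameAncestor w i x y) (h2 : SameAncestor w i y z) : SameAncestor w i x z := by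
  rw [sameAncestor_iff_of_le hxy] at h1
  rw [sameAncestor_iff_of_le hyz] at h2
  rw [sameAncestor_iff_of_le (hxy.trans hyz)]
  rcases h1 with rfl | ⟨hi, h1⟩
  · exact h2
  rcases h2 with rfl | ⟨-, h2⟩
  · exact Or.inr ⟨hi, h1⟩
  refine Or.inr ⟨hi, fun u hu hu' => ?_⟩
  rcases lt_trichotomy u y with h | rfl | h
  · exact h1 u hu h
  · rwa [hy]
  · exact h2 u h hu'

theorem SameAncestor.left (h : SameAncestor w i x z) (hxy : x ≤ y) (hyz : y ≤ z) :
    SameAncestor w i x y := by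
  rw [sameAncestor_iff_of_le (hxy.trans hyz)] at h
  rw [sameAncestor_iff_of_le hxy]
  rcases h with rfl | ⟨hi, h⟩
  · exact Or.inl (by omega)
  · exact Or.inr ⟨hi, fun u hu hu' => h u hu (by omega)⟩

theorem SameAncestor.right (h : SameAncestor w i x z) (hxy : x ≤ y) (hyz : y ≤ z) :
    SameAncestor w i y z := by
  rw [sameAncestor_iff_of_le (hxy.trans hyz)] at h
  rw [sameAncestor_iff_of_le hyz]
  rcases h with rfl | ⟨hi, h⟩
  · exact Or.inl (by omega)
  · exact Or.inr ⟨hi, fun u hu hu' => h u (by omega) hu'⟩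

theorem SameAncestor.mono (h : SameAncestor w (i + 1) x y) : SameAncestor w i x y := by
  rcases h with h | ⟨hi, h⟩
  · exact Or.inl h
  · exact Or.inr ⟨by omega, fun z h1 h2 => by have := h z h1 h2; omega⟩

theorem heads_subset_succ : heads w i ⊆ heads w (i + 1) :=
  fun _ hx => ⟨hx.1, fun y hy hl h => hx.2 y hy hl h.mono⟩

theorem heads_self : heads w n = {x | IsLeaf w x} := by
  ext x
  refine ⟨fun h => h.1, fun h => ⟨h, fun y hy _ h' => ?_⟩⟩
  rcases h' with rfl | ⟨h', -⟩ <;> omega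

theorem exists_head (hy : IsLeaf w y) : ∃ h ∈ heads w i, h ≤ y ∧ SameAncestor w i h y := by
  classical
  have hex : ∃ x, IsLeaf w x ∧ SameAncestor w i x y := ⟨y, hy, Or.inl rfl⟩
  have hle := Nat.find_min' hex ⟨hy, Or.inl rfl⟩
  refine ⟨Nat.find hex, ⟨(Nat.find_spec hex).1, fun z hz hl hs => Nat.find_min hex hz ⟨hl, ?_⟩⟩,
    hle, (Nat.find_spec hex).2⟩
  exact hs.trans_of_le (Nat.find_spec hex).1 hz.le hle (Nat.find_spec hex).2

/-- Take the head of the node of `y`. If it is at most `x`, then `x` lies between two leaves of that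
node; otherwise it is a head that ends the stretch of `x` before `y`. -/
theorem mem_stretch_iff (hx : IsLeaf w x) (hy : IsLeaf w y) (hxy : x ≤ y) :
    y ∈ stretch (heads w i) x ↔ SameAncestor w i x y := by
  constructor
  · intro h
    obtain ⟨k, hk, hky, hs⟩ := exists_head (i := i) hy
    by_cases hkx : k ≤ x
    · exact hs.right hkx hxy
    · exact absurd (h.2 k hk (not_le.1 hkx)) (not_lt.2 hky)
  · refine fun h => ⟨hxy, fun k hk hxk => ?_⟩
    by_contra! hky
    exact hk.2 x hxk hx (h.left hxk.le hky)

/-- The set of leaves below the node of depth `i` whose first leaf is `x`. -/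
def nodeOf (w : ℕ → Fin n) (i x : ℕ) : Set ℕ := {y | IsLeaf w y ∧ y ∈ stretch (heads w i) x}

theorem self_mem_stretch {H : Set ℕ} : x ∈ stretch H x := ⟨le_rfl, fun _ _ h => h⟩

theorem self_mem_nodeOf (hx : x ∈ heads w i) : x ∈ nodeOf w i x := ⟨hx.1, self_mem_stretch⟩

theorem stretch_disjoint {H : Set ℕ} {x x' y : ℕ} (hx : x ∈ H) (hx' : x' ∈ H)
    (h : y ∈ stretch H x) (h' : y ∈ stretch H x') : x = x' := by
  rcases lt_trichotomy x x' with hlt | heq | hlt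
  · exact absurd (h.2 x' hx' hlt) (not_lt.2 h'.1)
  · exact heq
  · exact absurd (h'.2 x hx hlt) (not_lt.2 h.1)

theorem nodeOf_injOn : Set.InjOn (nodeOf w i) (heads w i) := fun x hx x' hx' h =>
  stretch_disjoint hx hx' self_mem_stretch
    (show x ∈ nodeOf w i x' from h ▸ self_mem_nodeOf hx).2

theorem nodeOf_eq (hx : x ∈ heads w i) :
    nodeOf w i x = {y | IsLeaf w y ∧ SameAncestor w i x y} := by
  ext y
  constructor
  · exact fun h => ⟨h.1, (mem_stretch_iff hx.1 h.1 h.2.1).1 h.2⟩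
  · rintro ⟨hy, h⟩
    refine ⟨hy, ?_⟩
    rcases le_or_gt x y with hxy | hxy
    · exact (mem_stretch_iff hx.1 hy hxy).2 h
    · exact absurd h.symm (hx.2 y hxy hy)

theorem isNode_iff {v : Set ℕ} : IsNode w i v ↔ ∃ x ∈ heads w i, v = nodeOf w i x := by
  constructor
  · rintro ⟨y, hy, rfl⟩
    obtain ⟨x, hx, hxy, hs⟩ := exists_head (i := i) hy
    refine ⟨x, hx, ?_⟩
    ext z
    constructor
    · rintro ⟨hz, h⟩
      refine ⟨hz, ?_⟩
      rcases le_total y z with hyz | hzy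
      · exact (mem_stretch_iff hx.1 hz (hxy.trans hyz)).2 (hs.trans_of_le hy hxy hyz h)
      · have hxz : x ≤ z := by
          by_contra! hlt
          exact hx.2 z hlt hz (h.symm.left hlt.le hxy)
        exact (mem_stretch_iff hx.1 hz hxz).2 (hs.left hxz hzy)
    · rintro ⟨hz, h⟩
      refine ⟨hz, ?_⟩
      have h' := (mem_stretch_iff hx.1 hz h.1).1 h
      rcases le_total y z with hyz | hzy
      · exact h'.right hxy hyz
      · exact (hs.right h.1 hzy).symm
  · rintro ⟨x, hx, rfl⟩
    exact ⟨x, hx.1, nodeOf_eq hx⟩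

theorem stretch_anti {H H' : Set ℕ} (h : H ⊆ H') : stretch H' x ⊆ stretch H x :=
  fun _ hy => ⟨hy.1, fun k hk => hy.2 k (h hk)⟩

theorem stretch_trans {H : Set ℕ} (hy : y ∈ stretch H x) (hz : z ∈ stretch H y) :
    z ∈ stretch H x := ⟨hy.1.trans hz.1, fun k hk hxk => hz.2 k hk (hy.2 k hk hxk)⟩

theorem nodeOf_subset_iff (hy : y ∈ heads w (i + 1)) :
    nodeOf w (i + 1) y ⊆ nodeOf w i x ↔ y ∈ stretch (heads w i) x :=
  ⟨fun h => (h (self_mem_nodeOf hy)).2, fun h _ hz =>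
    ⟨hz.1, stretch_trans h (stretch_anti heads_subset_succ hz.2)⟩⟩

theorem children_nodeOf :
    children w i (nodeOf w i x) =
      nodeOf w (i + 1) '' (heads w (i + 1) ∩ stretch (heads w i) x) := by
  ext u
  simp only [children, isNode_iff]
  constructor
  · rintro ⟨⟨y, hy, rfl⟩, hsub⟩
    exact ⟨y, ⟨hy, (nodeOf_subset_iff hy).1 hsub⟩, rfl⟩
  · rintro ⟨y, ⟨hy, hyx⟩, rfl⟩
    exact ⟨⟨y, hy, rfl⟩, (nodeOf_subset_iff hy).2 hyx⟩

/-- The first leaves of the children of the node of depth `i` with first leaf `x`. -/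
def kids (w : ℕ → Fin n) (i x : ℕ) : Set ℕ := heads w (i + 1) ∩ stretch (heads w i) x

theorem degree_nodeOf : degree w i (nodeOf w i x) = (kids w i x).ncard := by
  rw [degree, children_nodeOf, (nodeOf_injOn.mono Set.inter_subset_left).ncard_image]
  rfl

theorem leftOf_nodeOf {x x' : ℕ} (hx : x ∈ heads w i) (hx' : x' ∈ heads w i) :
    LeftOf (nodeOf w i x) (nodeOf w i x') ↔ x < x' :=
  ⟨fun h => h x (self_mem_nodeOf hx) x' (self_mem_nodeOf hx'),
    fun h _ hy _ hz => (hy.2.2 x' hx' h).trans_le hz.2.1⟩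

/-- The first leaves of the left siblings of the node of depth `i + 1` with first leaf `p`. -/
def leftKids (w : ℕ → Fin n) (i p : ℕ) : Set ℕ :=
  {y | y ∈ heads w (i + 1) ∧ y < p ∧ ∀ h, h ∈ heads w i → h ≤ p → h ≤ y}

/-- `leftKids` does not mention the parent: the absence of depth `i` heads after `y` and up to `p`
already says that `y` and `p` have the same one. -/
theorem isKthChild_nodeOf {k p : ℕ} (hp : p ∈ heads w (i + 1)) :
    IsKthChild w i k (nodeOf w (i + 1) p) ↔ (leftKids w i p).ncard + 1 = k := by
  have key : ∀ x ∈ heads w i, p ∈ stretch (heads w i) x →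
      ({u' | u' ∈ children w i (nodeOf w i x) ∧ LeftOf u' (nodeOf w (i + 1) p)}.ncard =
        (leftKids w i p).ncard) := by
    intro x hx hxp
    rw [← Set.InjOn.ncard_image (f := nodeOf w (i + 1)) (s := leftKids w i p)
      (nodeOf_injOn.mono fun y hy => hy.1)]
    congr 1
    ext u
    rw [children_nodeOf]
    constructor
    · rintro ⟨⟨y, ⟨hy, hyx⟩, rfl⟩, hl⟩
      have hyp := (leftOf_nodeOf hy hp).1 hl
      refine ⟨y, ⟨hy, hyp, fun h hh hhp => ?_⟩, rfl⟩
      by_contra! hlt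
      have : h ≤ x := by
        by_contra! hxh
        exact absurd (hxp.2 h hh hxh) (not_lt.2 hhp)
      exact absurd (hyx.1) (by omega)
    · rintro ⟨y, ⟨hy, hyp, hyh⟩, rfl⟩
      refine ⟨⟨y, ⟨hy, hyh x hx hxp.1, fun h hh hxh => ?_⟩, rfl⟩, (leftOf_nodeOf hy hp).2 hyp⟩
      exact hyp.trans (hxp.2 h hh hxh)
  constructor
  · rintro ⟨v, hv, hu, hk⟩
    obtain ⟨x, hx, rfl⟩ := isNode_iff.1 hv
    rw [← hk, key x hx ((nodeOf_subset_iff hp).1 hu.2)]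
  · intro hk
    obtain ⟨x, hx, hxp, hs⟩ := exists_head (i := i) hp.1
    have hxp' := (mem_stretch_iff hx.1 hp.1 hxp).2 hs
    refine ⟨nodeOf w i x, isNode_iff.2 ⟨x, hx, rfl⟩,
      ⟨isNode_iff.2 ⟨p, hp, rfl⟩, (nodeOf_subset_iff hp).2 hxp'⟩, ?_⟩
    rw [key x hx hxp', hk]

theorem finite_nodes_iff (q : Set ℕ → Prop) :
    {v | IsNode w i v ∧ q v}.Finite ↔ {x | x ∈ heads w i ∧ q (nodeOf w i x)}.Finite := by
  have : {v | IsNode w i v ∧ q v} = nodeOf w i '' {x | x ∈ heads w i ∧ q (nodeOf w i x)} := by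
    ext v
    constructor
    · rintro ⟨hv, hq⟩
      obtain ⟨x, hx, rfl⟩ := isNode_iff.1 hv
      exact ⟨x, ⟨hx, hq⟩, rfl⟩
    · rintro ⟨x, ⟨hx, hq⟩, rfl⟩
      exact ⟨isNode_iff.2 ⟨x, hx, rfl⟩, hq⟩
  rw [this, Set.finite_image_iff (nodeOf_injOn.mono fun x hx => hx.1)]

theorem hasInfinitelyManyTrees_iff : HasInfinitelyManyTrees w ↔ (heads w 1).Infinite := by
  simpa [HasInfinitelyManyTrees] using
    not_congr (finite_nodes_iff (w := w) (i := 1) fun _ => True)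

theorem degreeTendsToInfinity_iff : DegreeTendsToInfinity w i ↔
    ∀ m, {x | x ∈ heads w i ∧ (kids w i x).ncard < m}.Finite := by
  simp only [DegreeTendsToInfinity, finite_nodes_iff, degree_nodeOf]

theorem rootDegreeEventually_iff {d : ℕ} : RootDegreeEventually w d ↔
    {x | x ∈ heads w 1 ∧ (kids w 1 x).ncard ≠ d}.Finite := by
  simp only [RootDegreeEventually, finite_nodes_iff, degree_nodeOf]

theorem kthChildDegreeEventually_iff {k m : ℕ} : KthChildDegreeEventually w (k + 1) m ↔
    {p | p ∈ heads w 2 ∧ (leftKids w 1 p).ncard = k ∧ (kids w 2 p).ncard ≠ m}.Finite := by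
  have h1 : {u | IsKthChild w 1 (k + 1) u ∧ degree w 2 u ≠ m} =
      {u | IsNode w 2 u ∧ (IsKthChild w 1 (k + 1) u ∧ degree w 2 u ≠ m)} := by
    ext u
    refine ⟨fun h => ⟨?_, h⟩, fun h => h.2⟩
    obtain ⟨⟨v, -, hu, -⟩, -⟩ := h
    exact hu.1
  rw [KthChildDegreeEventually, h1, finite_nodes_iff]
  have : {x | x ∈ heads w 2 ∧ (IsKthChild w 1 (k + 1) (nodeOf w 2 x) ∧
      degree w 2 (nodeOf w 2 x) ≠ m)} =
      {p | p ∈ heads w 2 ∧ (leftKids w 1 p).ncard = k ∧ (kids w 2 p).ncard ≠ m} := by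
    ext p
    refine and_congr_right fun hp => ?_
    rw [isKthChild_nodeOf hp, degree_nodeOf]
    simp
  rw [this]

end Translation

/-! ### Sequences indexed by an infinite set of positions -/

open Filter

/-- `y` is the next element of `H` after `x`. -/
def IsNext (H : Set ℕ) (x y : ℕ) : Prop := y ∈ H ∧ x < y ∧ ∀ h, h ∈ H → x < h → y ≤ h

theorem IsNext.unique {H : Set ℕ} {x y y' : ℕ} (h : IsNext H x y) (h' : IsNext H x y') : y = y' :=
  le_antisymm (h.2.2 _ h'.1 h'.2.1) (h'.2.2 _ h.1 h.2.1)

theorem IsNext.injective {H : Set ℕ} {x x' y : ℕ} (hx : x ∈ H) (hx' : x' ∈ H) (h : IsNext H x y)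
    (h' : IsNext H x' y) : x = x' := by
  rcases lt_trichotomy x x' with hlt | heq | hlt
  · exact absurd (h.2.2 x' hx' hlt) (not_le.2 h'.2.1)
  · exact heq
  · exact absurd (h'.2.2 x hx hlt) (not_le.2 h.2.1)

/-- The increasing enumeration of a set of natural numbers. -/
noncomputable def enum (H : Set ℕ) (n : ℕ) : ℕ := Nat.nth (fun x => x ∈ H) n

theorem enum_mem {H : Set ℕ} (hH : H.Infinite) (n : ℕ) : enum H n ∈ H :=
  Nat.nth_mem_of_infinite (p := fun x => x ∈ H) hH n

theorem enum_strictMono {H : Set ℕ} (hH : H.Infinite) : StrictMono (enum H) :=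
  Nat.nth_strictMono (p := fun x => x ∈ H) hH

theorem exists_enum {H : Set ℕ} (hH : H.Infinite) {x : ℕ} (hx : x ∈ H) : ∃ n, enum H n = x := by
  have : x ∈ Set.range (Nat.nth fun x => x ∈ H) := by
    rw [Nat.range_nth_of_infinite (p := fun x => x ∈ H) hH]
    exact hx
  exact this

theorem isNext_enum {H : Set ℕ} (hH : H.Infinite) (n : ℕ) :
    IsNext H (enum H n) (enum H (n + 1)) := by
  refine ⟨enum_mem hH _, enum_strictMono hH (Nat.lt_succ_self n), ?_⟩
  intro h hh hlt
  obtain ⟨k, rfl⟩ := exists_enum hH hh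
  exact (enum_strictMono hH).monotone ((enum_strictMono hH).lt_iff_lt.1 hlt)

theorem finite_iff_eventually_enum {H : Set ℕ} (hH : H.Infinite) (q : ℕ → Prop) :
    {x | x ∈ H ∧ q x}.Finite ↔ ∀ᶠ n in atTop, ¬ q (enum H n) := by
  rw [← Nat.cofinite_eq_atTop, eventually_cofinite]
  have : {x | x ∈ H ∧ q x} = enum H '' {n | ¬ ¬ q (enum H n)} := by
    ext x
    constructor
    · rintro ⟨hx, hq⟩
      obtain ⟨k, rfl⟩ := exists_enum hH hx
      exact ⟨k, not_not.2 hq, rfl⟩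
    · rintro ⟨k, hk, rfl⟩
      exact ⟨enum_mem hH _, not_not.1 hk⟩
  rw [this, Set.finite_image_iff (enum_strictMono hH).injective.injOn]

theorem finite_iff_bounded {q : ℕ → Prop} : {x | q x}.Finite ↔ ∃ b, ∀ x, b < x → ¬ q x := by
  constructor
  · intro h
    obtain ⟨b, hb⟩ := h.bddAbove
    exact ⟨b, fun x hx hq => absurd (hb hq) (not_le.2 hx)⟩
  · rintro ⟨b, hb⟩
    refine (Set.finite_Iic b).subset fun x hx => ?_
    by_contra hlt
    exact hb x (not_le.1 hlt) hx

theorem infinite_iff_unbounded {q : ℕ → Prop} : {x | q x}.Infinite ↔ ∀ b, ∃ x, b < x ∧ q x := by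
  rw [Set.Infinite, finite_iff_bounded]
  push Not
  rfl

/-- A bounded sequence that is eventually nondecreasing attains a maximum on its monotone tail and
stays there. -/
theorem eventually_const_iff {a : ℕ → ℕ} {N : ℕ} (hN : ∀ n, a n ≤ N) :
    (∀ᶠ n in atTop, a n ≤ a (n + 1)) ↔ ∃ d, ∀ᶠ n in atTop, a n = d := by
  constructor
  · intro h
    obtain ⟨n₀, h₀⟩ := eventually_atTop.1 h
    have hmono : Monotone fun k => a (n₀ + k) :=
      monotone_nat_of_le_succ fun k => h₀ (n₀ + k) (by omega)
    have hbdd : (Set.range fun k => a (n₀ + k)).Finite :=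
      (Set.finite_Iic N).subset (by rintro _ ⟨k, rfl⟩; exact hN _)
    obtain ⟨_, ⟨k, rfl⟩, hk⟩ := hbdd.exists_maximal (Set.range_nonempty _)
    refine ⟨a (n₀ + k), eventually_atTop.2 ⟨n₀ + k, fun n hn => ?_⟩⟩
    have h1 := hmono (show k ≤ n - n₀ by omega)
    have h2 := hk ⟨n - n₀, rfl⟩ h1
    simp only [show n₀ + (n - n₀) = n by omega] at h1 h2
    omega
  · rintro ⟨d, hd⟩
    filter_upwards [hd, (tendsto_add_atTop_nat 1).eventually hd] with n h1 h2
    rw [h1, h2]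

/-! ### Comparing every root with the next one -/

section Blocks

variable {n : ℕ} {w : ℕ → Fin n}

theorem heads_mono {i j : ℕ} (hij : i ≤ j) : heads w i ⊆ heads w j := by
  induction hij with
  | refl => exact subset_rfl
  | step _ ih => exact ih.trans heads_subset_succ

theorem stretch_finite {H : Set ℕ} (hH : H.Infinite) (x : ℕ) : (stretch H x).Finite := by
  obtain ⟨h, hh, hx⟩ := hH.exists_gt x
  exact (Set.finite_Iio h).subset fun y hy => hy.2 h hh hx

/-- The family of sets of columns which is obtained by passing to the next root. -/
def shift (w : ℕ → Fin n) (A : ℕ → Set ℕ) (r : ℕ) : Set ℕ :=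
  {c | r ∈ heads w 1 ∧ ∃ r', IsNext (heads w 1) r r' ∧ c ∈ A r'}

theorem BlockFamily.shift {C : Set ℕ} {A : ℕ → Set ℕ} (hA : BlockFamily C A) :
    BlockFamily C (shift w A) where
  subset := by
    rintro s c ⟨-, r, -, hc⟩
    exact hA.subset r hc
  finite s := by
    by_cases h : ∃ r, IsNext (heads w 1) s r
    · obtain ⟨r, hr⟩ := h
      refine (hA.finite r).subset ?_
      rintro c ⟨-, r', hr', hc⟩
      rwa [hr.unique hr']
    · refine Set.finite_empty.subset ?_
      rintro c ⟨-, r', hr', -⟩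
      exact h ⟨r', hr'⟩
  disjoint := by
    rintro s s' c ⟨hs, r, hr, hc⟩ ⟨hs', r', hr', hc'⟩
    obtain rfl := hA.disjoint _ _ _ hc hc'
    exact hr.injective hs hs' hr'

/-- Along the enumeration of the roots, the left side compares the count at each root with the next
count, so it says that a bounded sequence is eventually nondecreasing. -/
theorem mixLE_shift_iff {C : Set ℕ} {A col : ℕ → Set ℕ} (hw : (heads w 1).Infinite)
    (hC : ColumnSystem C col) (hA : BlockFamily C A) {N : ℕ} (hN : ∀ s, (A s).ncard ≤ N)
    (hA0 : ∀ s, s ∉ heads w 1 → A s = ∅) :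
    MixLE A (shift w A) col ↔ ∃ d, {r | r ∈ heads w 1 ∧ (A r).ncard ≠ d}.Finite := by
  have h1 : {s | (shift w A s).ncard < (A s).ncard} =
      {s | s ∈ heads w 1 ∧ (shift w A s).ncard < (A s).ncard} := by
    ext s
    refine ⟨fun h => ⟨?_, h⟩, fun h => h.2⟩
    by_contra hs
    have : (shift w A s).ncard < (A s).ncard := h
    rw [hA0 s hs, Set.ncard_empty] at this
    omega
  have h2 : ∀ n, shift w A (enum (heads w 1) n) = A (enum (heads w 1) (n + 1)) := by
    intro n
    ext c
    constructor
    · rintro ⟨-, r, hr, hc⟩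
      rwa [(isNext_enum hw n).unique hr]
    · exact fun hc => ⟨enum_mem hw n, _, isNext_enum hw n, hc⟩
  rw [mixLE_iff hC hA hA.shift N hN, h1, finite_iff_eventually_enum hw]
  simp only [finite_iff_eventually_enum hw, h2, not_lt, not_not]
  exact eventually_const_iff fun _ => hN _

end Blocks

/-! ### Eventually constant degrees -/

section Regular

variable {n : ℕ} {w : ℕ → Fin n}

theorem heads_infinite (hw : (heads w 1).Infinite) {i : ℕ} (hi : 1 ≤ i) : (heads w i).Infinite :=
  hw.mono (heads_mono hi)

theorem kids_finite (hw : (heads w 1).Infinite) {i : ℕ} (hi : 1 ≤ i) (x : ℕ) :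
    (kids w i x).Finite := (stretch_finite (heads_infinite hw hi) x).inter_of_right _

theorem nodeOf_finite (hw : (heads w 1).Infinite) {i : ℕ} (hi : 1 ≤ i) (x : ℕ) :
    (nodeOf w i x).Finite :=
  (stretch_finite (heads_infinite hw hi) x).subset fun _ hy => hy.2

theorem kids_disjoint {i x x' p : ℕ} (hx : x ∈ heads w i) (hx' : x' ∈ heads w i)
    (h : p ∈ kids w i x) (h' : p ∈ kids w i x') : x = x' := stretch_disjoint hx hx' h.2 h'.2

theorem self_mem_kids {i x : ℕ} (hx : x ∈ heads w i) : x ∈ kids w i x :=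
  ⟨heads_subset_succ hx, self_mem_stretch⟩

theorem kids_ncard_pos (hw : (heads w 1).Infinite) {i x : ℕ} (hi : 1 ≤ i) (hx : x ∈ heads w i) :
    0 < (kids w i x).ncard := (Set.ncard_pos (kids_finite hw hi x)).2 ⟨x, self_mem_kids hx⟩

theorem exists_parent {i p : ℕ} (hp : p ∈ heads w (i + 1)) : ∃ x ∈ heads w i, p ∈ kids w i x := by
  obtain ⟨x, hx, hxp, hs⟩ := exists_head (i := i) hp.1
  exact ⟨x, hx, hp, (mem_stretch_iff hx.1 hp.1 hxp).2 hs⟩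

theorem leftKids_eq {i x p : ℕ} (hx : x ∈ heads w i) (hp : p ∈ kids w i x) :
    leftKids w i p = {y | y ∈ kids w i x ∧ y < p} := by
  ext y
  constructor
  · rintro ⟨hy, hyp, h⟩
    exact ⟨⟨hy, h x hx hp.2.1, fun k hk hxk => hyp.trans (hp.2.2 k hk hxk)⟩, hyp⟩
  · rintro ⟨hy, hyp⟩
    refine ⟨hy.1, hyp, fun k hk hkp => ?_⟩
    have : k ≤ x := by
      by_contra! hxk
      exact absurd (hp.2.2 k hk hxk) (not_lt.2 hkp)
    exact this.trans hy.2.1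

theorem ncard_below_lt {K : Set ℕ} (hK : K.Finite) {p : ℕ} (hp : p ∈ K) :
    {y | y ∈ K ∧ y < p}.ncard < K.ncard :=
  Set.ncard_lt_ncard ⟨fun _ h => h.1, fun h => absurd (h hp).2 (lt_irrefl p)⟩ hK

theorem ncard_below_lt_ncard_below {K : Set ℕ} (hK : K.Finite) {p q : ℕ} (hp : p ∈ K)
    (hpq : p < q) : {y | y ∈ K ∧ y < p}.ncard < {y | y ∈ K ∧ y < q}.ncard :=
  Set.ncard_lt_ncard ⟨fun _ h => ⟨h.1, h.2.trans hpq⟩,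
    fun h => absurd (h (show p ∈ {y | y ∈ K ∧ y < q} from ⟨hp, hpq⟩)).2 (lt_irrefl p)⟩
    (hK.subset fun _ h => h.1)

theorem exists_ncard_below {K : Set ℕ} (hK : K.Finite) {i : ℕ} (hi : i < K.ncard) :
    ∃ p ∈ K, {y | y ∈ K ∧ y < p}.ncard = i := by
  have hinj : Set.InjOn (fun p => {y | y ∈ K ∧ y < p}.ncard) K := by
    intro p hp q hq h
    rcases lt_trichotomy p q with hlt | heq | hlt
    · exact absurd h (ncard_below_lt_ncard_below hK hp hlt).ne
    · exact heq
    · exact absurd h.symm (ncard_below_lt_ncard_below hK hq hlt).ne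
  have himg : (fun p => {y | y ∈ K ∧ y < p}.ncard) '' K = Set.Iio K.ncard := by
    refine Set.eq_of_subset_of_ncard_le ?_ ?_ (Set.finite_Iio _)
    · rintro _ ⟨p, hp, rfl⟩
      exact ncard_below_lt hK hp
    · rw [hinj.ncard_image, Set.ncard_eq_toFinset_card']
      simp
  have : i ∈ (fun p => {y | y ∈ K ∧ y < p}.ncard) '' K := himg ▸ hi
  exact this

theorem leftKids_ncard_lt (hw : (heads w 1).Infinite) {x p : ℕ} (hx : x ∈ heads w 1)
    (hp : p ∈ kids w 1 x) : (leftKids w 1 p).ncard < (kids w 1 x).ncard := by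
  rw [leftKids_eq hx hp]
  exact ncard_below_lt (kids_finite hw le_rfl x) hp

theorem exists_kid (hw : (heads w 1).Infinite) {x i : ℕ} (hx : x ∈ heads w 1)
    (hi : i < (kids w 1 x).ncard) : ∃ p ∈ kids w 1 x, (leftKids w 1 p).ncard = i := by
  obtain ⟨p, hp, h⟩ := exists_ncard_below (kids_finite hw le_rfl x) hi
  exact ⟨p, hp, by rw [leftKids_eq hx hp, h]⟩

theorem leftKids_injOn (hw : (heads w 1).Infinite) {x p q : ℕ} (hx : x ∈ heads w 1)
    (hp : p ∈ kids w 1 x) (hq : q ∈ kids w 1 x)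
    (h : (leftKids w 1 p).ncard = (leftKids w 1 q).ncard) : p = q := by
  rw [leftKids_eq hx hp, leftKids_eq hx hq] at h
  rcases lt_trichotomy p q with hlt | heq | hlt
  · exact absurd h (ncard_below_lt_ncard_below (kids_finite hw le_rfl x) hp hlt).ne
  · exact heq
  · exact absurd h.symm (ncard_below_lt_ncard_below (kids_finite hw le_rfl x) hq hlt).ne

/-- Every root has finitely many children, so finitely many bad roots account for finitely many bad
children. -/
theorem finite_kids_of_finite_roots (hw : (heads w 1).Infinite) {q q' : ℕ → Prop}
    (hq : {x | x ∈ heads w 1 ∧ q x}.Finite)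
    (h : ∀ x ∈ heads w 1, ∀ p ∈ kids w 1 x, q' p → q x) :
    {p | p ∈ heads w 2 ∧ q' p}.Finite := by
  refine (hq.biUnion fun x _ => kids_finite hw le_rfl x).subset ?_
  rintro p ⟨hp, hp'⟩
  obtain ⟨x, hx, hpx⟩ := exists_parent hp
  exact Set.mem_biUnion (show x ∈ {x | x ∈ heads w 1 ∧ q x} from ⟨hx, h x hx p hpx hp'⟩) hpx

/-- Different roots have different children, so choosing a bad child for every bad root is
injective. -/
theorem finite_roots_of_finite_kids {q q' : ℕ → Prop}
    (hq : {p | p ∈ heads w 2 ∧ q' p}.Finite)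
    (h : ∀ x ∈ heads w 1, q x → ∃ p ∈ kids w 1 x, q' p) :
    {x | x ∈ heads w 1 ∧ q x}.Finite := by
  choose! g hg using h
  refine Set.Finite.of_finite_image (f := g) (hq.subset ?_) ?_
  · rintro _ ⟨x, ⟨hx, hqx⟩, rfl⟩
    exact ⟨(hg x hx hqx).1.1, (hg x hx hqx).2⟩
  · rintro x ⟨hx, hqx⟩ x' ⟨hx', hqx'⟩ he
    exact kids_disjoint hx hx' (hg x hx hqx).1 (he ▸ (hg x' hx' hqx').1)

/-- The degrees in `tree(w)` are bounded at depths `1` and `2` and tend to infinity at depth `3`. -/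
structure Regular (w : ℕ → Fin n) : Prop where
  infinite : (heads w 1).Infinite
  tendsto : ∀ m, {x | x ∈ heads w 3 ∧ (kids w 3 x).ncard < m}.Finite
  bounded_one : ∃ N, ∀ x, x ∈ heads w 1 → (kids w 1 x).ncard ≤ N
  bounded_two : ∃ N, ∀ x, x ∈ heads w 2 → (kids w 2 x).ncard ≤ N

/-- Almost all roots have degree `d`, and for `i < d` almost all of their `i`-th children, counted
from zero, have degree `m i`. -/
def EventualDegrees (w : ℕ → Fin n) (d : ℕ) (m : ℕ → ℕ) : Prop :=
  {x | x ∈ heads w 1 ∧ (kids w 1 x).ncard ≠ d}.Finite ∧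
  ∀ i < d, {p | p ∈ heads w 2 ∧ (leftKids w 1 p).ncard = i ∧ (kids w 2 p).ncard ≠ m i}.Finite

theorem bounded_of_finite {q : ℕ → Prop} {f : ℕ → ℕ} {d : ℕ}
    (h : {x | q x ∧ d < f x}.Finite) : ∃ N, ∀ x, q x → f x ≤ N := by
  obtain ⟨N, hN⟩ := (h.image f).bddAbove
  refine ⟨max d N, fun x hx => ?_⟩
  by_cases hd : d < f x
  · exact le_max_of_le_right (hN ⟨x, ⟨hx, hd⟩, rfl⟩)
  · exact le_max_of_le_left (not_lt.1 hd)

/-- A depth 2 node of degree above `∑ i < d, m i` either has place at least `d`, so that its root is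
exceptional, or violates the prescribed degree at its place; both happen finitely often. -/
theorem EventualDegrees.regular {d : ℕ} {m : ℕ → ℕ} (h : EventualDegrees w d m)
    (hw : (heads w 1).Infinite)
    (ht : ∀ m, {x | x ∈ heads w 3 ∧ (kids w 3 x).ncard < m}.Finite) : Regular w where
  infinite := hw
  tendsto := ht
  bounded_one := bounded_of_finite (d := d) (h.1.subset fun x hx => ⟨hx.1, hx.2.ne'⟩)
  bounded_two := by
    refine bounded_of_finite (d := ∑ i ∈ Finset.range d, m i) ?_
    have h1 := finite_kids_of_finite_roots hw (q' := fun p => d ≤ (leftKids w 1 p).ncard) h.1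
      fun x hx p hp hd => by
        have := leftKids_ncard_lt hw hx hp
        omega
    refine (h1.union ((Set.finite_Iio d).biUnion fun i hi => h.2 i hi)).subset ?_
    rintro p ⟨hp, hlt⟩
    by_cases hd : d ≤ (leftKids w 1 p).ncard
    · exact Or.inl ⟨hp, hd⟩
    · refine Or.inr (Set.mem_biUnion (Set.mem_Iio.2 (not_le.1 hd)) ⟨hp, rfl, ?_⟩)
      have := Finset.single_le_sum (f := m) (fun _ _ => Nat.zero_le _)
        (Finset.mem_range.2 (not_le.1 hd))
      omega

/-- The children of the root with first leaf `r`. -/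
def rootKids (w : ℕ → Fin n) (r : ℕ) : Set ℕ := {c | r ∈ heads w 1 ∧ c ∈ kids w 1 r}

/-- The children of the root with first leaf `r` up to the last one in `S`. -/
def rootIdx (w : ℕ → Fin n) (S : Set ℕ) (r : ℕ) : Set ℕ :=
  {c | r ∈ heads w 1 ∧ c ∈ kids w 1 r ∧ ∃ p, p ∈ S ∧ p ∈ kids w 1 r ∧ c ≤ p}

/-- The children of the nodes in `S` below the root with first leaf `r`. -/
def rootDeg (w : ℕ → Fin n) (S : Set ℕ) (r : ℕ) : Set ℕ :=
  {c | r ∈ heads w 1 ∧ ∃ p, p ∈ S ∧ p ∈ kids w 1 r ∧ c ∈ kids w 2 p}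

/-- The set `S` contains at most one child of every root. -/
def OnePerRoot (w : ℕ → Fin n) (S : Set ℕ) : Prop :=
  ∀ r, r ∈ heads w 1 → ∀ p, p ∈ S → p ∈ kids w 1 r → ∀ p', p' ∈ S → p' ∈ kids w 1 r → p = p'

/-- Almost all sets of the family `A`, which is indexed by the roots, have the same size. -/
def EventuallyConst (w : ℕ → Fin n) (A : ℕ → Set ℕ) : Prop :=
  ∃ d, {r | r ∈ heads w 1 ∧ (A r).ncard ≠ d}.Finite

theorem rootKids_eq {r : ℕ} (hr : r ∈ heads w 1) : rootKids w r = kids w 1 r := by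
  ext c
  exact and_iff_right hr

theorem rootIdx_eq {S : Set ℕ} (hS : OnePerRoot w S) {r p : ℕ} (hr : r ∈ heads w 1)
    (hp : p ∈ kids w 1 r) (hpS : p ∈ S) : rootIdx w S r = insert p (leftKids w 1 p) := by
  ext c
  rw [leftKids_eq hr hp]
  constructor
  · rintro ⟨-, hc, p', hp'S, hp', hcp⟩
    obtain rfl := hS r hr p hpS hp p' hp'S hp'
    rcases hcp.eq_or_lt with h | h
    · exact Or.inl h
    · exact Or.inr ⟨hc, h⟩
  · rintro (rfl | ⟨hc, h⟩)
    · exact ⟨hr, hp, _, hpS, hp, le_rfl⟩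
    · exact ⟨hr, hc, p, hpS, hp, h.le⟩

theorem rootIdx_ncard (hw : (heads w 1).Infinite) {S : Set ℕ} (hS : OnePerRoot w S) {r p : ℕ}
    (hr : r ∈ heads w 1) (hp : p ∈ kids w 1 r) (hpS : p ∈ S) :
    (rootIdx w S r).ncard = (leftKids w 1 p).ncard + 1 := by
  have hsub : leftKids w 1 p ⊆ kids w 1 r := by
    rw [leftKids_eq hr hp]
    exact fun _ h => h.1
  rw [rootIdx_eq hS hr hp hpS, Set.ncard_insert_of_notMem
    (fun h => lt_irrefl _ h.2.1) ((kids_finite hw le_rfl r).subset hsub)]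

theorem rootDeg_eq {S : Set ℕ} (hS : OnePerRoot w S) {r p : ℕ} (hr : r ∈ heads w 1)
    (hp : p ∈ kids w 1 r) (hpS : p ∈ S) : rootDeg w S r = kids w 2 p := by
  ext c
  constructor
  · rintro ⟨-, p', hp'S, hp', hc⟩
    rwa [hS r hr p hpS hp p' hp'S hp']
  · exact fun hc => ⟨hr, p, hpS, hp, hc⟩

/-- The degrees of the children of the roots are eventually constant if and only if this is so for
every set of nodes at an eventually constant place among their siblings. -/
theorem exists_eventualDegrees_iff (hw : Regular w) :
    (∃ d m, EventualDegrees w d m) ↔ EventuallyConst w (rootKids w) ∧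
      ∀ S, OnePerRoot w S → EventuallyConst w (rootIdx w S) → EventuallyConst w (rootDeg w S) := by
  have hinf := hw.infinite
  have hroot : ∀ d, {r | r ∈ heads w 1 ∧ (rootKids w r).ncard ≠ d} =
      {r | r ∈ heads w 1 ∧ (kids w 1 r).ncard ≠ d} := by
    intro d
    ext r
    exact and_congr_right fun hr => by rw [rootKids_eq hr]
  constructor
  · rintro ⟨d, m, hd, hm⟩
    refine ⟨⟨d, by rwa [hroot]⟩, ?_⟩
    rintro S hS ⟨k, hk⟩
    -- For `k = 0` almost no root has a child in `S`, and `rootDeg` is empty wherever `rootIdx` is.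
    rcases Nat.eq_zero_or_pos k with rfl | hk0
    · refine ⟨0, hk.subset ?_⟩
      rintro r ⟨hr, hne⟩
      refine ⟨hr, fun h0 => hne ?_⟩
      have : rootDeg w S r = ∅ := by
        rw [Set.eq_empty_iff_forall_notMem]
        rintro c ⟨-, p, hpS, hp, -⟩
        rw [rootIdx_ncard hinf hS hr hp hpS] at h0
        omega
      rw [this, Set.ncard_empty]
    -- The marked child itself is counted by `rootIdx`, so its place counted from zero is `k - 1`.
    · refine ⟨m (k - 1), ?_⟩
      have hbad : {r | r ∈ heads w 1 ∧ (k - 1 < d ∧ ∃ p ∈ kids w 1 r,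
          (leftKids w 1 p).ncard = k - 1 ∧ (kids w 2 p).ncard ≠ m (k - 1))}.Finite := by
        by_cases hkd : k - 1 < d
        · exact finite_roots_of_finite_kids (hm (k - 1) hkd) fun x _ h => h.2
        · exact Set.finite_empty.subset fun r hr => absurd hr.2.1 hkd
      refine ((hd.union hk).union hbad).subset ?_
      rintro r ⟨hr, hne⟩
      by_cases h1 : (kids w 1 r).ncard = d
      swap
      · exact Or.inl (Or.inl ⟨hr, h1⟩)
      by_cases h2 : (rootIdx w S r).ncard = k
      swap
      · exact Or.inl (Or.inr ⟨hr, h2⟩)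
      refine Or.inr ⟨hr, ?_⟩
      obtain ⟨c, -, -, p, hpS, hp, -⟩ :=
        Set.nonempty_of_ncard_ne_zero (s := rootIdx w S r) (by omega)
      have h3 := rootIdx_ncard hinf hS hr hp hpS
      have h4 := leftKids_ncard_lt hinf hr hp
      rw [rootDeg_eq hS hr hp hpS] at hne
      exact ⟨by omega, p, hp, by omega, hne⟩
  · rintro ⟨⟨d, hd⟩, hS⟩
    rw [hroot] at hd
    have key : ∀ i, ∃ k, i < d →
        {p | p ∈ heads w 2 ∧ (leftKids w 1 p).ncard = i ∧ (kids w 2 p).ncard ≠ k}.Finite := by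
      intro i
      by_cases hi : i < d
      swap
      · exact ⟨0, fun h => absurd h hi⟩
      -- The test set consists of all nodes at place `i`; as `i < d`, almost every root has such a
      -- child.
      have hone : OnePerRoot w {p | (leftKids w 1 p).ncard = i} := by
        intro r hr p hpS hp p' hpS' hp'
        exact leftKids_injOn hinf hr hp hp' (Eq.trans hpS (Eq.symm hpS'))
      obtain ⟨k, hk⟩ := hS _ hone ⟨i + 1, hd.subset (by
        rintro r ⟨hr, hne⟩
        refine ⟨hr, fun hrd => hne ?_⟩
        obtain ⟨p, hp, hpi⟩ := exists_kid hinf hr (show i < (kids w 1 r).ncard by omega)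
        rw [rootIdx_ncard hinf hone hr hp hpi, hpi])⟩
      refine ⟨k, fun _ => finite_kids_of_finite_roots hinf hk ?_⟩
      rintro x hx p hp ⟨hpi, hne⟩
      rwa [rootDeg_eq hone hx hp hpi]
    choose m hm using key
    exact ⟨d, m, hd, hm⟩

/-- Since `n = 4`, the children of a depth 3 node are its leaves, so column size is degree. -/
theorem Regular.columnSystem_three (hw : Regular w) (h4 : n = 4) :
    ColumnSystem (heads w 3) (nodeOf w 3) where
  finite c _ := nodeOf_finite hw.infinite (by omega) c
  disjoint c hc c' hc' y hy hy' := stretch_disjoint hc hc' hy.2 hy'.2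
  tendsto m := by
    subst h4
    refine (hw.tendsto m).subset fun c hc => ⟨hc.1, ?_⟩
    rw [kids, heads_self]
    exact hc.2

/-- A depth 2 node contains all leaves of its first child, which has the same first leaf, and these
are many by the depth 3 case. -/
theorem Regular.columnSystem_two (hw : Regular w) (h4 : n = 4) :
    ColumnSystem (heads w 2) (nodeOf w 2) where
  finite c _ := nodeOf_finite hw.infinite (by omega) c
  disjoint c hc c' hc' y hy hy' := stretch_disjoint hc hc' hy.2 hy'.2
  tendsto m := by
    refine ((hw.columnSystem_three h4).tendsto m).subset fun c hc =>
      ⟨heads_subset_succ hc.1, lt_of_le_of_lt (Set.ncard_le_ncard ?_ ?_) hc.2⟩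
    · exact fun y hy => ⟨hy.1, stretch_anti heads_subset_succ hy.2⟩
    · exact nodeOf_finite hw.infinite (by omega) c

theorem Regular.blockFamily_rootKids (hw : Regular w) :
    BlockFamily (heads w 2) (rootKids w) where
  subset _ _ hc := hc.2.1
  finite s := (kids_finite hw.infinite le_rfl s).subset fun _ hc => hc.2
  disjoint _ _ _ hc hc' := kids_disjoint hc.1 hc'.1 hc.2 hc'.2

theorem Regular.blockFamily_rootIdx (hw : Regular w) (S : Set ℕ) :
    BlockFamily (heads w 2) (rootIdx w S) where
  subset _ _ hc := hc.2.1.1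
  finite s := (kids_finite hw.infinite le_rfl s).subset fun _ hc => hc.2.1
  disjoint _ _ _ hc hc' := kids_disjoint hc.1 hc'.1 hc.2.1 hc'.2.1

theorem Regular.blockFamily_rootDeg (hw : Regular w) (S : Set ℕ) :
    BlockFamily (heads w 3) (rootDeg w S) where
  subset := by
    rintro s c ⟨-, p, -, -, hc⟩
    exact hc.1
  finite s := by
    refine ((kids_finite hw.infinite le_rfl s).biUnion fun p _ =>
      kids_finite hw.infinite (show 1 ≤ 2 by omega) p).subset ?_
    rintro c ⟨-, p, -, hp, hc⟩
    exact Set.mem_biUnion hp hc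
  disjoint := by
    rintro s s' c ⟨hs, p, -, hp, hc⟩ ⟨hs', p', -, hp', hc'⟩
    obtain rfl := kids_disjoint hp.1 hp'.1 hc hc'
    exact kids_disjoint hs hs' hp hp'

theorem Regular.ncard_rootKids_le (hw : Regular w) : ∃ N, ∀ r, (rootKids w r).ncard ≤ N := by
  obtain ⟨N, hN⟩ := hw.bounded_one
  refine ⟨N, fun r => ?_⟩
  by_cases hr : r ∈ heads w 1
  · rw [rootKids_eq hr]
    exact hN r hr
  · rw [(Set.eq_empty_iff_forall_notMem (s := rootKids w r)).2 fun c hc => hr hc.1,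
      Set.ncard_empty]
    exact Nat.zero_le _

theorem Regular.mixLE_rootKids_iff (hw : Regular w) (h4 : n = 4) :
    MixLE (rootKids w) (shift w (rootKids w)) (nodeOf w 2) ↔ EventuallyConst w (rootKids w) := by
  obtain ⟨N, hN⟩ := hw.ncard_rootKids_le
  exact mixLE_shift_iff hw.infinite (hw.columnSystem_two h4) hw.blockFamily_rootKids hN
    fun s hs => Set.eq_empty_iff_forall_notMem.2 fun c hc => hs hc.1

theorem Regular.mixLE_rootIdx_iff (hw : Regular w) (h4 : n = 4) (S : Set ℕ) :
    MixLE (rootIdx w S) (shift w (rootIdx w S)) (nodeOf w 2) ↔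
      EventuallyConst w (rootIdx w S) := by
  obtain ⟨N, hN⟩ := hw.ncard_rootKids_le
  refine mixLE_shift_iff hw.infinite (hw.columnSystem_two h4) (hw.blockFamily_rootIdx S) (N := N)
    (fun s => (Set.ncard_le_ncard ?_ (hw.blockFamily_rootKids.finite s)).trans (hN s))
    fun s hs => Set.eq_empty_iff_forall_notMem.2 fun c hc => hs hc.1
  exact fun c hc => ⟨hc.1, hc.2.1⟩

theorem Regular.mixLE_rootDeg_iff (hw : Regular w) (h4 : n = 4) {S : Set ℕ}
    (hS : OnePerRoot w S) :
    MixLE (rootDeg w S) (shift w (rootDeg w S)) (nodeOf w 3) ↔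
      EventuallyConst w (rootDeg w S) := by
  obtain ⟨N, hN⟩ := hw.bounded_two
  refine mixLE_shift_iff hw.infinite (hw.columnSystem_three h4) (hw.blockFamily_rootDeg S)
    (N := N) (fun r => ?_) fun s hs => Set.eq_empty_iff_forall_notMem.2 fun c hc => hs hc.1
  by_cases h : (rootDeg w S r).Nonempty
  · obtain ⟨c, hr, p, hpS, hp, -⟩ := h
    rw [rootDeg_eq hS hr hp hpS]
    exact hN p hp.1
  · rw [Set.not_nonempty_iff_eq_empty.1 h, Set.ncard_empty]
    exact Nat.zero_le _

end Regular

/-! ### Counter operations between consecutive siblings -/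

section Siblings

variable {n : ℕ} {w : ℕ → Fin n}

/-- `p'` is the next sibling of the depth `2` node `p`. -/
def NextSibling (w : ℕ → Fin n) (p p' : ℕ) : Prop :=
  IsNext (heads w 2) p p' ∧ p' ∈ stretch (heads w 1) p

/-- `p'` is the `k`-th sibling to the right of the depth `2` node `p`. -/
def KthSibling (w : ℕ → Fin n) : ℕ → ℕ → ℕ → Prop
  | 0, p, p' => p = p'
  | k + 1, p, p' => ∃ q, KthSibling w k p q ∧ NextSibling w q p'

theorem nextSibling_iff (hw : (heads w 1).Infinite) {r p p' : ℕ} (hr : r ∈ heads w 1)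
    (hp : p ∈ kids w 1 r) : NextSibling w p p' ↔
      p' ∈ kids w 1 r ∧ (leftKids w 1 p').ncard = (leftKids w 1 p).ncard + 1 := by
  have hfin := kids_finite hw le_rfl r
  constructor
  · rintro ⟨⟨h1, h2, h3⟩, h4⟩
    have hp' : p' ∈ kids w 1 r := ⟨h1, stretch_trans hp.2 h4⟩
    refine ⟨hp', ?_⟩
    rw [leftKids_eq hr hp, leftKids_eq hr hp',
      ← Set.ncard_insert_of_notMem (a := p) (fun h => lt_irrefl _ h.2)
        (hfin.subset fun _ h => h.1)]
    congr 1
    ext y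
    constructor
    · rintro ⟨hy, hyp⟩
      rcases lt_trichotomy y p with h | h | h
      · exact Or.inr ⟨hy, h⟩
      · exact Or.inl h
      · exact absurd (h3 y hy.1 h) (not_le.2 hyp)
    · rintro (rfl | ⟨hy, hyp⟩)
      · exact ⟨hp, h2⟩
      · exact ⟨hy, hyp.trans h2⟩
  · rintro ⟨hp', h⟩
    rw [leftKids_eq hr hp, leftKids_eq hr hp'] at h
    have hlt : p < p' := by
      rcases lt_trichotomy p p' with hlt | rfl | hlt
      · exact hlt
      · omega
      · have := ncard_below_lt_ncard_below hfin hp' hlt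
        omega
    refine ⟨⟨hp'.1, hlt, fun k hk hpk => ?_⟩, hlt.le, fun k hk hpk =>
      hp'.2.2 k hk (hp.2.1.trans_lt hpk)⟩
    by_contra! hkp
    have hkr : k ∈ kids w 1 r := ⟨hk, hp.2.1.trans hpk.le, fun x hx hrx =>
      hkp.trans (hp'.2.2 x hx hrx)⟩
    have h1 := ncard_below_lt_ncard_below hfin hp hpk
    have h2 := ncard_below_lt_ncard_below hfin hkr hkp
    omega

/-- The places of the children of a root form an initial segment of the natural numbers, so each
step to the right adds one. -/
theorem kthSibling_iff (hw : (heads w 1).Infinite) {r p p' k : ℕ} (hr : r ∈ heads w 1)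
    (hp : p ∈ kids w 1 r) : KthSibling w k p p' ↔
      p' ∈ kids w 1 r ∧ (leftKids w 1 p').ncard = (leftKids w 1 p).ncard + k := by
  induction k generalizing p' with
  | zero =>
    constructor
    · rintro rfl
      exact ⟨hp, rfl⟩
    · rintro ⟨hp', h⟩
      exact (leftKids_injOn hw hr hp' hp h).symm
  | succ k ih =>
    constructor
    · rintro ⟨q, hq, hqp⟩
      obtain ⟨hq, h1⟩ := ih.1 hq
      obtain ⟨hp', h2⟩ := (nextSibling_iff hw hr hq).1 hqp
      exact ⟨hp', by omega⟩
    · rintro ⟨hp', h⟩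
      obtain ⟨q, hq, hqk⟩ := exists_kid hw hr (i := (leftKids w 1 p).ncard + k)
        (by have := leftKids_ncard_lt hw hr hp'; omega)
      exact ⟨q, ih.2 ⟨hq, hqk⟩, (nextSibling_iff hw hr hq).2 ⟨hp', by omega⟩⟩

theorem exists_kthSibling_iff (hw : (heads w 1).Infinite) {r p k : ℕ} (hr : r ∈ heads w 1)
    (hp : p ∈ kids w 1 r) : (∃ p', KthSibling w k p p') ↔
      (leftKids w 1 p).ncard + k < (kids w 1 r).ncard := by
  constructor
  · rintro ⟨p', h⟩
    obtain ⟨hp', h⟩ := (kthSibling_iff hw hr hp).1 h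
    rw [← h]
    exact leftKids_ncard_lt hw hr hp'
  · intro h
    obtain ⟨p', hp', h⟩ := exists_kid hw hr h
    exact ⟨p', (kthSibling_iff hw hr hp).2 ⟨hp', h⟩⟩

theorem KthSibling.unique (hw : (heads w 1).Infinite) {p q q' k : ℕ} (hp : p ∈ heads w 2)
    (h : KthSibling w k p q) (h' : KthSibling w k p q') : q = q' := by
  obtain ⟨r, hr, hpr⟩ := exists_parent hp
  obtain ⟨h1, h2⟩ := (kthSibling_iff hw hr hpr).1 h
  obtain ⟨h1', h2'⟩ := (kthSibling_iff hw hr hpr).1 h'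
  exact leftKids_injOn hw hr h1 h1' (h2.trans h2'.symm)

theorem KthSibling.injective (hw : (heads w 1).Infinite) {p p' q k : ℕ} (hp : p ∈ heads w 2)
    (hp' : p' ∈ heads w 2) (h : KthSibling w k p q) (h' : KthSibling w k p' q) : p = p' := by
  obtain ⟨r, hr, hpr⟩ := exists_parent hp
  obtain ⟨r', hr', hpr'⟩ := exists_parent hp'
  obtain ⟨h1, h2⟩ := (kthSibling_iff hw hr hpr).1 h
  obtain ⟨h1', h2'⟩ := (kthSibling_iff hw hr' hpr').1 h'
  obtain rfl := kids_disjoint hr hr' h1 h1'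
  exact leftKids_injOn hw hr hpr hpr' (by omega)

theorem KthSibling.mem_heads (hw : (heads w 1).Infinite) {p q k : ℕ} (hp : p ∈ heads w 2)
    (h : KthSibling w k p q) : q ∈ heads w 2 := by
  obtain ⟨r, hr, hpr⟩ := exists_parent hp
  exact ((kthSibling_iff hw hr hpr).1 h).1.1

theorem KthSibling.exists_le (hw : (heads w 1).Infinite) {p q k j : ℕ} (hp : p ∈ heads w 2)
    (h : KthSibling w k p q) (hj : j ≤ k) : ∃ q', KthSibling w j p q' := by
  obtain ⟨r, hr, hpr⟩ := exists_parent hp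
  rw [exists_kthSibling_iff hw hr hpr]
  have := (exists_kthSibling_iff hw hr hpr).1 ⟨q, h⟩
  omega

/-- The children of the `k`-th sibling to the right of `s ∈ S`, without the first child if `b` is
`true`. -/
def siblingKids (w : ℕ → Fin n) (k : ℕ) (b : Bool) (S : Set ℕ) (s : ℕ) : Set ℕ :=
  {x | s ∈ S ∧ s ∈ heads w 2 ∧ ∃ p, KthSibling w k s p ∧ x ∈ kids w 2 p ∧ (b = true → x ≠ p)}

theorem siblingKids_false (hw : (heads w 1).Infinite) {k : ℕ} {S : Set ℕ} {s p : ℕ} (hs : s ∈ S)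
    (hs2 : s ∈ heads w 2) (hp : KthSibling w k s p) :
    siblingKids w k false S s = kids w 2 p := by
  ext x
  constructor
  · rintro ⟨-, -, p', hp', hx, -⟩
    rwa [hp.unique hw hs2 hp']
  · exact fun hx => ⟨hs, hs2, p, hp, hx, by simp⟩

theorem siblingKids_true (hw : (heads w 1).Infinite) {k : ℕ} {S : Set ℕ} {s p : ℕ} (hs : s ∈ S)
    (hs2 : s ∈ heads w 2) (hp : KthSibling w k s p) :
    siblingKids w k true S s = kids w 2 p \ {p} := by
  ext x
  constructor
  · rintro ⟨-, -, p', hp', hx, h⟩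
    obtain rfl := hp.unique hw hs2 hp'
    exact ⟨hx, h rfl⟩
  · exact fun hx => ⟨hs, hs2, p, hp, hx.1, fun _ => hx.2⟩

/-- The degree, minus one, of the `k`-th sibling to the right of `s`. -/
noncomputable def siblingVal (w : ℕ → Fin n) (k s : ℕ) : ℕ :=
  (siblingKids w k true Set.univ s).ncard

theorem siblingVal_add_one (hw : (heads w 1).Infinite) {k s p : ℕ}
    (hs2 : s ∈ heads w 2) (hp : KthSibling w k s p) :
    siblingVal w k s + 1 = (kids w 2 p).ncard := by
  rw [siblingVal, siblingKids_true hw (Set.mem_univ s) hs2 hp]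
  exact Set.ncard_sdiff_singleton_add_one (self_mem_kids (hp.mem_heads hw hs2))
    (kids_finite hw (by omega) p)

theorem ncard_siblingKids (hw : (heads w 1).Infinite) {k s p : ℕ} {b : Bool} {S : Set ℕ}
    (hs : s ∈ S) (hs2 : s ∈ heads w 2) (hp : KthSibling w k s p) :
    (siblingKids w k b S s).ncard = siblingVal w k s + (if b then 0 else 1) := by
  cases b
  · rw [siblingKids_false hw hs hs2 hp, ← siblingVal_add_one hw hs2 hp]
    rfl
  · rw [siblingKids_true hw hs hs2 hp, siblingVal, siblingKids_true hw (Set.mem_univ s) hs2 hp]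
    rfl

theorem blockFamily_siblingKids (hw : (heads w 1).Infinite) (k : ℕ) (b : Bool) (S : Set ℕ) :
    BlockFamily (heads w 3) (siblingKids w k b S) where
  subset := by
    rintro s x ⟨-, -, p, -, hx, -⟩
    exact hx.1
  finite s := by
    by_cases h : s ∈ heads w 2 ∧ ∃ p, KthSibling w k s p
    · obtain ⟨hs, p, hp⟩ := h
      refine (kids_finite hw (show 1 ≤ 2 by omega) p).subset ?_
      rintro x ⟨-, -, p', hp', hx, -⟩
      rwa [hp.unique hw hs hp']
    · refine Set.finite_empty.subset ?_
      rintro x ⟨-, hs, p', hp', -⟩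
      exact h ⟨hs, p', hp'⟩
  disjoint := by
    rintro s s' x ⟨-, hs, p, hp, hx, -⟩ ⟨-, hs', p', hp', hx', -⟩
    obtain rfl := kids_disjoint (hp.mem_heads hw hs) (hp'.mem_heads hw hs') hx hx'
    exact hp.injective hw hs hs' hp'

theorem Regular.ncard_siblingKids_le (hw : Regular w) (k : ℕ) (b : Bool) (S : Set ℕ) :
    ∃ N, ∀ s, (siblingKids w k b S s).ncard ≤ N := by
  obtain ⟨N, hN⟩ := hw.bounded_two
  refine ⟨N, fun s => ?_⟩
  by_cases h : (siblingKids w k b S s).Nonempty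
  · obtain ⟨x, hs, hs2, p, hp, -, -⟩ := h
    refine (Set.ncard_le_ncard ?_ (kids_finite hw.infinite (by omega) p)).trans
      (hN p (hp.mem_heads hw.infinite hs2))
    rintro x ⟨-, -, p', hp', hx, -⟩
    rwa [hp.unique hw.infinite hs2 hp']
  · rw [Set.not_nonempty_iff_eq_empty.1 h, Set.ncard_empty]
    exact Nat.zero_le _

/-- The numbers of columns in the two families are asymptotically equal. -/
def SameCount (w : ℕ → Fin n) (S : Set ℕ) (k : ℕ) (b : Bool) (k' : ℕ) (b' : Bool) : Prop :=
  MixLE (siblingKids w k b S) (siblingKids w k' b' S) (nodeOf w 3) ∧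
  MixLE (siblingKids w k' b' S) (siblingKids w k b S) (nodeOf w 3)

/-- `S` consists of nodes of depth `2` that have three siblings to the right. -/
def HasThreeSiblings (w : ℕ → Fin n) (S : Set ℕ) : Prop :=
  ∀ s, s ∈ S → s ∈ heads w 2 ∧ ∃ p, KthSibling w 3 s p

/-- Two inequalities up to finitely many indices give equality up to finitely many indices. Keeping
the first child adds one to the counter value; the three siblings ensure that both nodes exist. -/
theorem Regular.sameCount_iff (hw : Regular w) (h4 : n = 4) {S : Set ℕ} {k k' : ℕ} {b b' : Bool}
    (hS : HasThreeSiblings w S) (hk : k ≤ 3) (hk' : k' ≤ 3) : SameCount w S k b k' b' ↔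
    {s | s ∈ S ∧ ¬ siblingVal w k s + (if b then 0 else 1) =
      siblingVal w k' s + (if b' then 0 else 1)}.Finite := by
  obtain ⟨N, hN⟩ := hw.ncard_siblingKids_le k b S
  obtain ⟨N', hN'⟩ := hw.ncard_siblingKids_le k' b' S
  have hA := blockFamily_siblingKids hw.infinite k b S
  have hB := blockFamily_siblingKids hw.infinite k' b' S
  have hC := hw.columnSystem_three h4
  rw [SameCount, mixLE_iff hC hA hB N hN, mixLE_iff hC hB hA N' hN', ← Set.finite_union]
  have hcount : ∀ s ∈ S, (siblingKids w k b S s).ncard = siblingVal w k s + (if b then 0 else 1) ∧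
      (siblingKids w k' b' S s).ncard = siblingVal w k' s + (if b' then 0 else 1) := by
    intro s hs
    obtain ⟨hs2, p, hp⟩ := hS s hs
    obtain ⟨q, hq⟩ := hp.exists_le hw.infinite hs2 hk
    obtain ⟨q', hq'⟩ := hp.exists_le hw.infinite hs2 hk'
    exact ⟨ncard_siblingKids hw.infinite hs hs2 hq, ncard_siblingKids hw.infinite hs hs2 hq'⟩
  have hempty : ∀ s, s ∉ S → ∀ k b, (siblingKids w k b S s).ncard = 0 := by
    intro s hs k b
    rw [(Set.eq_empty_iff_forall_notMem (s := siblingKids w k b S s)).2 fun x hx => hs hx.1,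
      Set.ncard_empty]
  have hset : {s | (siblingKids w k' b' S s).ncard < (siblingKids w k b S s).ncard} ∪
      {s | (siblingKids w k b S s).ncard < (siblingKids w k' b' S s).ncard} =
      {s | s ∈ S ∧ ¬ siblingVal w k s + (if b then 0 else 1) =
        siblingVal w k' s + (if b' then 0 else 1)} := by
    ext s
    simp only [Set.mem_union, Set.mem_ofPred_eq]
    by_cases hs : s ∈ S
    · obtain ⟨h1, h2⟩ := hcount s hs
      rw [h1, h2]
      simp only [hs, true_and]
      omega
    · simp [hempty s hs, hs]
  rw [hset]

/-- The operation `o` on counter `c` is correctly performed, for almost all `s ∈ S`, between the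
configuration given by `s` and its next sibling and the configuration given by the following two
siblings. -/
def PerformsOp (w : ℕ → Fin n) (c : Fin 2) (o : CounterOp) (S : Set ℕ) : Prop :=
  HasThreeSiblings w S ∧ SameCount w S (1 - c : Fin 2).val true ((1 - c : Fin 2).val + 2) true ∧
  match o with
  | .inc => SameCount w S c.val false (c.val + 2) true
  | .dec => SameCount w S c.val true (c.val + 2) false
  | .isZero => SameCount w S c.val true (c.val + 2) true ∧
      ∃ b, ∀ s, b < s → ¬ ∃ x, x ∈ siblingKids w c.val true S s
  | .isPos => SameCount w S c.val true (c.val + 2) true ∧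
      ∃ b, ∀ s, b < s → s ∈ S → ∃ x, x ∈ siblingKids w c.val true S s

/-- The counter values given by the `k`-th and the `k + 1`-st sibling to the right of `s`. -/
noncomputable def configVal (w : ℕ → Fin n) (k s : ℕ) : Fin 2 → ℕ :=
  fun j => siblingVal w (k + j.val) s

theorem finite_not_and {S : Set ℕ} {P Q : ℕ → Prop} : {s | s ∈ S ∧ ¬ (P s ∧ Q s)}.Finite ↔
    {s | s ∈ S ∧ ¬ P s}.Finite ∧ {s | s ∈ S ∧ ¬ Q s}.Finite := by
  rw [← Set.finite_union]
  refine iff_of_eq (congrArg Set.Finite ?_)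
  ext s
  simp only [Set.mem_union, Set.mem_ofPred_eq]
  tauto

/-- This form uses only equalities of counts, possibly with one added, and emptiness tests. In the
decrement case, `u c = v c + 1` includes positivity. -/
theorem exec_iff {c : Fin 2} {o : CounterOp} {u v : Fin 2 → ℕ} : o.Exec c u v ↔
    u (1 - c) = v (1 - c) ∧ match o with
    | .inc => u c + 1 = v c
    | .dec => u c = v c + 1
    | .isZero => u c = v c ∧ u c = 0
    | .isPos => u c = v c ∧ 0 < u c := by
  fin_cases c <;> cases o <;> simp [CounterOp.Exec, funext_iff, Fin.forall_fin_two] <;> omega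

theorem Regular.performsOp_iff (hw : Regular w) (h4 : n = 4) {S : Set ℕ} {c : Fin 2}
    {o : CounterOp} : PerformsOp w c o S ↔ HasThreeSiblings w S ∧
      {s | s ∈ S ∧ ¬ o.Exec c (configVal w 0 s) (configVal w 2 s)}.Finite := by
  refine and_congr_right fun hS => ?_
  have hc := c.isLt
  have hc' := (1 - c : Fin 2).isLt
  have hval : ∀ s ∈ S, (siblingKids w c.val true S s).ncard = siblingVal w c.val s := by
    intro s hs
    obtain ⟨hs2, p, hp⟩ := hS s hs
    obtain ⟨q, hq⟩ := hp.exists_le hw.infinite hs2 (show c.val ≤ 3 by omega)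
    exact ncard_siblingKids hw.infinite hs hs2 hq
  have hfin := fun s => (blockFamily_siblingKids hw.infinite c.val true S).finite s
  have hzero : (∃ b, ∀ s, b < s → ¬ ∃ x, x ∈ siblingKids w c.val true S s) ↔
      {s | s ∈ S ∧ ¬ siblingVal w c.val s = 0}.Finite := by
    rw [finite_iff_bounded]
    refine exists_congr fun b => forall_congr' fun s => imp_congr_right fun _ => ?_
    refine not_congr ⟨?_, ?_⟩
    · rintro ⟨x, hx⟩
      refine ⟨hx.1, ?_⟩
      rw [← hval s hx.1]
      exact ((Set.ncard_pos (hfin s)).2 ⟨x, hx⟩).ne'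
    · rintro ⟨hs, hne⟩
      rw [← hval s hs] at hne
      exact Set.nonempty_of_ncard_ne_zero hne
  have hpos : (∃ b, ∀ s, b < s → s ∈ S → ∃ x, x ∈ siblingKids w c.val true S s) ↔
      {s | s ∈ S ∧ ¬ 0 < siblingVal w c.val s}.Finite := by
    rw [finite_iff_bounded]
    refine exists_congr fun b => forall_congr' fun s => imp_congr_right fun _ => ?_
    rw [not_and, not_not]
    refine imp_congr_right fun hs => ?_
    rw [← hval s hs, Set.ncard_pos (hfin s)]
    rfl
  simp only [exec_iff, finite_not_and]
  have hother := hw.sameCount_iff h4 (k := (1 - c : Fin 2).val) (k' := (1 - c : Fin 2).val + 2)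
    (b := true) (b' := true) hS (by omega) (by omega)
  have hsame : ∀ b b', SameCount w S c.val b (c.val + 2) b' ↔ _ := fun b b' =>
    hw.sameCount_iff h4 (k := c.val) (k' := c.val + 2) (b := b) (b' := b') hS (by omega) (by omega)
  simp only [configVal, zero_add]
  rw [hother, Nat.add_comm _ 2]
  refine and_congr (by simp) ?_
  cases o
  · simp only [hsame]
    simp [Nat.add_comm _ 2]
  · simp only [hsame]
    simp [Nat.add_comm _ 2]
  · simp only [hsame, hzero, finite_not_and]
    simp [Nat.add_comm _ 2]
  · simp only [hsame, hpos, finite_not_and]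
    simp [Nat.add_comm _ 2]

/-- Almost always, a node in `X` is followed by a configuration that starts in `X'`, if the
operation `o` on counter `c` leads to this configuration. -/
def ClosedUnder (w : ℕ → Fin n) (c : Fin 2) (o : CounterOp) (X X' : Set ℕ) : Prop :=
  ∀ S, PerformsOp w c o S →
    ∃ b, ∀ s, b < s → s ∈ S → s ∈ X → ∀ p, KthSibling w 2 s p → p ∈ X'

/-- Testing the set of all nodes at which the operation is correctly performed suffices: every other
admissible `S` is contained in it up to finitely many nodes. -/
theorem Regular.closedUnder_iff (hw : Regular w) (h4 : n = 4) {c : Fin 2} {o : CounterOp}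
    {X X' : Set ℕ} : ClosedUnder w c o X X' ↔
    {s | s ∈ heads w 2 ∧ ((∃ p, KthSibling w 3 s p) ∧
      o.Exec c (configVal w 0 s) (configVal w 2 s) ∧
      s ∈ X ∧ ∃ p, KthSibling w 2 s p ∧ p ∉ X')}.Finite := by
  constructor
  · intro h
    obtain ⟨b, hb⟩ := h {s | s ∈ heads w 2 ∧ (∃ p, KthSibling w 3 s p) ∧
      o.Exec c (configVal w 0 s) (configVal w 2 s)}
      ((hw.performsOp_iff h4).2 ⟨fun s hs => ⟨hs.1, hs.2.1⟩,
        Set.finite_empty.subset fun s hs => hs.2 hs.1.2.2⟩)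
    refine finite_iff_bounded.2 ⟨b, ?_⟩
    rintro s hbs ⟨h1, h2, h3, h4, p, hp, hpX⟩
    exact hpX (hb s hbs ⟨h1, h2, h3⟩ h4 p hp)
  · intro h S hS
    obtain ⟨hS, hfin⟩ := (hw.performsOp_iff h4).1 hS
    obtain ⟨b, hb⟩ := finite_iff_bounded.1 (h.union hfin)
    refine ⟨b, fun s hbs hs hX p hp => ?_⟩
    have := hb s hbs
    by_contra hpX
    obtain ⟨h1, h2⟩ := hS s hs
    by_cases he : o.Exec c (configVal w 0 s) (configVal w 2 s)
    · exact this (Or.inl ⟨h1, h2, he, hX, p, hp, hpX⟩)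
    · exact this (Or.inr ⟨hs, he⟩)

end Siblings

/-! ### Runs with prescribed counter values -/

/-- In the sequence of counter values `v`, the `i`-th configuration can be reached with state
`q`. -/
inductive Reach (M : MinskyMachine) (v : ℕ → Fin 2 → ℕ) : ℕ → ℕ → Prop
  | init : Reach M v 0 M.init
  | step {i q c o q'} : Reach M v i q → (q, c, o, q') ∈ M.trans → o.Exec c (v i) (v (i + 1)) →
      Reach M v (i + 1) q'

/-- The counter values listed by a sequence of numbers. -/
def listedVals (u : ℕ → ℕ) (i : ℕ) : Fin 2 → ℕ := fun j => u (2 * i + j.val)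

theorem describes_iff {d : ℕ} {u : ℕ → ℕ} {ρ : List MinskyConfig} :
    Describes (fun i : Fin d => u i) ρ ↔
      d = 2 * ρ.length ∧ ∀ i (hi : i < ρ.length), ρ[i].val = listedVals u i := by
  unfold Describes
  induction ρ generalizing d u with
  | nil => simp
  | cons s ρ ih =>
    match d with
    | 0 => simp
    | 1 => simp; omega
    | d + 2 =>
      have h := ih (d := d) (u := fun i => u (i + 2))
      simp only [List.ofFn_succ, List.flatMap_cons, List.cons_append, List.nil_append,
        List.cons.injEq, List.length_cons, Fin.val_succ, Fin.val_zero] at h ⊢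
      rw [show (fun i : Fin d => u (i.val + 1 + 1)) = fun i : Fin d => u (i.val + 2) from rfl, h]
      constructor
      · rintro ⟨h0, h1, h2, h3⟩
        refine ⟨by omega, fun i hi => ?_⟩
        cases i with
        | zero =>
          funext j
          fin_cases j
          · exact h0.symm
          · exact h1.symm
        | succ i =>
          rw [List.getElem_cons_succ, h3 i (by omega)]
          funext j
          simp only [listedVals]
          congr 1
          omega
      · rintro ⟨h2, h3⟩
        have h0 := h3 0 (by omega)
        refine ⟨(congrFun h0 0).symm, (congrFun h0 1).symm, by omega, fun i hi => ?_⟩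
        have := h3 (i + 1) (by omega)
        rw [List.getElem_cons_succ] at this
        rw [this]
        funext j
        simp only [listedVals]
        congr 1
        omega

theorem Reach.exists_run {M : MinskyMachine} {v : ℕ → Fin 2 → ℕ} {i q : ℕ} (h : Reach M v i q)
    (h0 : v 0 = fun _ => 0) : ∃ ρ : List MinskyConfig, ρ.length = i + 1 ∧
      ρ.head? = some ⟨M.init, fun _ => 0⟩ ∧ ρ.IsChain M.Step ∧
      ρ.getLast? = some ⟨q, v i⟩ ∧ ∀ j (hj : j < ρ.length), ρ[j].val = v j := by
  induction h with
  | init =>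
    refine ⟨[⟨M.init, fun _ => 0⟩], rfl, rfl, List.isChain_singleton _, by simp [h0], ?_⟩
    intro j hj
    have : j = 0 := by simpa using hj
    subst this
    exact h0.symm
  | @step i q c o q' _ ht ho ih =>
    obtain ⟨ρ, h1, h2, h3, h4, h5⟩ := ih
    refine ⟨ρ ++ [⟨q', v (i + 1)⟩], by simp [h1], ?_, ?_, by simp, ?_⟩
    · rw [List.head?_append, h2]
      rfl
    · refine List.isChain_append.2 ⟨h3, List.isChain_singleton _, ?_⟩
      intro x hx y hy
      rw [h4] at hx
      obtain rfl := Option.mem_some.1 hx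
      obtain rfl := Option.mem_some.1 hy
      exact ⟨c, o, ht, ho⟩
    · intro j hj
      rcases Nat.lt_or_ge j ρ.length with hlt | hge
      · rw [List.getElem_append_left hlt]
        exact h5 j hlt
      · have : j = i + 1 := by simp at hj; omega
        subst this
        rw [List.getElem_append_right hge]
        simp

theorem reach_of_isChain {M : MinskyMachine} {v : ℕ → Fin 2 → ℕ} {ρ : List MinskyConfig}
    (h0 : ∃ x, ρ.head? = some ⟨M.init, x⟩) (hchain : ρ.IsChain M.Step)
    (hv : ∀ j (hj : j < ρ.length), ρ[j].val = v j) (i : ℕ) (hi : i < ρ.length) :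
    Reach M v i ρ[i].state := by
  induction i with
  | zero =>
    obtain ⟨x, h0⟩ := h0
    rw [List.head?_eq_getElem?, List.getElem?_eq_getElem hi, Option.some_inj] at h0
    rw [h0]
    exact Reach.init
  | succ i ih =>
    obtain ⟨c, o, ht, ho⟩ := List.isChain_iff_getElem.1 hchain i hi
    rw [hv, hv] at ho
    exact Reach.step (ih (by omega)) ht ho

/-- The vector fixes all counter values and the length of the run, so only the sequence of states is
left to choose, and `Reach` records which states are possible. -/
theorem exists_run_iff_reach {M : MinskyMachine} {d : ℕ} {u : ℕ → ℕ} :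
    (∃ ρ, M.IsAcceptingRun ρ ∧ Describes (fun i : Fin d => u i) ρ) ↔
      listedVals u 0 = (fun _ => 0) ∧ ∃ l, d = 2 * (l + 1) ∧ Reach M (listedVals u) l M.final := by
  simp only [describes_iff]
  constructor
  · rintro ⟨ρ, ⟨h1, h2, s, hs, hf⟩, h4, h5⟩
    have hpos : 0 < ρ.length := by
      cases ρ
      · simp at h1
      · simp
    refine ⟨?_, ρ.length - 1, by omega, ?_⟩
    · rw [← h5 0 hpos]
      rw [List.head?_eq_getElem?, List.getElem?_eq_getElem hpos, Option.some_inj] at h1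
      rw [h1]
    · have := reach_of_isChain ⟨_, h1⟩ h2 h5 (ρ.length - 1) (by omega)
      rw [List.getLast?_eq_getElem?, List.getElem?_eq_getElem (by omega)] at hs
      rw [← hf, ← Option.mem_some.1 hs]
      exact this
  · rintro ⟨h0, l, hd, hr⟩
    obtain ⟨ρ, h1, h2, h3, h4, h5⟩ := hr.exists_run h0
    exact ⟨ρ, ⟨h2, h3, _, h4, rfl⟩, by omega, h5⟩

/-! ### Acceptance expressed by closed families of node sets -/

section RunFormula

variable {n : ℕ} {w : ℕ → Fin n}

/-- In almost all trees, the first two depth `2` nodes exist and have degree `1`. -/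
def StartsWithZeros (w : ℕ → Fin n) : Prop :=
  ∃ b, ∀ r, b < r → r ∈ heads w 1 → (∀ x, x ∈ kids w 2 r → x = r) ∧
    ∃ p, KthSibling w 1 r p ∧ ∀ x, x ∈ kids w 2 p → x = p

/-- In almost all trees, the first node of depth `2` is in `X`. -/
def ContainsFirst (w : ℕ → Fin n) (X : Set ℕ) : Prop :=
  ∃ b, ∀ r, b < r → r ∈ heads w 1 → r ∈ X

/-- In almost all trees, there is a node of depth `2` before the last one and it is in `X`. -/
def ContainsLast (w : ℕ → Fin n) (X : Set ℕ) : Prop :=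
  ∃ b, ∀ r, b < r → r ∈ heads w 1 → ∃ p, p ∈ X ∧ p ∈ kids w 1 r ∧
    (∃ p', KthSibling w 1 p p') ∧ ¬ ∃ p', KthSibling w 2 p p'

/-- The state `M.final` is reached at the end of almost all trees. -/
def ReachesFinal (w : ℕ → Fin n) (M : MinskyMachine) : Prop :=
  ∀ X : ℕ → Set ℕ, ContainsFirst w (X M.init) →
    (∀ t ∈ M.trans, ClosedUnder w t.2.1 t.2.2.1 (X t.1) (X t.2.2.2)) → ContainsLast w (X M.final)

/-- The degrees below the root `r` are given by `d` and `m`. -/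
def GoodRoot (w : ℕ → Fin n) (d : ℕ) (m : ℕ → ℕ) (r : ℕ) : Prop :=
  (kids w 1 r).ncard = d ∧ ∀ p ∈ kids w 1 r, (kids w 2 p).ncard = m (leftKids w 1 p).ncard

theorem EventualDegrees.finite_not_goodRoot {d : ℕ} {m : ℕ → ℕ} (h : EventualDegrees w d m)
    (hw : (heads w 1).Infinite) : {r | r ∈ heads w 1 ∧ ¬ GoodRoot w d m r}.Finite := by
  have h1 := (Set.finite_Iio d).biUnion fun i hi => h.2 i hi
  have h2 : {p | p ∈ heads w 2 ∧ ((leftKids w 1 p).ncard < d ∧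
      (kids w 2 p).ncard ≠ m (leftKids w 1 p).ncard)}.Finite :=
    h1.subset fun p hp => Set.mem_biUnion (Set.mem_Iio.2 hp.2.1) ⟨hp.1, rfl, hp.2.2⟩
  have h3 := finite_roots_of_finite_kids (q := fun r => (kids w 1 r).ncard = d ∧
    ¬ GoodRoot w d m r) h2 (by
      rintro r hr ⟨hd, hg⟩
      rw [GoodRoot, not_and] at hg
      have := hg hd
      push Not at this
      obtain ⟨p, hp, hne⟩ := this
      exact ⟨p, hp, hd ▸ leftKids_ncard_lt hw hr hp, hne⟩)
  refine (h.1.union h3).subset ?_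
  rintro r ⟨hr, hg⟩
  by_cases hd : (kids w 1 r).ncard = d
  · exact Or.inr ⟨hr, hd, hg⟩
  · exact Or.inl ⟨hr, hd⟩

theorem GoodRoot.siblingVal (hw : (heads w 1).Infinite) {d : ℕ} {m : ℕ → ℕ} {r p k : ℕ}
    (hg : GoodRoot w d m r) (hr : r ∈ heads w 1) (hp : p ∈ kids w 1 r)
    (hk : (leftKids w 1 p).ncard + k < d) :
    siblingVal w k p = m ((leftKids w 1 p).ncard + k) - 1 := by
  obtain ⟨q, hq⟩ := (exists_kthSibling_iff hw hr hp).2 (hg.1.symm ▸ hk)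
  have h1 := siblingVal_add_one hw hp.1 hq
  obtain ⟨hqr, hqk⟩ := (kthSibling_iff hw hr hp).1 hq
  have h2 := hg.2 q hqr
  rw [hqk] at h2
  omega

theorem GoodRoot.configVal (hw : (heads w 1).Infinite) {d : ℕ} {m : ℕ → ℕ} {r p k i : ℕ}
    (hg : GoodRoot w d m r) (hr : r ∈ heads w 1) (hp : p ∈ kids w 1 r)
    (hi : (leftKids w 1 p).ncard + k = 2 * i) (hd : 2 * i + 1 < d) :
    configVal w k p = listedVals (fun i => m i - 1) i := by
  funext j
  have := j.isLt
  rw [_root_.configVal, hg.siblingVal hw hr hp (by omega), listedVals]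
  congr 2
  omega

theorem exists_goodRoot_gt (hw : (heads w 1).Infinite) {d : ℕ} {m : ℕ → ℕ}
    (h : EventualDegrees w d m) (b : ℕ) : ∃ r ∈ heads w 1, b < r ∧ GoodRoot w d m r := by
  obtain ⟨r, hr, hb⟩ := (hw.sdiff (h.finite_not_goodRoot hw)).exists_gt b
  refine ⟨r, hr.1, hb, ?_⟩
  by_contra hg
  exact hr.2 ⟨hr.1, hg⟩

theorem leftKids_root {r : ℕ} (hr : r ∈ heads w 1) : (leftKids w 1 r).ncard = 0 := by
  rw [leftKids_eq hr (self_mem_kids hr), show {y | y ∈ kids w 1 r ∧ y < r} = ∅ from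
    Set.eq_empty_iff_forall_notMem.2 fun y hy => absurd hy.1.2.1 (not_le.2 hy.2),
    Set.ncard_empty]

theorem ncard_kids_eq_one_iff {i p : ℕ} (hp : p ∈ heads w i) :
    (kids w i p).ncard = 1 ↔ ∀ x, x ∈ kids w i p → x = p := by
  constructor
  · intro h x hx
    obtain ⟨y, hy⟩ := Set.ncard_eq_one.1 h
    have h1 : p ∈ kids w i p := self_mem_kids hp
    rw [hy, Set.mem_singleton_iff] at hx h1
    rw [hx, h1]
  · intro h
    refine Set.ncard_eq_one.2 ⟨p, ?_⟩
    ext x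
    refine ⟨h x, ?_⟩
    rintro rfl
    exact self_mem_kids hp

theorem startsWithZeros_of_eq (hw : (heads w 1).Infinite) {d : ℕ} {m : ℕ → ℕ}
    (h : EventualDegrees w d m) (hd : 2 ≤ d) (h0 : m 0 - 1 = 0) (h1 : m 1 - 1 = 0) :
    StartsWithZeros w := by
  obtain ⟨b, hb⟩ := finite_iff_bounded.1 (h.finite_not_goodRoot hw)
  refine ⟨b, fun r hbr hr => ?_⟩
  have hg : GoodRoot w d m r := by
    by_contra hg
    exact hb r hbr ⟨hr, hg⟩
  -- The first leaf of a root is also the first leaf of its first child, so `r` names both nodes.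
  have hrk : r ∈ kids w 1 r := self_mem_kids hr
  obtain ⟨p, hp⟩ := (exists_kthSibling_iff hw hr hrk (k := 1)).2 (by
    rw [leftKids_root hr, hg.1]
    omega)
  obtain ⟨hpr, hp1⟩ := (kthSibling_iff hw hr hrk).1 hp
  rw [leftKids_root hr, zero_add] at hp1
  refine ⟨(ncard_kids_eq_one_iff (i := 2) hrk.1).1 ?_, p, hp,
    (ncard_kids_eq_one_iff (i := 2) hpr.1).1 ?_⟩
  · have h2 := hg.2 r hrk
    -- Because of truncated subtraction, `h0` alone would allow `m 0 = 0`; degrees are positive.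
    have h3 := kids_ncard_pos hw (i := 2) (by omega) hrk.1
    rw [leftKids_root hr] at h2
    omega
  · have h2 := hg.2 p hpr
    have h3 := kids_ncard_pos hw (i := 2) (by omega) hpr.1
    rw [hp1] at h2
    omega

theorem StartsWithZeros.vals_eq (hw : (heads w 1).Infinite) {d : ℕ} {m : ℕ → ℕ}
    (h : EventualDegrees w d m) (hs : StartsWithZeros w) :
    m 0 - 1 = 0 ∧ m 1 - 1 = 0 := by
  obtain ⟨b, hb⟩ := hs
  obtain ⟨r, hr, hbr, hg⟩ := exists_goodRoot_gt hw h b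
  obtain ⟨h1, p, hp, h2⟩ := hb r hbr hr
  have hrk : r ∈ kids w 1 r := self_mem_kids hr
  obtain ⟨hpr, hp1⟩ := (kthSibling_iff hw hr hrk).1 hp
  have h3 := (ncard_kids_eq_one_iff (i := 2) hrk.1).2 h1
  have h4 := (ncard_kids_eq_one_iff (i := 2) hpr.1).2 h2
  have h5 := hg.2 r hrk
  have h6 := hg.2 p hpr
  rw [leftKids_root hr] at h5 hp1
  rw [hp1, zero_add] at h6
  omega

/-- The hypothesis is applied to the family of truly reachable nodes: those at an even place `2 * i`
such that configuration `i` of the vector can be reached in the given state. Moving two siblings to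
the right preserves evenness. One good root beyond the bound then supplies the final configuration.
-/
theorem reach_of_reachesFinal (hw : Regular w) (h4 : n = 4) {M : MinskyMachine} {d : ℕ}
    {m : ℕ → ℕ} (h : EventualDegrees w d m) (hf : ReachesFinal w M) :
    ∃ l, d = 2 * (l + 1) ∧ Reach M (listedVals fun i => m i - 1) l M.final := by
  have hinf := hw.infinite
  obtain ⟨b, hb⟩ := hf (fun q => {p | p ∈ heads w 2 ∧ ∃ i, (leftKids w 1 p).ncard = 2 * i ∧
    Reach M (listedVals fun i => m i - 1) i q})
    ⟨0, fun r _ hr => ⟨heads_subset_succ hr, 0, leftKids_root hr, Reach.init⟩⟩ (by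
      rintro ⟨q, c, o, q'⟩ ht
      refine (hw.closedUnder_iff h4).2 (finite_kids_of_finite_roots hinf
        (h.finite_not_goodRoot hinf) ?_)
      rintro r hr p hp ⟨h3, he, ⟨-, i, hi, hreach⟩, p', hp', hne⟩ hg
      rw [exists_kthSibling_iff hinf hr hp, hg.1] at h3
      obtain ⟨hpr', hi'⟩ := (kthSibling_iff hinf hr hp).1 hp'
      rw [hg.configVal hinf hr hp (i := i) (by omega) (by omega),
        hg.configVal hinf hr hp (i := i + 1) (by omega) (by omega)] at he
      exact hne ⟨hpr'.1, i + 1, by omega, hreach.step ht he⟩)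
  obtain ⟨r, hr, hbr, hg⟩ := exists_goodRoot_gt hinf h b
  obtain ⟨p, ⟨-, i, hi, hreach⟩, hp, h1, h2⟩ := hb r hbr hr
  -- One sibling to the right but not two: this fixes `d = 2 * i + 2`.
  rw [exists_kthSibling_iff hinf hr hp, hg.1] at h1 h2
  exact ⟨i, by omega, hreach⟩

/-- By induction along `Reach`, the node at place `2 * i` belongs to the set of the reached state in
almost all trees. Every step loses finitely many roots, and there are finitely many steps. -/
theorem reachesFinal_of_reach (hw : Regular w) (h4 : n = 4) {M : MinskyMachine} {d l : ℕ}
    {m : ℕ → ℕ} (h : EventualDegrees w d m) (hd : d = 2 * (l + 1))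
    (hreach : Reach M (listedVals fun i => m i - 1) l M.final) : ReachesFinal w M := by
  have hinf := hw.infinite
  have hbad := h.finite_not_goodRoot hinf
  intro X hX hcl
  have key : ∀ i q, Reach M (listedVals fun i => m i - 1) i q → 2 * i + 1 < d →
      {r | r ∈ heads w 1 ∧ ∃ p ∈ kids w 1 r, (leftKids w 1 p).ncard = 2 * i ∧ p ∉ X q}.Finite := by
    intro i q hr
    induction hr with
    | init =>
      intro _
      obtain ⟨b, hb⟩ := hX
      refine finite_iff_bounded.2 ⟨b, ?_⟩
      rintro r hbr ⟨hr, p, hp, hp0, hpX⟩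
      refine hpX ?_
      rw [leftKids_injOn hinf hr hp (self_mem_kids hr) (by rw [hp0, leftKids_root hr])]
      exact hb r hbr hr
    | @step i q c o q' _ ht he ih =>
      intro hid
      have h1 := (hw.closedUnder_iff h4).1 (hcl _ ht)
      let bad : ℕ → Prop := fun s => (∃ p, KthSibling w 3 s p) ∧
        o.Exec c (configVal w 0 s) (configVal w 2 s) ∧
        s ∈ X q ∧ ∃ p, KthSibling w 2 s p ∧ p ∉ X q'
      have h2 := finite_roots_of_finite_kids (q := fun r => ∃ p ∈ kids w 1 r, bad p)
        (q' := bad) h1 fun x _ hx => hx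
      refine ((hbad.union (ih (by omega))).union h2).subset ?_
      rintro r ⟨hr, p', hp', hi', hpX'⟩
      by_cases hg : GoodRoot w d m r
      swap
      · exact Or.inl (Or.inl ⟨hr, hg⟩)
      obtain ⟨p, hp, hi⟩ := exists_kid hinf hr (i := 2 * i) (by rw [hg.1]; omega)
      by_cases hpX : p ∈ X q
      swap
      · exact Or.inl (Or.inr ⟨hr, p, hp, hi, hpX⟩)
      refine Or.inr ⟨hr, p, hp, ?_, ?_, hpX, p', ?_, hpX'⟩
      · rw [exists_kthSibling_iff hinf hr hp, hg.1]
        omega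
      · rwa [hg.configVal hinf hr hp (i := i) (by omega) (by omega),
          hg.configVal hinf hr hp (i := i + 1) (by omega) (by omega)]
      · rw [kthSibling_iff hinf hr hp]
        exact ⟨hp', by omega⟩
  obtain ⟨b, hb⟩ := finite_iff_bounded.1 (hbad.union (key l _ hreach (by omega)))
  refine ⟨b, fun r hbr hr => ?_⟩
  have hnot := hb r hbr
  have hg : GoodRoot w d m r := by
    by_contra hg
    exact hnot (Or.inl ⟨hr, hg⟩)
  obtain ⟨p, hp, hi⟩ := exists_kid hinf hr (i := 2 * l) (by rw [hg.1]; omega)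
  refine ⟨p, ?_, hp, ?_, ?_⟩
  · by_contra hpX
    exact hnot (Or.inr ⟨hr, p, hp, hi, hpX⟩)
  · rw [exists_kthSibling_iff hinf hr hp, hg.1]
    omega
  · rw [exists_kthSibling_iff hinf hr hp, hg.1]
    omega

end RunFormula

/-- The language of `M` in terms of first leaves of nodes. -/
theorem encodesAcceptingRun_iff {M : MinskyMachine} {w : ℕ → Fin 4} :
    EncodesAcceptingRun M w ↔ HasInfinitelyManyOnes w ∧ Regular w ∧
      (EventuallyConst w (rootKids w) ∧ ∀ S, OnePerRoot w S → EventuallyConst w (rootIdx w S) →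
        EventuallyConst w (rootDeg w S)) ∧ StartsWithZeros w ∧ ReachesFinal w M := by
  rw [EncodesAcceptingRun, hasInfinitelyManyTrees_iff, degreeTendsToInfinity_iff]
  refine and_congr_right fun _ => ?_
  simp only [rootDegreeEventually_iff, kthChildDegreeEventually_iff]
  constructor
  · rintro ⟨hinf, ht, d, m, hd, hm, -, hρ⟩
    -- The values beyond `d` are never consulted.
    let m' : ℕ → ℕ := fun i => if h : i < d then m ⟨i, h⟩ else 0
    have hm' : ∀ i : Fin d, m' i = m i := fun i => dif_pos i.isLt
    have hdeg : EventualDegrees w d m' :=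
      ⟨hd, fun i hi => by simpa only [hm' ⟨i, hi⟩] using hm ⟨i, hi⟩⟩
    have hw := hdeg.regular hinf ht
    simp only [← hm'] at hρ
    obtain ⟨h0, l, hl, hr⟩ := (exists_run_iff_reach (u := fun i => m' i - 1)).1 hρ
    exact ⟨hw, (exists_eventualDegrees_iff hw).1 ⟨d, m', hdeg⟩,
      startsWithZeros_of_eq hinf hdeg (by omega) (congrFun h0 0) (congrFun h0 1),
      reachesFinal_of_reach hw rfl hdeg hl hr⟩
  · rintro ⟨hw, hconst, hz, hf⟩
    obtain ⟨d, m, hdeg⟩ := (exists_eventualDegrees_iff hw).2 hconst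
    obtain ⟨l, hl, hr⟩ := reach_of_reachesFinal hw rfl hdeg hf
    obtain ⟨h0, h1⟩ := hz.vals_eq hw.infinite hdeg
    refine ⟨hw.infinite, hw.tendsto, d, fun i => m i, hdeg.1, fun i => hdeg.2 i i.isLt, ?_, ?_⟩
    · intro i
      obtain ⟨r, hr, -, hg⟩ := exists_goodRoot_gt hw.infinite hdeg 0
      obtain ⟨p, hp, hi⟩ := exists_kid hw.infinite hr (i := i) (by rw [hg.1]; exact i.isLt)
      change 1 ≤ m i
      rw [← hi, ← hg.2 p hp]
      exact kids_ncard_pos hw.infinite (by omega) hp.1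
    · refine (exists_run_iff_reach (u := fun i => m i - 1)).2 ⟨?_, l, hl, hr⟩
      funext j
      fin_cases j
      · exact h0
      · exact h1

/-! ### Definability of the notions above -/

/-- The blocks of the family `A`, which may depend on a word and on a set, are definable. -/
def DefFamily (A : (ℕ → Fin 4) → Set ℕ → ℕ → Set ℕ) : Prop :=
  ∀ ⦃n m S s c : ℕ⦄, S < m → s < n → c < n →
    MSOU.Def n m fun w ν μ => ν c ∈ A w (μ S) (ν s)

namespace MSOU.Def

variable {n m : ℕ}

theorem mem_kids (i : ℕ) {x y : ℕ} (hx : x < n) (hy : y < n) :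
    Def n m (fun w ν _ => ν y ∈ kids w i (ν x)) :=
  and (mem_heads (i + 1) hy) (mem_stretch i hx hy)

theorem mem_nodeOf (i : ℕ) {x y : ℕ} (hx : x < n) (hy : y < n) :
    Def n m (fun w ν _ => ν y ∈ nodeOf w i (ν x)) :=
  and (isLeaf hy) (mem_stretch i hx hy)

theorem isNext_heads (i : ℕ) {x y : ℕ} (hx : x < n) (hy : y < n) :
    Def n m (fun w ν _ => IsNext (heads w i) (ν x) (ν y)) := by
  refine and (mem_heads i hy) (and (lt hx hy)
    (all (imp (mem_heads i ?_) (imp (lt ?_ ?_) (le ?_ ?_)))))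
  all_goals omega

theorem unb_family {A : (ℕ → Fin 4) → Set ℕ → ℕ → Set ℕ} (hA : DefFamily A) (i : ℕ)
    {S P σ Z : ℕ} (hS : S < m) (hP : P < m) (hσ : σ < m) (hZ : Z < m) :
    Def n m (fun w _ μ => Unb (A w (μ S)) (nodeOf w i) (μ P) (μ σ) (μ Z)) := by
  refine unb (fun w _ μ Y => ∃ s, s ∈ μ Z ∧ ∃ c, c ∈ μ σ ∧ c ∈ A w (μ S) s ∧
    ∀ y, y ∈ Y → y ∈ μ P ∧ y ∈ nodeOf w i c) ?_
  refine ex (and (mem ?_ ?_) (ex (and (mem ?_ ?_) (and (hA ?_ ?_ ?_)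
    (all (imp (mem ?_ ?_) (and (mem ?_ ?_) (mem_nodeOf i ?_ ?_))))))))
  all_goals omega

theorem selects {A : (ℕ → Fin 4) → Set ℕ → ℕ → Set ℕ} (hA : DefFamily A)
    {S σ : ℕ} (hS : S < m) (hσ : σ < m) :
    Def n m (fun w _ μ => Selects (A w (μ S)) (μ σ)) := by
  refine all (all (all (imp (hA ?_ ?_ ?_) (imp (hA ?_ ?_ ?_) (imp (mem ?_ ?_)
    (imp (mem ?_ ?_) (eq ?_ ?_)))))))
  all_goals omega

theorem mixLE {A B : (ℕ → Fin 4) → Set ℕ → ℕ → Set ℕ} (hA : DefFamily A) (hB : DefFamily B)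
    (i : ℕ) {S : ℕ} (hS : S < m) :
    Def n m (fun w _ μ => MixLE (A w (μ S)) (B w (μ S)) (nodeOf w i)) := by
  refine allSet (exSet (allSet (imp (selects hA ?_ ?_) (exSet (and (selects hB ?_ ?_)
    (allSet (iff (unb_family hA i ?_ ?_ ?_ ?_) (unb_family hB i ?_ ?_ ?_ ?_))))))))
  all_goals omega

theorem rootKids : DefFamily fun w _ => rootKids w := by
  intro n m S s c hS hs hc
  exact and (mem_heads 1 hs) (mem_kids 1 hs hc)

theorem rootIdx : DefFamily fun w S => rootIdx w S := by
  intro n m S s c hS hs hc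
  refine and (mem_heads 1 hs) (and (mem_kids 1 hs hc) (ex (and (mem ?_ ?_)
    (and (mem_kids 1 ?_ ?_) (le ?_ ?_)))))
  all_goals omega

theorem rootDeg : DefFamily fun w S => rootDeg w S := by
  intro n m S s c hS hs hc
  refine and (mem_heads 1 hs) (ex (and (mem ?_ ?_) (and (mem_kids 1 ?_ ?_) (mem_kids 2 ?_ ?_))))
  all_goals omega

theorem shift {A : (ℕ → Fin 4) → Set ℕ → ℕ → Set ℕ} (hA : DefFamily A) :
    DefFamily fun w S => shift w (A w S) := by
  intro n m S s c hS hs hc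
  refine and (mem_heads 1 hs) (ex (and (isNext_heads 1 ?_ ?_) (hA ?_ ?_ ?_)))
  all_goals omega

theorem kthSibling (k : ℕ) : ∀ {n x y : ℕ}, x < n → y < n →
    Def n m (fun w ν _ => KthSibling w k (ν x) (ν y)) := by
  induction k with
  | zero => exact fun hx hy => eq hx hy
  | succ k ih =>
    intro n x y hx hy
    refine ex (and (ih ?_ ?_) (and (isNext_heads 2 ?_ ?_) (mem_stretch 1 ?_ ?_)))
    all_goals omega

theorem siblingKids (k : ℕ) (b : Bool) : DefFamily fun w S => siblingKids w k b S := by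
  intro n m S s c hS hs hc
  refine and (mem hs hS) (and (mem_heads 2 hs) (ex (and (kthSibling k ?_ ?_)
    (and (mem_kids 2 ?_ ?_) (imp (const _) (not (eq ?_ ?_)))))))
  all_goals omega

theorem sameCount {S : ℕ} (hS : S < m) (k : ℕ) (b : Bool) (k' : ℕ) (b' : Bool) :
    Def n m (fun w _ μ => SameCount w (μ S) k b k' b') :=
  and (mixLE (siblingKids k b) (siblingKids k' b') 3 hS)
    (mixLE (siblingKids k' b') (siblingKids k b) 3 hS)

theorem performsOp (c : Fin 2) (o : CounterOp) {S : ℕ} (hS : S < m) :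
    Def n m (fun w _ μ => PerformsOp w c o (μ S)) := by
  refine and (all (imp (mem ?_ hS) (and (mem_heads 2 ?_) (ex (kthSibling 3 ?_ ?_)))))
    (and (sameCount hS _ _ _ _) ?_)
  any_goals omega
  cases o
  · exact sameCount hS _ _ _ _
  · exact sameCount hS _ _ _ _
  · refine and (sameCount hS _ _ _ _) (ex (all (imp (lt ?_ ?_) (not (ex
      (siblingKids _ _ ?_ ?_ ?_))))))
    all_goals omega
  · refine and (sameCount hS _ _ _ _) (ex (all (imp (lt ?_ ?_) (imp (mem ?_ ?_) (ex
      (siblingKids _ _ ?_ ?_ ?_))))))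
    all_goals omega

theorem closedUnder (c : Fin 2) (o : CounterOp) {X X' : ℕ} (hX : X < m) (hX' : X' < m) :
    Def n m (fun w _ μ => ClosedUnder w c o (μ X) (μ X')) := by
  refine allSet (imp (performsOp c o ?_) (ex (all (imp (lt ?_ ?_) (imp (mem ?_ ?_)
    (imp (mem ?_ ?_) (all (imp (kthSibling 2 ?_ ?_) (mem ?_ ?_)))))))))
  all_goals omega

theorem startsWithZeros : Def n m (fun w _ _ => StartsWithZeros w) := by
  refine ex (all (imp (lt ?_ ?_) (imp (mem_heads 1 ?_) (and
    (all (imp (mem_kids 2 ?_ ?_) (eq ?_ ?_)))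
    (ex (and (kthSibling 1 ?_ ?_) (all (imp (mem_kids 2 ?_ ?_) (eq ?_ ?_)))))))))
  all_goals omega

theorem containsFirst {X : ℕ} (hX : X < m) : Def n m (fun w _ μ => ContainsFirst w (μ X)) := by
  refine ex (all (imp (lt ?_ ?_) (imp (mem_heads 1 ?_) (mem ?_ ?_))))
  all_goals omega

theorem containsLast {X : ℕ} (hX : X < m) : Def n m (fun w _ μ => ContainsLast w (μ X)) := by
  refine ex (all (imp (lt ?_ ?_) (imp (mem_heads 1 ?_) (ex (and (mem ?_ ?_)
    (and (mem_kids 1 ?_ ?_) (and (ex (kthSibling 1 ?_ ?_)) (not (ex (kthSibling 2 ?_ ?_))))))))))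
  all_goals omega

theorem onePerRoot {S : ℕ} (hS : S < m) : Def n m (fun w _ μ => OnePerRoot w (μ S)) := by
  refine all (imp (mem_heads 1 ?_) (all (imp (mem ?_ ?_) (imp (mem_kids 1 ?_ ?_)
    (all (imp (mem ?_ ?_) (imp (mem_kids 1 ?_ ?_) (eq ?_ ?_))))))))
  all_goals omega

theorem hasInfinitelyManyOnes : Def n m (fun w _ _ => HasInfinitelyManyOnes w) := by
  have : Def n m (fun w _ _ => ∀ b, ∃ x, b < x ∧ labelAt w x = 1) :=
    all (ex (and (lt (by omega) (by omega)) (letter (by omega) fun a => a.val + 1 = 1)))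
  exact this.congr fun w _ _ => infinite_iff_unbounded.symm

theorem heads_infinite (i : ℕ) : Def n m (fun w _ _ => (heads w i).Infinite) := by
  have : Def n m (fun w _ _ => ∀ b, ∃ x, b < x ∧ x ∈ heads w i) :=
    all (ex (and (lt (by omega) (by omega)) (mem_heads i (by omega))))
  exact this.congr fun w _ _ => (infinite_iff_unbounded (q := fun x => x ∈ heads w i)).symm

end MSOU.Def

/-! ### The conditions that do not depend on the machine -/

/-- There are arbitrarily large finite sets of children of nodes in `Z` of depth `i`. -/
def UnbKids (w : ℕ → Fin 4) (i : ℕ) (Z : Set ℕ) : Prop :=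
  ∀ k, ∃ Y : Finset ℕ, k ≤ Y.card ∧ ∃ z, z ∈ Z ∧ z ∈ heads w i ∧
    ∀ y, y ∈ (Y : Set ℕ) → y ∈ kids w i z

theorem not_unbKids_iff {w : ℕ → Fin 4} (hw : (heads w 1).Infinite) {i : ℕ} (hi : 1 ≤ i)
    {Z : Set ℕ} :
    ¬ UnbKids w i Z ↔ ∃ N, ∀ z, z ∈ Z → z ∈ heads w i → (kids w i z).ncard ≤ N := by
  unfold UnbKids
  push Not
  constructor
  · rintro ⟨k, hk⟩
    refine ⟨k, fun z hz hzh => ?_⟩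
    by_contra! hlt
    have hf := kids_finite hw hi z
    obtain ⟨y, hy, hy'⟩ := hk hf.toFinset (by rw [← Set.ncard_eq_toFinset_card _ hf]; omega) z hz
      hzh
    exact hy' (by simpa using hy)
  · rintro ⟨N, hN⟩
    refine ⟨N + 1, fun Y hY z hz hzh => ?_⟩
    by_contra! hsub
    have h1 := Set.ncard_le_ncard (s := (Y : Set ℕ)) hsub (kids_finite hw hi z)
    rw [Set.ncard_coe_finset] at h1
    have := hN z hz hzh
    omega

/-- The parts of the definition of the language that do not depend on the machine. -/
def Basic (w : ℕ → Fin 4) : Prop :=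
  HasInfinitelyManyOnes w ∧ (heads w 1).Infinite ∧
  (∀ Z, (∀ z, z ∈ Z → z ∈ heads w 3) → (∀ b, ∃ z, b < z ∧ z ∈ Z) → UnbKids w 3 Z) ∧
  (∀ Z, ¬ UnbKids w 1 Z ∧ ¬ UnbKids w 2 Z) ∧
  (∀ S, MixLE (rootKids w) (shift w (rootKids w)) (nodeOf w 2) ∧
    (OnePerRoot w S → MixLE (rootIdx w S) (shift w (rootIdx w S)) (nodeOf w 2) →
      MixLE (rootDeg w S) (shift w (rootDeg w S)) (nodeOf w 3))) ∧
  StartsWithZeros w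

/-- Degrees tend to infinity exactly when they are unbounded on every infinite set of depth 3 nodes:
a counterexample is the set of nodes of degree below some `k`. For boundedness, the set of all
positions is the decisive `Z`. -/
theorem regular_iff {w : ℕ → Fin 4} : Regular w ↔ (heads w 1).Infinite ∧
    (∀ Z, (∀ z, z ∈ Z → z ∈ heads w 3) → (∀ b, ∃ z, b < z ∧ z ∈ Z) → UnbKids w 3 Z) ∧
    (∀ Z, ¬ UnbKids w 1 Z ∧ ¬ UnbKids w 2 Z) := by
  constructor
  · intro hw
    refine ⟨hw.infinite, fun Z hZ hinf => ?_, fun Z => ?_⟩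
    · by_contra hunb
      obtain ⟨N, hN⟩ := (not_unbKids_iff hw.infinite (by omega)).1 hunb
      refine (infinite_iff_unbounded (q := fun z => z ∈ Z)).2 hinf ((hw.tendsto (N + 1)).subset ?_)
      exact fun z hz => ⟨hZ z hz, Nat.lt_succ_of_le (hN z hz (hZ z hz))⟩
    · obtain ⟨N, hN⟩ := hw.bounded_one
      obtain ⟨N', hN'⟩ := hw.bounded_two
      exact ⟨(not_unbKids_iff hw.infinite le_rfl).2 ⟨N, fun z _ => hN z⟩,
        (not_unbKids_iff hw.infinite (by omega)).2 ⟨N', fun z _ => hN' z⟩⟩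
  · rintro ⟨hinf, ht, hb⟩
    obtain ⟨N, hN⟩ := (not_unbKids_iff hinf le_rfl).1 (hb Set.univ).1
    obtain ⟨N', hN'⟩ := (not_unbKids_iff hinf (by omega)).1 (hb Set.univ).2
    refine ⟨hinf, fun k => ?_, ⟨N, fun x => hN x (Set.mem_univ x)⟩,
      ⟨N', fun x => hN' x (Set.mem_univ x)⟩⟩
    by_contra hk
    refine (not_unbKids_iff hinf (by omega)).2 ⟨k, fun z hz _ => hz.2.le⟩
      (ht {x | x ∈ heads w 3 ∧ (kids w 3 x).ncard < k} (fun z hz => hz.1)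
        (infinite_iff_unbounded.1 hk))

theorem basic_iff {w : ℕ → Fin 4} : Basic w ↔ HasInfinitelyManyOnes w ∧ Regular w ∧
    (EventuallyConst w (rootKids w) ∧ ∀ S, OnePerRoot w S → EventuallyConst w (rootIdx w S) →
      EventuallyConst w (rootDeg w S)) ∧ StartsWithZeros w := by
  have h : Regular w → ((∀ S, MixLE (rootKids w) (shift w (rootKids w)) (nodeOf w 2) ∧
      (OnePerRoot w S → MixLE (rootIdx w S) (shift w (rootIdx w S)) (nodeOf w 2) →
        MixLE (rootDeg w S) (shift w (rootDeg w S)) (nodeOf w 3))) ↔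
      (EventuallyConst w (rootKids w) ∧ ∀ S, OnePerRoot w S → EventuallyConst w (rootIdx w S) →
      EventuallyConst w (rootDeg w S))) := by
    intro hw
    rw [forall_and, hw.mixLE_rootKids_iff rfl]
    -- The condition on root degrees does not involve `S`, so its quantifier disappears.
    refine and_congr (forall_const _) (forall_congr' fun S => ?_)
    rw [hw.mixLE_rootIdx_iff rfl]
    exact forall_congr' fun hS => by rw [hw.mixLE_rootDeg_iff rfl hS]
  rw [Basic, regular_iff]
  constructor
  · rintro ⟨h1, h2, h3, h4, h5, h6⟩
    exact ⟨h1, ⟨h2, h3, h4⟩, (h (regular_iff.2 ⟨h2, h3, h4⟩)).1 h5, h6⟩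
  · rintro ⟨h1, ⟨h2, h3, h4⟩, h5, h6⟩
    exact ⟨h1, h2, h3, h4, (h (regular_iff.2 ⟨h2, h3, h4⟩)).2 h5, h6⟩

theorem encodesAcceptingRun_iff_basic {M : MinskyMachine} {w : ℕ → Fin 4} :
    EncodesAcceptingRun M w ↔ Basic w ∧ ReachesFinal w M := by
  rw [encodesAcceptingRun_iff, basic_iff]
  tauto

namespace MSOU.Def

theorem unbKids {n m : ℕ} (i : ℕ) {Z : ℕ} (hZ : Z < m) :
    Def n m (fun w _ μ => UnbKids w i (μ Z)) := by
  refine unb (fun w _ μ Y => ∃ z, z ∈ μ Z ∧ z ∈ heads w i ∧ ∀ y, y ∈ Y → y ∈ kids w i z) ?_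
  refine ex (and (mem ?_ ?_) (and (mem_heads i ?_) (all (imp (mem ?_ ?_) (mem_kids i ?_ ?_)))))
  all_goals omega

theorem basic : Def 0 0 (fun w _ _ => Basic w) := by
  refine and hasInfinitelyManyOnes (and (heads_infinite 1) (and (allSet (imp
    (all (imp (mem ?_ ?_) (mem_heads 3 ?_))) (imp (all (ex (and (lt ?_ ?_) (mem ?_ ?_))))
    (unbKids 3 ?_)))) (and (allSet (and (not (unbKids 1 ?_)) (not (unbKids 2 ?_))))
    (and (allSet (and (mixLE rootKids (shift rootKids) 2 (S := 0) ?_)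
    (imp (onePerRoot ?_) (imp (mixLE rootIdx (shift rootIdx) 2 ?_)
    (mixLE rootDeg (shift rootDeg) 3 ?_))))) startsWithZeros))))
  all_goals omega

end MSOU.Def

/-! ### Assembling the sentence of a machine -/

namespace MSOU

/-- The set variables `X` and `Y` have the same value. -/
def eqSet (X Y : ℕ) : MSOU :=
  .neg (.exElem 0 (.neg (.conj (.neg (.conj (.mem 0 X) (.neg (.mem 0 Y))))
    (.neg (.conj (.mem 0 Y) (.neg (.mem 0 X)))))))

theorem sat_eqSet {w : ℕ → Fin 4} {X Y : ℕ} {ν : ℕ → ℕ} {μ : ℕ → Set ℕ} :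
    Sat w (eqSet X Y) ν μ ↔ μ X = μ Y := by
  simp only [eqSet, Sat, Function.update_self, Set.ext_iff, not_exists, not_not]
  exact forall_congr' fun x => by tauto

/-- The formula `φ` with the value of the set variable `X` replaced by the value of `Y`. -/
def withCopy (X Y : ℕ) (φ : MSOU) : MSOU := .exSet X (.conj (eqSet X Y) φ)

/-- Rebinding `X` to the value of `Y` plays the role of substitution without entering `φ`, so bound
variables cannot be captured. With `X ≠ Y`, the value of `Y` survives the rebinding. -/
theorem sat_withCopy {w : ℕ → Fin 4} {X Y : ℕ} {φ : MSOU} {ν : ℕ → ℕ} {μ : ℕ → Set ℕ}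
    (hXY : X ≠ Y) : Sat w (withCopy X Y φ) ν μ ↔ Sat w φ ν (Function.update μ X (μ Y)) := by
  simp [withCopy, Sat, sat_eqSet, Function.update_of_ne hXY.symm]

theorem freeElem_withCopy (X Y : ℕ) (φ : MSOU) : (withCopy X Y φ).freeElem = φ.freeElem := by
  simp [withCopy, eqSet, freeElem]

theorem freeSet_withCopy (X Y : ℕ) (φ : MSOU) :
    (withCopy X Y φ).freeSet = ({X, Y} ∪ φ.freeSet).erase X := by
  simp only [withCopy, eqSet, freeSet]
  ext Z
  simp only [Finset.mem_erase, Finset.mem_union, Finset.mem_singleton, Finset.mem_insert]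
  tauto

section Machine

/-- Formulas expressing the parts of the definition of the language of a machine. -/
structure Parts where
  basic : MSOU
  first : MSOU
  last : MSOU
  closed : Fin 2 × CounterOp → MSOU

/-- The set variable that stands for the nodes with state `q`. -/
def stateVar (q : ℕ) : ℕ := q + 2

variable (T : Parts)

/-- The sets of nodes with given states are closed under the transition `t`. -/
def transFormula (t : ℕ × Fin 2 × CounterOp × ℕ) : MSOU :=
  withCopy 0 (stateVar t.1) (withCopy 1 (stateVar t.2.2.2) (T.closed (t.2.1, t.2.2.1)))

/-- The sets of nodes with given states contradict the existence of an accepting run. -/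
def counterFormula (a b : ℕ) (l : List (ℕ × Fin 2 × CounterOp × ℕ)) : MSOU :=
  l.foldr (fun t φ => .conj (transFormula T t) φ)
    (.conj (withCopy 0 (stateVar a) T.first) (.neg (withCopy 0 (stateVar b) T.last)))

/-- Quantification over the set variables that stand for the states of a list of transitions. -/
def exStates (l : List (ℕ × Fin 2 × CounterOp × ℕ)) (φ : MSOU) : MSOU :=
  l.foldr (fun t φ => .exSet (stateVar t.1) (.exSet (stateVar t.2.2.2) φ)) φ

/-- The sentence that defines the language of the machine with initial state `a`, final state `b`
and list of transitions `l`. -/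
def machineFormula (a b : ℕ) (l : List (ℕ × Fin 2 × CounterOp × ℕ)) : MSOU :=
  .conj T.basic (.neg (.exSet (stateVar a) (.exSet (stateVar b)
    (exStates l (counterFormula T a b l)))))

/-- A variable may be quantified several times; only the innermost quantifier counts, so the net
effect is a free choice of values for the listed variables. -/
theorem sat_exStates {w : ℕ → Fin 4} {l : List (ℕ × Fin 2 × CounterOp × ℕ)} {φ : MSOU}
    {ν : ℕ → ℕ} {μ : ℕ → Set ℕ} : Sat w (exStates l φ) ν μ ↔
      ∃ μ', (∀ X, (∀ t ∈ l, X ≠ stateVar t.1 ∧ X ≠ stateVar t.2.2.2) → μ' X = μ X) ∧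
        Sat w φ ν μ' := by
  induction l generalizing μ with
  | nil =>
    constructor
    · exact fun h => ⟨μ, fun _ _ => rfl, h⟩
    · rintro ⟨μ', h, hs⟩
      rwa [show μ = μ' from funext fun X => (h X (by simp)).symm]
  | cons t l ih =>
    simp only [exStates, List.foldr_cons, Sat] at ih ⊢
    simp only [ih]
    constructor
    · rintro ⟨S, S', μ', h, hs⟩
      refine ⟨μ', fun X hX => ?_, hs⟩
      rw [h X fun t ht => hX t (List.mem_cons_of_mem _ ht),
        Function.update_of_ne (hX t List.mem_cons_self).2,
        Function.update_of_ne (hX t List.mem_cons_self).1]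
    · rintro ⟨μ', h, hs⟩
      -- Both quantifiers are given the values of the final valuation, so that later
      -- requantification changes nothing.
      refine ⟨μ' (stateVar t.1), μ' (stateVar t.2.2.2), μ', fun X hX => ?_, hs⟩
      by_cases h2 : X = stateVar t.2.2.2
      · rw [h2, Function.update_self]
      by_cases h1 : X = stateVar t.1
      · rw [Function.update_of_ne h2, h1, Function.update_self]
      rw [Function.update_of_ne h2, Function.update_of_ne h1]
      refine h X fun t' ht' => ?_
      rcases List.mem_cons.1 ht' with rfl | ht'
      · exact ⟨h1, h2⟩
      · exact hX t' ht'

theorem freeElem_exStates (l : List (ℕ × Fin 2 × CounterOp × ℕ)) (φ : MSOU) :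
    (exStates l φ).freeElem = φ.freeElem := by
  induction l with
  | nil => rfl
  | cons t l ih => exact ih

theorem mem_freeSet_exStates {l : List (ℕ × Fin 2 × CounterOp × ℕ)} {φ : MSOU} {X : ℕ}
    (h : X ∈ (exStates l φ).freeSet) :
    X ∈ φ.freeSet ∧ ∀ t ∈ l, X ≠ stateVar t.1 ∧ X ≠ stateVar t.2.2.2 := by
  induction l with
  | nil => exact ⟨h, by simp⟩
  | cons t l ih =>
    have h' : X ∈ ((exStates l φ).freeSet.erase (stateVar t.2.2.2)).erase (stateVar t.1) := h
    simp only [Finset.mem_erase] at h'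
    obtain ⟨h1, h2, h3⟩ := h'
    obtain ⟨h4, h5⟩ := ih h3
    exact ⟨h4, List.forall_mem_cons.2 ⟨⟨h1, h2⟩, h5⟩⟩

/-- The parts express what they should. -/
structure Parts.Correct : Prop where
  basic_freeElem : T.basic.freeElem = ∅
  basic_freeSet : T.basic.freeSet = ∅
  sat_basic : ∀ w ν μ, Sat w T.basic ν μ ↔ Basic w
  first_freeElem : T.first.freeElem = ∅
  first_freeSet : T.first.freeSet ⊆ {0}
  sat_first : ∀ w ν μ, Sat w T.first ν μ ↔ ContainsFirst w (μ 0)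
  last_freeElem : T.last.freeElem = ∅
  last_freeSet : T.last.freeSet ⊆ {0}
  sat_last : ∀ w ν μ, Sat w T.last ν μ ↔ ContainsLast w (μ 0)
  closed_freeElem : ∀ c, (T.closed c).freeElem = ∅
  closed_freeSet : ∀ c, (T.closed c).freeSet ⊆ {0, 1}
  sat_closed : ∀ c w ν μ, Sat w (T.closed c) ν μ ↔ ClosedUnder w c.1 c.2 (μ 0) (μ 1)

/-- The parts amount to finitely many formulas that do not depend on the machine, so choosing them
nonconstructively does not endanger computability. -/
theorem exists_parts : ∃ T : Parts, T.Correct := by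
  obtain ⟨b, b1, b2, b3⟩ := Def.basic
  obtain ⟨f, f1, f2, f3⟩ := Def.containsFirst (n := 0) (m := 1) (X := 0) (by omega)
  obtain ⟨l, l1, l2, l3⟩ := Def.containsLast (n := 0) (m := 1) (X := 0) (by omega)
  choose c c1 c2 c3 using fun c : Fin 2 × CounterOp =>
    Def.closedUnder (n := 0) (m := 2) c.1 c.2 (X := 0) (X' := 1) (by omega) (by omega)
  refine ⟨⟨b, f, l, c⟩, Finset.subset_empty.1 b1, Finset.subset_empty.1 b2, b3,
    Finset.subset_empty.1 f1, f2, f3, Finset.subset_empty.1 l1, l2, l3,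
    fun p => Finset.subset_empty.1 (c1 p), fun p => (c2 p).trans ?_, c3⟩
  decide

variable {T}

theorem Parts.Correct.sat_transFormula (hT : T.Correct) {w : ℕ → Fin 4}
    {t : ℕ × Fin 2 × CounterOp × ℕ} {ν : ℕ → ℕ} {μ : ℕ → Set ℕ} :
    Sat w (transFormula T t) ν μ ↔
      ClosedUnder w t.2.1 t.2.2.1 (μ (stateVar t.1)) (μ (stateVar t.2.2.2)) := by
  -- The offset in `stateVar` reserves the variables `0` and `1` for the arguments of the parts.
  have h0 : ∀ q, (0 : ℕ) ≠ stateVar q := fun q => by simp [stateVar]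
  have h1 : ∀ q, (1 : ℕ) ≠ stateVar q := fun q => by simp [stateVar]
  rw [transFormula, sat_withCopy (h0 _), sat_withCopy (h1 _), hT.sat_closed]
  rw [Function.update_of_ne (by omega), Function.update_self, Function.update_self,
    Function.update_of_ne (h0 _).symm]

theorem Parts.Correct.sat_counterFormula (hT : T.Correct) {w : ℕ → Fin 4} {a b : ℕ}
    {l : List (ℕ × Fin 2 × CounterOp × ℕ)} {ν : ℕ → ℕ} {μ : ℕ → Set ℕ} :
    Sat w (counterFormula T a b l) ν μ ↔
      (∀ t ∈ l, ClosedUnder w t.2.1 t.2.2.1 (μ (stateVar t.1)) (μ (stateVar t.2.2.2))) ∧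
      ContainsFirst w (μ (stateVar a)) ∧ ¬ ContainsLast w (μ (stateVar b)) := by
  have h0 : ∀ q, (0 : ℕ) ≠ stateVar q := fun q => by simp [stateVar]
  induction l with
  | nil =>
    simp only [counterFormula, List.foldr_nil, Sat, sat_withCopy (h0 _), hT.sat_first,
      hT.sat_last, Function.update_self]
    simp
  | cons t l ih =>
    simp only [counterFormula, List.foldr_cons, Sat, hT.sat_transFormula] at ih ⊢
    rw [List.forall_mem_cons, and_assoc]
    exact and_congr_right fun _ => ih

theorem Parts.Correct.sat_machineFormula (hT : T.Correct) {w : ℕ → Fin 4} {M : MinskyMachine}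
    {ν : ℕ → ℕ} {μ : ℕ → Set ℕ} : Sat w (machineFormula T M.init M.final M.trans) ν μ ↔
      Basic w ∧ ReachesFinal w M := by
  rw [machineFormula, Sat, hT.sat_basic]
  refine and_congr_right fun _ => ?_
  simp only [Sat, sat_exStates, hT.sat_counterFormula]
  constructor
  · intro h X hX hcl
    by_contra hlast
    classical
    let used : ℕ → Prop := fun Y => Y = stateVar M.init ∨ Y = stateVar M.final ∨
      ∃ t ∈ M.trans, Y = stateVar t.1 ∨ Y = stateVar t.2.2.2
    -- The family `X` covers all numbers as states, but only the quantified variables may change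
    -- their value; `Y - 2` recovers the state from its variable.
    let μ' : ℕ → Set ℕ := fun Y => if used Y then X (Y - 2) else μ Y
    have hμ' : ∀ q, used (stateVar q) → μ' (stateVar q) = X q := fun q hq => if_pos hq
    refine h ⟨X M.init, X M.final, μ', fun Y hY => ?_, fun t ht => ?_, ?_, ?_⟩
    · by_cases h2 : Y = stateVar M.final
      · rw [h2, Function.update_self, hμ' _ (Or.inr (Or.inl rfl))]
      by_cases h1 : Y = stateVar M.init
      · rw [Function.update_of_ne h2, h1, Function.update_self, hμ' _ (Or.inl rfl)]
      rw [Function.update_of_ne h2, Function.update_of_ne h1]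
      refine if_neg ?_
      rintro (h | h | ⟨t, ht, h⟩)
      · exact h1 h
      · exact h2 h
      · exact h.elim (hY t ht).1 (hY t ht).2
    · rw [hμ' _ (Or.inr (Or.inr ⟨t, ht, Or.inl rfl⟩)), hμ' _ (Or.inr (Or.inr ⟨t, ht, Or.inr rfl⟩))]
      exact hcl t ht
    · rwa [hμ' _ (Or.inl rfl)]
    · rwa [hμ' _ (Or.inr (Or.inl rfl))]
  · rintro h ⟨S, S', μ', -, hcl, hfirst, hlast⟩
    exact hlast (h (fun q => μ' (stateVar q)) hfirst hcl)

theorem Parts.Correct.freeSet_withCopy_subset {φ : MSOU} {q : ℕ} (h : φ.freeSet ⊆ {0}) {X : ℕ}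
    (hX : X ∈ (withCopy 0 (stateVar q) φ).freeSet) : X = stateVar q := by
  rw [freeSet_withCopy] at hX
  simp only [Finset.mem_erase, Finset.mem_union, Finset.mem_insert, Finset.mem_singleton] at hX
  have h1 := fun hX => Finset.mem_singleton.1 (@h X hX)
  tauto

theorem Parts.Correct.isSentence_machineFormula (hT : T.Correct) (a b : ℕ)
    (l : List (ℕ × Fin 2 × CounterOp × ℕ)) : (machineFormula T a b l).IsSentence := by
  have hE : ∀ l', (counterFormula T a b l').freeElem = ∅ := by
    intro l'
    induction l' with
    | nil => simp [counterFormula, freeElem, freeElem_withCopy, hT.first_freeElem, hT.last_freeElem]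
    | cons t l' ih =>
      simp only [counterFormula, List.foldr_cons, freeElem] at ih ⊢
      rw [ih, transFormula, freeElem_withCopy, freeElem_withCopy, hT.closed_freeElem]
      rfl
  have hS : ∀ l' X, X ∈ (counterFormula T a b l').freeSet → X = stateVar a ∨ X = stateVar b ∨
      ∃ t ∈ l', X = stateVar t.1 ∨ X = stateVar t.2.2.2 := by
    intro l' X
    induction l' with
    | nil =>
      intro hX
      rcases Finset.mem_union.1 hX with hX | hX
      · exact Or.inl (freeSet_withCopy_subset hT.first_freeSet hX)
      · exact Or.inr (Or.inl (freeSet_withCopy_subset hT.last_freeSet hX))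
    | cons t l' ih =>
      intro hX
      rcases Finset.mem_union.1 hX with hX | hX
      · refine Or.inr (Or.inr ⟨t, List.mem_cons_self, ?_⟩)
        have h1 : X ∈ (T.closed (t.2.1, t.2.2.1)).freeSet → X = 0 ∨ X = 1 := fun h => by
          simpa using hT.closed_freeSet _ h
        simp only [transFormula, freeSet_withCopy, Finset.mem_erase, Finset.mem_union,
          Finset.mem_insert, Finset.mem_singleton] at hX
        tauto
      · rcases ih hX with h | h | ⟨t', ht', h⟩
        · exact Or.inl h
        · exact Or.inr (Or.inl h)
        · exact Or.inr (Or.inr ⟨t', List.mem_cons_of_mem _ ht', h⟩)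
  constructor
  · simp only [machineFormula, freeElem, freeElem_exStates, hE, hT.basic_freeElem]
    rfl
  · rw [Finset.eq_empty_iff_forall_notMem]
    intro X hX
    simp only [machineFormula, freeSet, hT.basic_freeSet, Finset.empty_union,
      Finset.mem_erase] at hX
    obtain ⟨h1, h2, h3⟩ := hX
    obtain ⟨h4, h5⟩ := mem_freeSet_exStates h3
    rcases hS l X h4 with h | h | ⟨t, ht, h | h⟩
    · exact h1 h
    · exact h2 h
    · exact (h5 t ht).1 h
    · exact (h5 t ht).2 h

end Machine

/-! ### Computability of the translation -/

section Computability

theorem primrec_mem (x : ℕ) : Primrec (mem x) := by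
  refine Primrec.encode_iff.1 ?_
  exact Primrec.nat_add.comp (Primrec.nat_mul.comp (Primrec.const 11)
    (Primrec₂.natPair.comp (Primrec.const x) Primrec.id)) (Primrec.const 1)

theorem primrec_neg : Primrec neg := by
  refine Primrec.encode_iff.1 ?_
  exact Primrec.nat_add.comp (Primrec.nat_mul.comp (Primrec.const 11) Primrec.encode)
    (Primrec.const 6)

theorem primrec_conj : Primrec₂ conj := by
  refine Primrec₂.encode_iff.1 ?_
  exact Primrec.nat_add.comp (Primrec.nat_mul.comp (Primrec.const 11)
    (Primrec₂.natPair.comp (Primrec.encode.comp Primrec.fst) (Primrec.encode.comp Primrec.snd)))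
    (Primrec.const 7)

theorem primrec_exElem : Primrec₂ exElem := by
  refine Primrec₂.encode_iff.1 ?_
  exact Primrec.nat_add.comp (Primrec.nat_mul.comp (Primrec.const 11)
    (Primrec₂.natPair.comp Primrec.fst (Primrec.encode.comp Primrec.snd))) (Primrec.const 8)

theorem primrec_exSet : Primrec₂ exSet := by
  refine Primrec₂.encode_iff.1 ?_
  exact Primrec.nat_add.comp (Primrec.nat_mul.comp (Primrec.const 11)
    (Primrec₂.natPair.comp Primrec.fst (Primrec.encode.comp Primrec.snd))) (Primrec.const 9)

theorem primrec_eqSet (X : ℕ) : Primrec (eqSet X) := by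
  have hX : Primrec fun _ : ℕ => mem 0 X := Primrec.const _
  have hY : Primrec fun Y : ℕ => mem 0 Y := primrec_mem 0
  exact primrec_neg.comp (primrec_exElem.comp (Primrec.const 0) (primrec_neg.comp
    (primrec_conj.comp (primrec_neg.comp (primrec_conj.comp hX (primrec_neg.comp hY)))
      (primrec_neg.comp (primrec_conj.comp hY (primrec_neg.comp hX))))))

theorem primrec_withCopy (X : ℕ) : Primrec₂ (withCopy X) :=
  primrec_exSet.comp (Primrec.const X)
    (primrec_conj.comp ((primrec_eqSet X).comp Primrec.fst) Primrec.snd)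

theorem primrec_stateVar : Primrec stateVar := Primrec.nat_add.comp Primrec.id (Primrec.const 2)

variable (T : Parts)

theorem primrec_transFormula : Primrec (transFormula T) := by
  -- A function on a finite type is primitive recursive whatever its values are, which covers the
  -- chosen formulas `T.closed`.
  have : Finite CounterOp := Finite.of_equiv _ CounterOp.equivFin.symm
  have hc : Primrec T.closed := Primrec.dom_finite _
  have h2 : Primrec fun t : ℕ × Fin 2 × CounterOp × ℕ => t.2.2.2 :=
    Primrec.snd.comp (Primrec.snd.comp Primrec.snd)
  have h3 : Primrec fun t : ℕ × Fin 2 × CounterOp × ℕ => (t.2.1, t.2.2.1) :=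
    (Primrec.fst.comp Primrec.snd).pair (Primrec.fst.comp (Primrec.snd.comp Primrec.snd))
  exact (primrec_withCopy 0).comp (primrec_stateVar.comp Primrec.fst)
    ((primrec_withCopy 1).comp (primrec_stateVar.comp h2) (hc.comp h3))

theorem primrec_machineFormula : Primrec fun t : ℕ × ℕ × List (ℕ × Fin 2 × CounterOp × ℕ) =>
    machineFormula T t.1 t.2.1 t.2.2 := by
  have hl : Primrec fun t : ℕ × ℕ × List (ℕ × Fin 2 × CounterOp × ℕ) => t.2.2 :=
    Primrec.snd.comp Primrec.snd
  have ha : Primrec fun t : ℕ × ℕ × List (ℕ × Fin 2 × CounterOp × ℕ) => stateVar t.1 :=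
    primrec_stateVar.comp Primrec.fst
  have hb : Primrec fun t : ℕ × ℕ × List (ℕ × Fin 2 × CounterOp × ℕ) => stateVar t.2.1 :=
    primrec_stateVar.comp (Primrec.fst.comp Primrec.snd)
  have hcounter : Primrec fun t : ℕ × ℕ × List (ℕ × Fin 2 × CounterOp × ℕ) =>
      counterFormula T t.1 t.2.1 t.2.2 := by
    refine Primrec.list_foldr (h := fun _ p => .conj (transFormula T p.1) p.2) hl
      (primrec_conj.comp ((primrec_withCopy 0).comp ha (Primrec.const _))
        (primrec_neg.comp ((primrec_withCopy 0).comp hb (Primrec.const _)))) ?_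
    exact (primrec_conj.comp ((primrec_transFormula T).comp (Primrec.fst.comp Primrec.snd))
        (Primrec.snd.comp Primrec.snd))
  have hex : Primrec fun t : ℕ × ℕ × List (ℕ × Fin 2 × CounterOp × ℕ) =>
      exStates t.2.2 (counterFormula T t.1 t.2.1 t.2.2) := by
    refine Primrec.list_foldr
      (h := fun _ p => .exSet (stateVar p.1.1) (.exSet (stateVar p.1.2.2.2) p.2)) hl hcounter ?_
    have hp : Primrec fun x : (ℕ × ℕ × List (ℕ × Fin 2 × CounterOp × ℕ)) ×
        ((ℕ × Fin 2 × CounterOp × ℕ) × MSOU) => x.2.1 := Primrec.fst.comp Primrec.snd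
    exact primrec_exSet.comp (primrec_stateVar.comp (Primrec.fst.comp hp))
      (primrec_exSet.comp (primrec_stateVar.comp
        (Primrec.snd.comp (Primrec.snd.comp (Primrec.snd.comp hp))))
        (Primrec.snd.comp Primrec.snd))
  exact primrec_conj.comp (Primrec.const _) (primrec_neg.comp (primrec_exSet.comp ha
    (primrec_exSet.comp hb hex)))

theorem computable_machineFormula :
    Computable fun M : MinskyMachine => machineFormula T M.init M.final M.trans := by
  have h : Primrec MinskyMachine.equivProd := Primrec.of_equiv
  exact ((primrec_machineFormula T).comp h).to_comp

end Computability

end MSOU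

/-! ### A word with prescribed degrees -/

section Witness

/-- Here `a` enumerates the heads of one depth and `a ∘ b` those one depth above; the stretch that
begins at `a (b k)` ends right before `a (b (k + 1))`. -/
theorem inter_stretch_range {a b : ℕ → ℕ} (ha : StrictMono a) (hb : StrictMono b) (k : ℕ) :
    Set.range a ∩ stretch (Set.range fun j => a (b j)) (a (b k)) =
      a '' Set.Ico (b k) (b (k + 1)) := by
  ext y
  constructor
  · rintro ⟨⟨t, rfl⟩, h1, h2⟩
    exact ⟨t, ⟨ha.le_iff_le.1 h1, ha.lt_iff_lt.1
      (h2 _ ⟨k + 1, rfl⟩ (ha (hb (Nat.lt_succ_self k))))⟩, rfl⟩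
  · rintro ⟨t, ⟨h1, h2⟩, rfl⟩
    refine ⟨⟨t, rfl⟩, ha.monotone h1, ?_⟩
    rintro _ ⟨j, rfl⟩ hlt
    have hkj : k + 1 ≤ j := hb.lt_iff_lt.1 (ha.lt_iff_lt.1 hlt)
    exact ha (h2.trans_le (hb.monotone hkj))

/-- If the letter `1` is at position `0` and every letter other than `4` is followed by `4`, then
the nodes of depth `i` begin after the letters up to `i`. -/
theorem heads_eq_of_separated {w : ℕ → Fin 4} (h0 : labelAt w 0 = 1)
    (hsep : ∀ x, labelAt w x ≤ 3 → labelAt w (x + 1) = 4) {i : ℕ} (hi : 1 ≤ i) (hi3 : i ≤ 3) :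
    heads w i = {y | ∃ x, labelAt w x ≤ i ∧ y = x + 1} := by
  have hlab : ∀ x, labelAt w x ≤ 4 := fun x => (w x).isLt
  ext y
  constructor
  · rintro ⟨hy, h⟩
    have hy4 : labelAt w y = 4 := hy
    obtain ⟨x, rfl⟩ : ∃ x, y = x + 1 := Nat.exists_eq_succ_of_ne_zero fun h => by
      rw [h] at hy4
      omega
    refine ⟨x, ?_, rfl⟩
    by_contra! hlt
    by_cases hx4 : labelAt w x = 4
    · exact h x (by omega) hx4 ((sameAncestor_iff_of_le (by omega)).2
        (Or.inr ⟨by omega, fun z h1 h2 => by omega⟩))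
    · obtain ⟨z, rfl⟩ : ∃ z, x = z + 1 := Nat.exists_eq_succ_of_ne_zero fun h => by
        rw [h] at hlt
        omega
      have hz : labelAt w z = 4 := by
        by_contra hz
        have := hsep z (by have := hlab z; omega)
        omega
      refine h z (by omega) hz ((sameAncestor_iff_of_le (by omega)).2
        (Or.inr ⟨by omega, fun u h1 h2 => ?_⟩))
      obtain rfl : u = z + 1 := by omega
      exact hlt
  · rintro ⟨x, hx, rfl⟩
    refine ⟨hsep x (by omega), fun y hy hy4 hs => ?_⟩
    have hyx : y ≠ x := by
      rintro rfl
      have : labelAt w y = 4 := hy4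
      omega
    rcases (sameAncestor_iff_of_le (by omega)).1 hs with h | ⟨-, h⟩
    · omega
    · exact absurd (h x (by omega) (by omega)) (by omega)

theorem strictMono_sum {f : ℕ → ℕ} (hf : ∀ i, 0 < f i) :
    StrictMono fun k => ∑ i ∈ Finset.range k, f i :=
  strictMono_nat_of_lt_succ fun k => by
    rw [Finset.sum_range_succ]
    exact Nat.lt_add_of_pos_right (hf k)

/-- All three kinds of nodes are laid out by partial sums of their degrees: `d` for roots, `m (l %
d)` for the `l`-th depth 2 node, and `t + 1` for the `t`-th depth 3 node. -/
theorem exists_word_of_degrees {d : ℕ} (hd : 0 < d) {m : ℕ → ℕ} (hm : ∀ i, 0 < m i) :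
    ∃ w : ℕ → Fin 4, HasInfinitelyManyOnes w ∧ (heads w 1).Infinite ∧
      (∀ k, {x | x ∈ heads w 3 ∧ (kids w 3 x).ncard < k}.Finite) ∧ EventualDegrees w d m := by
  classical
  -- The `t`-th letter other than `4` is at position `s t` and is followed by `t + 1` leaves, whence
  -- the summand `u + 2`. The `l`-th depth 2 node begins with the depth 3 node number `g l`, and the
  -- `k`-th root with the depth 2 node number `k * d`.
  let s : ℕ → ℕ := fun t => ∑ u ∈ Finset.range t, (u + 2)
  let g : ℕ → ℕ := fun l => ∑ j ∈ Finset.range l, m (j % d)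
  have hs : StrictMono s := strictMono_sum fun _ => by omega
  have hg : StrictMono g := strictMono_sum fun _ => hm _
  have hmul : StrictMono fun k => k * d := fun a b h => Nat.mul_lt_mul_of_pos_right h hd
  have hs1 : ∀ t, s (t + 1) = s t + (t + 2) := fun t => Finset.sum_range_succ _ _
  have hg1 : ∀ l, g (l + 1) = g l + m (l % d) := fun l => Finset.sum_range_succ _ _
  let w : ℕ → Fin 4 := fun x =>
    if ∃ k, x = s (g (k * d)) then 0 else if ∃ l, x = s (g l) then 1
    else if ∃ t, x = s t then 2 else 3
  have hw1 : ∀ x, labelAt w x ≤ 1 ↔ ∃ k, x = s (g (k * d)) := by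
    intro x
    simp only [labelAt, w]
    split_ifs with h1 h2 h3 <;> simp [h1]
  have hw2 : ∀ x, labelAt w x ≤ 2 ↔ ∃ l, x = s (g l) := by
    intro x
    simp only [labelAt, w]
    split_ifs with h1 h2 h3
    · obtain ⟨k, rfl⟩ := h1
      exact iff_of_true (by simp) ⟨_, rfl⟩
    all_goals simp [h2]
  have hw3 : ∀ x, labelAt w x ≤ 3 ↔ ∃ t, x = s t := by
    intro x
    simp only [labelAt, w]
    split_ifs with h1 h2 h3
    · obtain ⟨k, rfl⟩ := h1
      simp
    · obtain ⟨k, rfl⟩ := h2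
      simp
    all_goals simp [h3]
  have hlab : ∀ x, labelAt w x ≤ 4 := fun x => (w x).isLt
  have hpos : ∀ x, 1 ≤ labelAt w x := fun x => Nat.succ_le_succ (Nat.zero_le _)
  have hleaf : ∀ x, labelAt w x = 4 ↔ ¬ ∃ t, x = s t := by
    intro x
    rw [← hw3]
    have := hlab x
    omega
  have h0 : labelAt w 0 = 1 := by
    have h1 := (hw1 0).2 ⟨0, by simp [s, g]⟩
    have := hpos 0
    omega
  have hsep : ∀ x, labelAt w x ≤ 3 → labelAt w (x + 1) = 4 := by
    intro x hx
    obtain ⟨t, rfl⟩ := (hw3 x).1 hx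
    rw [hleaf]
    rintro ⟨u, hu⟩
    have h1 : t + 1 ≤ u := hs.lt_iff_lt.1 (by omega)
    have h2 := hs.monotone h1
    rw [hs1] at h2
    omega
  let a : ℕ → ℕ := fun t => s t + 1
  have ha : StrictMono a := fun t u h => Nat.succ_lt_succ (hs h)
  have hag : StrictMono fun l => a (g l) := ha.comp hg
  have hH3 : heads w 3 = Set.range a := by
    rw [heads_eq_of_separated h0 hsep (by omega) le_rfl]
    ext y
    simp only [hw3, Set.mem_range, Set.mem_ofPred_eq, a]
    exact ⟨fun ⟨x, ⟨t, hx⟩, hy⟩ => ⟨t, by rw [hy, hx]⟩, fun ⟨t, hy⟩ => ⟨_, ⟨t, rfl⟩, hy.symm⟩⟩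
  have hH2 : heads w 2 = Set.range fun l => a (g l) := by
    rw [heads_eq_of_separated h0 hsep (by omega) (by omega)]
    ext y
    simp only [hw2, Set.mem_range, Set.mem_ofPred_eq, a]
    exact ⟨fun ⟨x, ⟨t, hx⟩, hy⟩ => ⟨t, by rw [hy, hx]⟩, fun ⟨t, hy⟩ => ⟨_, ⟨t, rfl⟩, hy.symm⟩⟩
  have hH1 : heads w 1 = Set.range fun k => a (g (k * d)) := by
    rw [heads_eq_of_separated h0 hsep (by omega) (by omega)]
    ext y
    simp only [hw1, Set.mem_range, Set.mem_ofPred_eq, a]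
    exact ⟨fun ⟨x, ⟨t, hx⟩, hy⟩ => ⟨t, by rw [hy, hx]⟩, fun ⟨t, hy⟩ => ⟨_, ⟨t, rfl⟩, hy.symm⟩⟩
  have hK1 : ∀ k, kids w 1 (a (g (k * d))) =
      (fun l => a (g l)) '' Set.Ico (k * d) ((k + 1) * d) := by
    intro k
    rw [kids, hH1, hH2]
    exact inter_stretch_range hag hmul k
  have hK2 : ∀ l, kids w 2 (a (g l)) = a '' Set.Ico (g l) (g (l + 1)) := by
    intro l
    rw [kids, hH2, hH3]
    exact inter_stretch_range ha hg l
  have hK3 : ∀ t, t + 1 ≤ (kids w 3 (a t)).ncard := by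
    intro t
    -- The positions strictly between two consecutive separators are leaves below one depth 3 node.
    have hsub : Set.Ico (a t) (s (t + 1)) ⊆ kids w 3 (a t) := by
      rintro y ⟨h1, h2⟩
      have h1' : s t + 1 ≤ y := h1
      rw [kids, heads_self, hH3]
      refine ⟨(hleaf y).2 ?_, h1, ?_⟩
      · rintro ⟨u, rfl⟩
        have h3 : t + 1 ≤ u := hs.lt_iff_lt.1 h1'
        exact absurd (hs.monotone h3) (not_le.2 h2)
      · rintro _ ⟨u, rfl⟩ hlt
        have h3 : t + 1 ≤ u := ha.lt_iff_lt.1 hlt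
        exact h2.trans (Nat.lt_succ_of_le (hs.monotone h3))
    have hinf : (heads w 1).Infinite := by
      rw [hH1]
      exact Set.infinite_range_of_injective (hag.comp hmul).injective
    have hle := Set.ncard_le_ncard hsub (kids_finite hinf (by omega) _)
    rw [Set.ncard_eq_toFinset_card', Set.toFinset_Ico, Nat.card_Ico, hs1] at hle
    simp only [a] at hle ⊢
    omega
  have hinf : (heads w 1).Infinite := by
    rw [hH1]
    exact Set.infinite_range_of_injective (hag.comp hmul).injective
  refine ⟨w, ?_, hinf, fun k => ?_, ?_, fun i hi => ?_⟩
  · refine (Set.infinite_range_of_injective ((hs.comp hg).comp hmul).injective).mono ?_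
    rintro _ ⟨k, rfl⟩
    exact le_antisymm ((hw1 _).2 ⟨k, rfl⟩) (hpos _)
  · refine ((Set.finite_Iio k).image a).subset ?_
    rintro x ⟨hx, hlt⟩
    rw [hH3] at hx
    obtain ⟨t, rfl⟩ := hx
    have := hK3 t
    exact ⟨t, Set.mem_Iio.2 (by omega), rfl⟩
  · refine Set.finite_empty.subset ?_
    rintro x ⟨hx, hne⟩
    rw [hH1] at hx
    obtain ⟨k, rfl⟩ := hx
    refine hne ?_
    rw [hK1, Set.ncard_image_of_injective _ hag.injective, Set.ncard_eq_toFinset_card',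
      Set.toFinset_Ico, Nat.card_Ico, Nat.succ_mul]
    omega
  · refine Set.finite_empty.subset ?_
    rintro p ⟨hp, hpi, hne⟩
    rw [hH2] at hp
    obtain ⟨l, rfl⟩ := hp
    have hroot : a (g (l / d * d)) ∈ heads w 1 := by
      rw [hH1]
      exact ⟨l / d, rfl⟩
    have hdiv := Nat.div_add_mod l d
    have hmod := Nat.mod_lt l hd
    rw [Nat.mul_comm] at hdiv
    have hpk : a (g l) ∈ kids w 1 (a (g (l / d * d))) := by
      rw [hK1]
      refine ⟨l, ⟨by omega, ?_⟩, rfl⟩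
      rw [Nat.succ_mul]
      omega
    have hleft : leftKids w 1 (a (g l)) = (fun l => a (g l)) '' Set.Ico (l / d * d) l := by
      rw [leftKids_eq hroot hpk, hK1]
      ext y
      constructor
      · rintro ⟨⟨j, ⟨h1, h2⟩, rfl⟩, hlt⟩
        exact ⟨j, ⟨h1, hag.lt_iff_lt.1 hlt⟩, rfl⟩
      · rintro ⟨j, ⟨h1, h2⟩, rfl⟩
        refine ⟨⟨j, ⟨h1, ?_⟩, rfl⟩, hag h2⟩
        rw [Nat.succ_mul]
        omega
    rw [hleft, Set.ncard_image_of_injective _ hag.injective, Set.ncard_eq_toFinset_card',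
      Set.toFinset_Ico, Nat.card_Ico] at hpi
    refine hne ?_
    change (kids w 2 (a (g l))).ncard = m i
    rw [hK2, Set.ncard_image_of_injective _ ha.injective, Set.ncard_eq_toFinset_card',
      Set.toFinset_Ico, Nat.card_Ico, hg1]
    rw [show l % d = i by omega]
    omega

theorem exists_encodesAcceptingRun {M : MinskyMachine} {ρ : List MinskyConfig}
    (hρ : M.IsAcceptingRun ρ) : ∃ w : ℕ → Fin 4, EncodesAcceptingRun M w := by
  -- Entry `i` belongs to configuration `i / 2` and to the counter given by the parity of `i`. The
  -- degrees are `u i + 1`, hence positive as the construction requires.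
  let u : ℕ → ℕ := fun i => if h : i / 2 < ρ.length then ρ[i / 2].val (Fin.ofNat 2 i) else 0
  have hpos : 0 < ρ.length := by
    cases ρ
    · simp [MinskyMachine.IsAcceptingRun] at hρ
    · simp
  obtain ⟨w, h1, h2, h3, h4⟩ := exists_word_of_degrees (d := 2 * ρ.length) (by omega)
    (m := fun i => u i + 1) fun i => Nat.succ_pos _
  refine ⟨w, h1, hasInfinitelyManyTrees_iff.2 h2, degreeTendsToInfinity_iff.2 h3, 2 * ρ.length,
    fun i => u i + 1, rootDegreeEventually_iff.2 h4.1,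
    fun i => kthChildDegreeEventually_iff.2 (h4.2 i i.isLt), fun i => Nat.succ_pos _, ρ, hρ,
    (describes_iff (u := u)).2 ⟨rfl, fun i hi => ?_⟩⟩
  funext j
  have hj := j.isLt
  have h5 : (2 * i + j.val) / 2 = i := by omega
  have h6 : Fin.ofNat 2 (2 * i + j.val) = j := by
    ext
    simp only [Fin.ofNat]
    omega
  simp only [listedVals, u, h5, h6, hi, dif_pos]

end Witness

theorem mainTheorem2 :
    ∃ f : MinskyMachine → MSOU, Computable f ∧
      ∀ M : MinskyMachine,
        (f M).IsSentence ∧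
        (∀ w : ℕ → Fin 4, MSOU.Models w (f M) ↔ EncodesAcceptingRun M w) ∧
        ((∃ w : ℕ → Fin 4, MSOU.Models w (f M)) ↔
          ∃ ρ : List MinskyConfig, M.IsAcceptingRun ρ) := by
  obtain ⟨T, hT⟩ := MSOU.exists_parts
  have key : ∀ (M : MinskyMachine) (w : ℕ → Fin 4),
      MSOU.Models w (MSOU.machineFormula T M.init M.final M.trans) ↔ EncodesAcceptingRun M w :=
    fun M w => hT.sat_machineFormula.trans encodesAcceptingRun_iff_basic.symm
  refine ⟨_, MSOU.computable_machineFormula T, fun M =>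
    ⟨hT.isSentence_machineFormula _ _ _, key M, ?_⟩⟩
  simp only [key]
  constructor
  · rintro ⟨w, -, -, -, d, m, -, -, -, ρ, hρ, -⟩
    exact ⟨ρ, hρ⟩
  · rintro ⟨ρ, hρ⟩
    exact exists_encodesAcceptingRun hρ
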